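/- **Definitions.** Let $G$ be a finite simple graph on the vertex set $[n]$, with $m$ edges. A *separation* of $G$ is an unordered pair $\{A,B\}$ of vertex sets with $A\cup B=V(G)$, with $A\setminus B$ and $B\setminus A$ nonempty, and with no edge between $A\setminus B$ and $B\setminus A$; its *order* is $|A\cap B|$. It is *minimal* if every vertex of $A\cap B$ has a neighbour in $A\setminus B$ and a neighbour in $B\setminus A$. Two separations $\{A,B\}$, $\{C,D\}$ are *nested* if, after possibly switching $A$ and $B$ and possibly switching $C$ and $D$, we have $A\subseteq C$ and $D\subseteq B$. The *representation* of a set $A\subseteq[n]$ is the increasing list of endpoints $(a_1,a_1',\dots,a_r,a_r')$ of the maximal intervals $[a_j,a_j']$ of which $A$ is the disjoint union; its *length* is $r$. The representation of a separation $\{A,B\}$ consists of the representations of $A$ and of $B$, and its length is the sum of their lengths. Let $(T,\mathcal V)$, $\mathcal V=(V_t)_{t\in V(T)}$, be a tree-decomposition of $G$. An edge $e=t_1t_2$ of $T$ *induces* the separation $\{A_e,B_e\}$, where $A_e$ (resp. $B_e$) is the union of the bags $V_t$ over all nodes $t$ in the component of $T-e$ containing $t_1$ (resp. $t_2$). A set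 $\mathcal S$ of separations *induces* $(T,\mathcal V)$ if $e\mapsto\{A_e,B_e\}$ is a bijection from $E(T)$ to $\mathcal S$. The *torso* at $t$ is the graph with vertex set $V_t$ in which two distinct vertices $u,v\in V_t$ are adjacent if and only if $uv\in E(G)$ or there is an edge $tt'$ of $T$ with $\{u,v\}\subseteq V_t\cap V_{t'}$. **Theorem.** There are an algorithm (a fixed program for a unit-cost word RAM) and a constant $c$ such that the following holds. Let $G$ be a connected graph on the vertex set $[n]$ with $m$ edges, let $\mathcal S=\{\{A_1,B_1\},\dots,\{A_p,B_p\}\}$ be a set of $p\ge 0$ distinct, pairwise nested, minimal separations of $G$, each of order at most $k$, and suppose that the representation of each $\{A_i,B_i\}$ has length at most $\ell$. Given $G$ (as an edge list) and the representations of $\{A_1,B_1\},\dots,\{A_p,B_p\}$, the algorithm computes the tree-decomposition $(T,\mathcal V)$ of $G$ induced by $\mathcal S$ and all its torsos: it outputs the edge list of a tree $T$, the list of the elements of each bag $V_t$, and the edge list of each torso, such that $(T,\mathcal V)$ is a tree-decomposition of $G$ induced by $\mathcal S$. It does so in at most $c\,(n+m+p\ell+pk^2)$ steps, and every number that it computes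 on the way is smaller than $c\,(n+m+p\ell+pk^2)$, so that words of logarithmically many bits suffice. -/

import Mathlib

/-! ## Separations -/

namespace SepTree

variable {V : Type*}

/-- `(A, B)` is a separation of `G`. -/
structure IsSeparation (G : SimpleGraph V) (A B : Set V) : Prop where
  cover : A ∪ B = Set.univ
  left_nonempty : (A \ B).Nonempty
  right_nonempty : (B \ A).Nonempty
  no_edge : ∀ u ∈ A \ B, ∀ v ∈ B \ A, ¬ G.Adj u v

/-- Every vertex of the separator has a neighbour strictly on each side. -/
structure IsMinimalSeparation (G : SimpleGraph V) (A B : Set V) : Prop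
    extends IsSeparation G A B where
  left_neighbor : ∀ x ∈ A ∩ B, ∃ u ∈ A \ B, G.Adj x u
  right_neighbor : ∀ x ∈ A ∩ B, ∃ v ∈ B \ A, G.Adj x v

/-- `(A, B)` and `(C, D)` are nested: `A ⊆ C` and `D ⊆ B`, after possibly switching `A` with `B`
and possibly switching `C` with `D`. -/
def Nested (A B C D : Set V) : Prop :=
  (A ⊆ C ∧ D ⊆ B) ∨ (B ⊆ C ∧ D ⊆ A) ∨ (A ⊆ D ∧ C ⊆ B) ∨ (B ⊆ D ∧ C ⊆ A)

/-! ## Tree-decompositions and torsos -/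

variable {τ : Type*}

/-- `(T, bag)` is a tree-decomposition of `G`. (Connectedness of an induced subgraph includes that
it is non-empty, so every vertex lies in a bag.) -/
structure IsTreeDecomposition (G : SimpleGraph V) (T : SimpleGraph τ) (bag : τ → Set V) : Prop where
  isTree : T.IsTree
  edge_mem : ∀ u v, G.Adj u v → ∃ t, u ∈ bag t ∧ v ∈ bag t
  connected : ∀ v, (T.induce {t | v ∈ bag t}).Connected

/-- The unordered pair `{A_e, B_e}` induced by an edge `e` of `T`: to each endpoint `s` of `e`
corresponds the union of the bags in the component of `T - e` that contains `s`. -/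
def edgeSep (T : SimpleGraph τ) (bag : τ → Set V) (e : Sym2 τ) : Sym2 (Set V) :=
  e.map fun s => {v | ∃ r, (T.deleteEdges {e}).Reachable s r ∧ v ∈ bag r}

/-- The set `𝒮` of (unordered) separations induces `(T, bag)`: the map `e ↦ {A_e, B_e}` is a
bijection from the edges of `T` to `𝒮`. -/
def Induces (𝒮 : Set (Sym2 (Set V))) (T : SimpleGraph τ) (bag : τ → Set V) : Prop :=
  Set.BijOn (edgeSep T bag) T.edgeSet 𝒮

/-- The torso at the node `t`: its vertex set is the bag of `t`, and two distinct vertices of the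
bag are adjacent if they are adjacent in `G` or lie together in an adhesion set at `t`. -/
def torso (G : SimpleGraph V) (T : SimpleGraph τ) (bag : τ → Set V) (t : τ) :
    (⊤ : SimpleGraph V).Subgraph where
  verts := bag t
  Adj u v := u ≠ v ∧ u ∈ bag t ∧ v ∈ bag t ∧
    (G.Adj u v ∨ ∃ t', T.Adj t t' ∧ u ∈ bag t ∩ bag t' ∧ v ∈ bag t ∩ bag t')
  adj_sub h := h.1
  edge_vert h := h.2.1
  symm := ⟨fun _ _ h => ⟨h.1.symm, h.2.2.1, h.2.1,
    h.2.2.2.imp (fun a => a.symm) (fun ⟨t', ht, hu, hv⟩ => ⟨t', ht, hv, hu⟩)⟩⟩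

/-! ## Lists representing sets, graphs and separations -/

/-- `L` lists every element of `s` exactly once (in any order). -/
def ListsSet {α : Type*} (L : List α) (s : Set α) : Prop :=
  L.Nodup ∧ ∀ x, x ∈ L ↔ x ∈ s

/-- `E` is an edge list: it lists every edge of `s` exactly once, in any order, with its two
endpoints in any order. -/
def ListsEdges {α : Type*} (E : List (α × α)) (s : Set (Sym2 α)) : Prop :=
  ListsSet (E.map fun e => s(e.1, e.2)) s

/-- `L = [(a₁, a₁'), …, (a_r, a_r')]` is the representation of `A` as the disjoint union of its
maximal intervals `[a_i, a_i']`, from left to right. Its length is `L.length`. -/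
structure IsIntervalRep {n : ℕ} (A : Set (Fin n)) (L : List (ℕ × ℕ)) : Prop where
  le : ∀ I ∈ L, I.1 ≤ I.2
  gap : L.Pairwise fun I J => I.2 + 1 < J.1
  mem_iff : ∀ x : ℕ, (∃ I ∈ L, I.1 ≤ x ∧ x ≤ I.2) ↔ ∃ h : x < n, (⟨x, h⟩ : Fin n) ∈ A

/-- A list of words, preceded by its length. -/
def block (L : List ℕ) : List ℕ := L.length :: L

/-- A list of pairs of words, preceded by its length. -/
def pairBlock (L : List (ℕ × ℕ)) : List ℕ := L.length :: L.flatMap fun e => [e.1, e.2]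

/-- An edge list on `Fin n` as a list of pairs of words. -/
def toWords {n : ℕ} (E : List (Fin n × Fin n)) : List (ℕ × ℕ) :=
  E.map fun e => (e.1.val, e.2.val)

/-- The input words: `n`, the edge list of the graph, the number `p` of separations, and the
representations of their two sides. -/
def encodeInput (n : ℕ) (E : List (Fin n × Fin n)) (p : ℕ) (repA repB : Fin p → List (ℕ × ℕ)) :
    List ℕ :=
  n :: pairBlock (toWords E) ++
    p :: (List.finRange p).flatMap fun i => pairBlock (repA i) ++ pairBlock (repB i)

/-- The output words: the number `q` of nodes of the tree, the edge list of the tree, the bags of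
the nodes, and the edge lists of the torsos of the nodes. -/
def encodeOutput {n q : ℕ} (F : List (Fin q × Fin q)) (bagList : Fin q → List (Fin n))
    (torsoList : Fin q → List (Fin n × Fin n)) : List ℕ :=
  q :: pairBlock (toWords F) ++
    ((List.finRange q).flatMap fun t => block ((bagList t).map Fin.val)) ++
    (List.finRange q).flatMap fun t => pairBlock (toWords (torsoList t))

/-- `out` encodes a tree-decomposition of `G` induced by `𝒮`, together with all its torsos. -/
def IsDecompositionOutput {n : ℕ} (G : SimpleGraph (Fin n)) (𝒮 : Set (Sym2 (Set (Fin n))))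
    (out : List ℕ) : Prop :=
  ∃ (q : ℕ) (T : SimpleGraph (Fin q)) (bag : Fin q → Set (Fin n))
    (F : List (Fin q × Fin q)) (bagList : Fin q → List (Fin n))
    (torsoList : Fin q → List (Fin n × Fin n)),
    IsTreeDecomposition G T bag ∧ Induces 𝒮 T bag ∧
    ListsEdges F T.edgeSet ∧
    (∀ t, ListsSet (bagList t) (bag t)) ∧
    (∀ t, ListsEdges (torsoList t) (torso G T bag t).edgeSet) ∧
    out = encodeOutput F bagList torsoList

end SepTree

/-! ## Random access machine

A word RAM with unit costs. Programs are finite structured texts; registers are named by natural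
numbers, so a program has only finitely many of them, fixed independently of the input, while the
memory is an array addressed indirectly through registers. -/

namespace WordRAM

structure State where
  reg : ℕ → ℕ
  mem : ℕ → ℕ

inductive Prog where
  | skip : Prog
  /-- `reg x := c` -/
  | imm (x c : ℕ) : Prog
  /-- `reg x := reg y` -/
  | mov (x y : ℕ) : Prog
  /-- `reg x := reg y + reg z` -/
  | add (x y z : ℕ) : Prog
  /-- `reg x := reg y - reg z`, or `0` if this is negative -/
  | sub (x y z : ℕ) : Prog
  /-- `reg x := mem (reg y)` -/
  | load (x y : ℕ) : Prog
  /-- `mem (reg x) := reg y` -/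
  | store (x y : ℕ) : Prog
  | seq (P Q : Prog) : Prog
  /-- `if reg x < reg y then P else Q` -/
  | ifLt (x y : ℕ) (P Q : Prog) : Prog
  /-- `while reg x < reg y do P` -/
  | whileLt (x y : ℕ) (P : Prog) : Prog

def State.setReg (s : State) (x v : ℕ) : State := { s with reg := Function.update s.reg x v }

def State.setMem (s : State) (a v : ℕ) : State := { s with mem := Function.update s.mem a v }

/-- `Exec W P s t s'`: on a machine whose words hold the numbers smaller than `W`, the program `P`
started in the state `s` halts after exactly `t` steps in the state `s'`. Every elementary
instruction and every evaluation of a test is one step. A number that does not fit into a word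
cannot be produced: a run that attempts to do so has no final state. -/
inductive Exec (W : ℕ) : Prog → State → ℕ → State → Prop where
  | skip (s) : Exec W .skip s 1 s
  | imm (s x c) : c < W → Exec W (.imm x c) s 1 (s.setReg x c)
  | mov (s x y) : Exec W (.mov x y) s 1 (s.setReg x (s.reg y))
  | add (s x y z) : s.reg y + s.reg z < W →
      Exec W (.add x y z) s 1 (s.setReg x (s.reg y + s.reg z))
  | sub (s x y z) : Exec W (.sub x y z) s 1 (s.setReg x (s.reg y - s.reg z))
  | load (s x y) : Exec W (.load x y) s 1 (s.setReg x (s.mem (s.reg y)))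
  | store (s x y) : Exec W (.store x y) s 1 (s.setMem (s.reg x) (s.reg y))
  | seq {P Q s₁ s₂ s₃ t₁ t₂} : Exec W P s₁ t₁ s₂ → Exec W Q s₂ t₂ s₃ →
      Exec W (.seq P Q) s₁ (t₁ + t₂) s₃
  | ifTrue {x y P Q s s' t} : s.reg x < s.reg y → Exec W P s t s' →
      Exec W (.ifLt x y P Q) s (t + 1) s'
  | ifFalse {x y P Q s s' t} : ¬ s.reg x < s.reg y → Exec W Q s t s' →
      Exec W (.ifLt x y P Q) s (t + 1) s'
  | whileFalse {x y P s} : ¬ s.reg x < s.reg y → Exec W (.whileLt x y P) s 1 s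
  | whileTrue {x y P s₁ s₂ s₃ t₁ t₂} : s₁.reg x < s₁.reg y → Exec W P s₁ t₁ s₂ →
      Exec W (.whileLt x y P) s₂ t₂ s₃ → Exec W (.whileLt x y P) s₁ (t₁ + t₂ + 1) s₃

/-- The input occupies the memory from address `0` on; everything else is `0`. -/
def initState (input : List ℕ) : State where
  reg _ := 0
  mem a := input.getD a 0

/-- The words of `out` stand in consecutive memory cells, from the address in register `0` on. -/
def State.Outputs (s : State) (out : List ℕ) : Prop :=
  ∀ i < out.length, s.mem (s.reg 0 + i) = out.getD i 0

end WordRAM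

/-!
The tree-decomposition is read off from a laminar family. Write each separation as `{C, D}` so that
the strict side `X = Dᶜ = C \ D` has at most as many vertices as `Cᶜ`. By minimality, `C ∩ D` is the
vertex boundary `S` of `X`, so that `X` determines the separation. For two of the given separations,
nestedness leaves four cases: in two of them one of the sets `X` contains the other, in one they are
disjoint without an edge between them, and the remaining one, in which the two sets would contain
each other's opposite sides, is excluded by their sizes (`SepTree.IsMinimalSeparation.cases`).

Add the whole vertex set as a root. Each other set has a parent, the smallest set that strictly
contains it, and each vertex has a home, the smallest set that contains it. The parents define a
tree, and the bag of a node `t` consists of the vertices at home at `t` and the boundary of `X t`.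
This is a tree-decomposition (`Laminar.Family.isTreeDecomposition`), and the edge from `t` to its
parent induces the separation from which `X t` arose (`Laminar.Family.edgeSep_eq`). The edges of the
torso at `t` are the pairs in the boundary of `X t`, and those edges of `G` and pairs in other
boundaries for which the lower of the homes of the two ends is `t`
(`Laminar.Family.torso_adj_iff`). So one pass over the edges of `G` and all pairs inside separators
distributes them among the torsos.

All this can be computed in linear time. The intervals of the complements of `A` and of `B` are the
gaps of the two representations (`RamLang.gaps_spec`), and give the sizes and the set `X`. The
separator is found by a walk through all vertices that jumps over these gaps, in time proportional
to the number of gaps and the size of the separator (`RamLang.walk_spec`). After a bucket sort by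
size, a single sweep over the vertices keeps track of the smallest set that contains the current
vertex; it finds all parents and homes (`RamLang.sweep_spec`). An edge that lies in several
separators is recognized by a mark, so that it enters a torso once (`RamLang.distribute_spec`).

The algorithm is a program in a small structured language with arrays and families of lists. Its
semantics is a total function that also counts the time, and its programs are analysed with
invariants. The only arithmetic operations of the language are successor and subtraction, so that
all values, and the total length of the lists in a family, are bounded in terms of the time used
(`RamLang.Bounded.cmd`). Commands are compiled to the word RAM with constant slowdown
(`RamLang.sim_comp`, `RamLang.exec_program`), and the bound on the values bounds the addresses.
-/

set_option linter.unusedSectionVars false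
set_option linter.unusedSimpArgs false

/-! ### A structured language with arrays and persistent lists -/

namespace RamLang

/-- Expressions of the source language. There is no addition except `succ`, so that the values a
program produces exceed its inputs by at most its running time. -/
inductive Expr where
  | var (x : ℕ)
  | zero
  | succ (e : Expr)
  | sub (e f : Expr)
  /-- the entry of the `j`-th array at the index `e` -/
  | get (j : Fin 8) (e : Expr)

/-- Commands of the source language. -/
inductive Cmd where
  | skip
  /-- `x := e` -/
  | set (x : ℕ) (e : Expr)
  /-- write `f` into the `j`-th array at the index `e` -/
  | put (j : Fin 8) (e f : Expr)
  /-- add the pair `(f, g)` at the front of the list with key `e` of the `j`-th family of lists -/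
  | push (j : Fin 16) (e f g : Expr)
  /-- take the next input word -/
  | read (x : ℕ)
  | seq (P Q : Cmd)
  /-- `if e < f then P else Q` -/
  | ite (e f : Expr) (P Q : Cmd)
  /-- run `P` for `x = 0, …, e - 1` -/
  | forN (x : ℕ) (e : Expr) (P : Cmd)
  /-- run `P` for all pairs `(x, y)` in the list with key `e` of the `j`-th family -/
  | forL (j : Fin 16) (e : Expr) (x y : ℕ) (P : Cmd)
  /-- run `P` while `e < e'`, but at most `f` times -/
  | whl (f e e' : Expr) (P : Cmd)

infixr:60 ";;" => Cmd.seq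

/-- A state: variables, arrays, families of lists of pairs, the remaining input, and a ghost
counter for the time used so far. -/
@[ext] structure St where
  var : ℕ → ℕ
  arr : Fin 8 → ℕ → ℕ
  lst : Fin 16 → ℕ → List (ℕ × ℕ)
  inp : List ℕ
  tm : ℕ

namespace St

/-- Let `k` steps pass. -/
def tick (σ : St) (k : ℕ) : St := { σ with tm := σ.tm + k }
/-- Set the variable `x` to `v`. -/
def setVar (σ : St) (x v : ℕ) : St := { σ with var := Function.update σ.var x v }
/-- Set the entry of the `j`-th array at the index `i` to `v`. -/
def setArr (σ : St) (j : Fin 8) (i v : ℕ) : St :=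
  { σ with arr := Function.update σ.arr j (Function.update (σ.arr j) i v) }
/-- Add `a` at the front of the list with key `i` of the `j`-th family. -/
def cons (σ : St) (j : Fin 16) (i : ℕ) (a : ℕ × ℕ) : St :=
  { σ with lst := Function.update σ.lst j (Function.update (σ.lst j) i (a :: σ.lst j i)) }
/-- Replace the remaining input. -/
def setInp (σ : St) (l : List ℕ) : St := { σ with inp := l }

variable (σ : St)

@[simp] theorem tick_var (k) : (σ.tick k).var = σ.var := rfl
@[simp] theorem tick_arr (k) : (σ.tick k).arr = σ.arr := rfl
@[simp] theorem tick_lst (k) : (σ.tick k).lst = σ.lst := rfl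
@[simp] theorem tick_inp (k) : (σ.tick k).inp = σ.inp := rfl
@[simp] theorem tick_tm (k) : (σ.tick k).tm = σ.tm + k := rfl
@[simp] theorem setVar_var (x v y) : (σ.setVar x v).var y = if y = x then v else σ.var y := by
  simp [setVar, Function.update_apply]
@[simp] theorem setVar_arr (x v) : (σ.setVar x v).arr = σ.arr := rfl
@[simp] theorem setVar_lst (x v) : (σ.setVar x v).lst = σ.lst := rfl
@[simp] theorem setVar_inp (x v) : (σ.setVar x v).inp = σ.inp := rfl
@[simp] theorem setVar_tm (x v) : (σ.setVar x v).tm = σ.tm := rfl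
@[simp] theorem setArr_var (j i v) : (σ.setArr j i v).var = σ.var := rfl
@[simp] theorem setArr_arr (j i v j') : (σ.setArr j i v).arr j' =
    if j' = j then Function.update (σ.arr j) i v else σ.arr j' := by
  simp [setArr, Function.update_apply]
@[simp] theorem setArr_lst (j i v) : (σ.setArr j i v).lst = σ.lst := rfl
@[simp] theorem setArr_inp (j i v) : (σ.setArr j i v).inp = σ.inp := rfl
@[simp] theorem setArr_tm (j i v) : (σ.setArr j i v).tm = σ.tm := rfl
@[simp] theorem cons_var (j i v) : (σ.cons j i v).var = σ.var := rfl
@[simp] theorem cons_arr (j i v) : (σ.cons j i v).arr = σ.arr := rfl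
@[simp] theorem cons_lst (j i v j') : (σ.cons j i v).lst j' =
    if j' = j then Function.update (σ.lst j) i (v :: σ.lst j i) else σ.lst j' := by
  simp [cons, Function.update_apply]
@[simp] theorem cons_inp (j i v) : (σ.cons j i v).inp = σ.inp := rfl
@[simp] theorem cons_tm (j i v) : (σ.cons j i v).tm = σ.tm := rfl
@[simp] theorem setInp_var (l) : (σ.setInp l).var = σ.var := rfl
@[simp] theorem setInp_arr (l) : (σ.setInp l).arr = σ.arr := rfl
@[simp] theorem setInp_lst (l) : (σ.setInp l).lst = σ.lst := rfl
@[simp] theorem setInp_inp (l) : (σ.setInp l).inp = l := rfl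
@[simp] theorem setInp_tm (l) : (σ.setInp l).tm = σ.tm := rfl

end St

/-- The value of an expression; subtraction is truncated. -/
@[simp] def Expr.eval (σ : St) : Expr → ℕ
  | .var x => σ.var x
  | .zero => 0
  | .succ e => e.eval σ + 1
  | .sub e f => e.eval σ - f.eval σ
  | .get j e => σ.arr j (e.eval σ)

/-- The time charged for the evaluation of an expression: its number of symbols. -/
@[simp] def Expr.cost : Expr → ℕ
  | .var _ => 1
  | .zero => 1
  | .succ e => e.cost + 1
  | .sub e f => e.cost + f.cost + 1
  | .get _ e => e.cost + 1

/-- Iterate `f` as long as `c` holds, but at most `k` times; each test costs `w`. -/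
def whileIter (c : St → Prop) [DecidablePred c] (w : ℕ) (f : St → St) : ℕ → St → St
  | 0, s => s
  | k + 1, s => if c s then whileIter c w f k (f (s.tick w)) else s.tick w

/-- The `n`-fold iteration behind a counting loop. -/
def forIter (f : ℕ → St → St) (s : St) : ℕ → St
  | 0 => s
  | i + 1 => f i (forIter f s i)

/-- The semantics of commands, a total function on states that also counts the time. -/
def Cmd.eval : Cmd → St → St
  | .skip, σ => σ.tick 1
  | .set x e, σ => (σ.setVar x (e.eval σ)).tick (1 + e.cost)
  | .put j e f, σ => (σ.setArr j (e.eval σ) (f.eval σ)).tick (1 + e.cost + f.cost)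
  | .push j e f g, σ =>
      (σ.cons j (e.eval σ) (f.eval σ, g.eval σ)).tick (1 + e.cost + f.cost + g.cost)
  | .read x, σ => ((σ.setInp σ.inp.tail).setVar x (σ.inp.headD 0)).tick 1
  | .seq P Q, σ => Q.eval (P.eval σ)
  | .ite e f P Q, σ =>
      if e.eval σ < f.eval σ then P.eval (σ.tick (1 + e.cost + f.cost))
      else Q.eval (σ.tick (1 + e.cost + f.cost))
  | .forN x e P, σ =>
      forIter (fun i s => P.eval ((s.setVar x i).tick 1)) (σ.tick (1 + e.cost)) (e.eval σ)
  | .forL j e x y P, σ =>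
      (σ.lst j (e.eval σ)).foldl (fun s a => P.eval (((s.setVar x a.1).setVar y a.2).tick 1))
        (σ.tick (1 + e.cost))
  | .whl f e e' P, σ =>
      whileIter (fun s => e.eval s < e'.eval s) (1 + e.cost + e'.cost) P.eval (f.eval σ)
        (σ.tick (1 + f.cost))

/-! ### Reasoning about loops and unchanged data -/

theorem forIter_inv {f : ℕ → St → St} {s : St} {n : ℕ} (I : ℕ → St → Prop) (h0 : I 0 s)
    (hs : ∀ i t, i < n → I i t → I (i + 1) (f i t)) : I n (forIter f s n) := by
  suffices ∀ k ≤ n, I k (forIter f s k) from this n le_rfl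
  intro k
  induction k with
  | zero => intro _; exact h0
  | succ k ih => intro hk; exact hs k _ (by omega) (ih (by omega))

/-- The invariant of a bounded loop refers to the number of rounds still allowed. When the loop
ends, either this number is `0` or the condition fails. -/
theorem whileIter_inv {c : St → Prop} [DecidablePred c] {w : ℕ} {f : St → St} {k : ℕ} {s : St}
    (I : ℕ → St → Prop) (h0 : I k s)
    (hs : ∀ j t, c t → I (j + 1) t → I j (f (t.tick w))) :
    ∃ j t, I j t ∧ (j = 0 ∧ whileIter c w f k s = t ∨
      ¬ c t ∧ whileIter c w f k s = t.tick w) := by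
  induction k generalizing s with
  | zero => exact ⟨0, s, h0, .inl ⟨rfl, rfl⟩⟩
  | succ k ih =>
    by_cases hc : c s
    · simp only [whileIter, hc, if_true]
      exact ih (hs k s hc h0)
    · exact ⟨_, s, h0, .inr ⟨hc, by simp [whileIter, hc]⟩⟩

/-- Invariant rule for folds; the invariant refers to the part of the list already seen. -/
theorem foldl_inv {α β : Type*} {f : β → α → β} {s : β} {L : List α} (I : List α → β → Prop)
    (h0 : I [] s) (hs : ∀ D a R t, L = D ++ a :: R → I D t → I (D ++ [a]) (f t a)) :
    I L (L.foldl f s) := by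
  suffices ∀ R D t, L = D ++ R → I D t → I L (R.foldl f t) from this L [] s rfl h0
  intro R
  induction R with
  | nil => intro D t h hI; simpa [h] using hI
  | cons a R ih =>
    intro D t h hI
    exact ih (D ++ [a]) _ (by simp [h]) (hs D a R t h hI)

/-- Invariant rule for counting loops. -/
theorem forN_inv {x : ℕ} {e : Expr} {P : Cmd} {σ : St} (I : ℕ → St → Prop)
    (h0 : I 0 (σ.tick (1 + e.cost)))
    (hs : ∀ i s, i < e.eval σ → I i s → I (i + 1) (P.eval ((s.setVar x i).tick 1))) :
    I (e.eval σ) ((Cmd.forN x e P).eval σ) := by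
  simp only [Cmd.eval]
  exact forIter_inv I h0 hs

/-- Invariant rule for list loops; the invariant refers to the part of the list already seen. -/
theorem forL_inv {j : Fin 16} {e : Expr} {x y : ℕ} {P : Cmd} {σ : St}
    (I : List (ℕ × ℕ) → St → Prop) (h0 : I [] (σ.tick (1 + e.cost)))
    (hs : ∀ D a R s, σ.lst j (e.eval σ) = D ++ a :: R → I D s →
      I (D ++ [a]) (P.eval (((s.setVar x a.1).setVar y a.2).tick 1))) :
    I (σ.lst j (e.eval σ)) ((Cmd.forL j e x y P).eval σ) := by
  simp only [Cmd.eval]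
  exact foldl_inv I h0 hs

/-- The variables a command may change. -/
def Cmd.wv : Cmd → List ℕ
  | .set x _ => [x]
  | .read x => [x]
  | .seq P Q => P.wv ++ Q.wv
  | .ite _ _ P Q => P.wv ++ Q.wv
  | .forN x _ P => x :: P.wv
  | .forL _ _ x y P => x :: y :: P.wv
  | .whl _ _ _ P => P.wv
  | _ => []

/-- The arrays a command may change. -/
def Cmd.wa : Cmd → List (Fin 8)
  | .put j _ _ => [j]
  | .seq P Q => P.wa ++ Q.wa
  | .ite _ _ P Q => P.wa ++ Q.wa
  | .forN _ _ P => P.wa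
  | .forL _ _ _ _ P => P.wa
  | .whl _ _ _ P => P.wa
  | _ => []

/-- The families of lists a command may change. -/
def Cmd.wl : Cmd → List (Fin 16)
  | .push j _ _ _ => [j]
  | .seq P Q => P.wl ++ Q.wl
  | .ite _ _ P Q => P.wl ++ Q.wl
  | .forN _ _ P => P.wl
  | .forL _ _ _ _ P => P.wl
  | .whl _ _ _ P => P.wl
  | _ => []

/-- Does the command read input? -/
def Cmd.reads : Cmd → Bool
  | .read _ => true
  | .seq P Q => P.reads || Q.reads
  | .ite _ _ P Q => P.reads || Q.reads
  | .forN _ _ P => P.reads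
  | .forL _ _ _ _ P => P.reads
  | .whl _ _ _ P => P.reads
  | _ => false

theorem whileIter_ind {c : St → Prop} [DecidablePred c] {w : ℕ} {f : St → St} (I : St → Prop)
    (hf : ∀ t, I t → I (f t)) (hw : ∀ t k, I t → I (t.tick k)) (k : ℕ) (s : St) (h0 : I s) :
    I (whileIter c w f k s) := by
  induction k generalizing s with
  | zero => exact h0
  | succ k ih =>
    simp only [whileIter]
    split
    · exact ih _ (hf _ (hw _ _ h0))
    · exact hw _ _ h0

/-- A property of states that survives every elementary change made by `P` survives `P`. -/
theorem Cmd.eval_ind (I : St → Prop) (ht : ∀ s k, I s → I (s.tick k)) (P : Cmd)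
    (hv : ∀ s x v, x ∈ P.wv → I s → I (s.setVar x v))
    (ha : ∀ s j i v, j ∈ P.wa → I s → I (s.setArr j i v))
    (hl : ∀ s j i v, j ∈ P.wl → I s → I (s.cons j i v))
    (hr : ∀ s l, P.reads = true → I s → I (s.setInp l)) (s : St) (h : I s) : I (P.eval s) := by
  induction P generalizing s with
  | skip => exact ht _ _ h
  | set x e => exact ht _ _ (hv _ _ _ (by simp [wv]) h)
  | put j e f => exact ht _ _ (ha _ _ _ _ (by simp [wa]) h)
  | push j e f g => exact ht _ _ (hl _ _ _ _ (by simp [wl]) h)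
  | read x => exact ht _ _ (hv _ _ _ (by simp [wv]) (hr _ _ rfl h))
  | seq P Q ihP ihQ =>
    simp only [wv, wa, wl, reads, List.mem_append, Bool.or_eq_true] at hv ha hl hr
    exact ihQ (fun s x v h => hv s x v (.inr h)) (fun s x i v h => ha s x i v (.inr h))
      (fun s x i v h => hl s x i v (.inr h)) (fun s l h => hr s l (.inr h)) _
      (ihP (fun s x v h => hv s x v (.inl h)) (fun s x i v h => ha s x i v (.inl h))
      (fun s x i v h => hl s x i v (.inl h)) (fun s l h => hr s l (.inl h)) _ h)
  | ite e f P Q ihP ihQ =>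
    simp only [wv, wa, wl, reads, List.mem_append, Bool.or_eq_true] at hv ha hl hr
    simp only [eval]
    split
    · exact ihP (fun s x v h => hv s x v (.inl h)) (fun s x i v h => ha s x i v (.inl h))
        (fun s x i v h => hl s x i v (.inl h)) (fun s l h => hr s l (.inl h)) _ (ht _ _ h)
    · exact ihQ (fun s x v h => hv s x v (.inr h)) (fun s x i v h => ha s x i v (.inr h))
        (fun s x i v h => hl s x i v (.inr h)) (fun s l h => hr s l (.inr h)) _ (ht _ _ h)
  | forN x e P ih =>
    simp only [wv, wa, wl, List.mem_cons] at hv ha hl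
    simp only [eval]
    exact forIter_inv (fun _ => I) (ht _ _ h) fun i t _ hI =>
      ih (fun s x v h => hv s x v (.inr h)) ha hl hr _ (ht _ _ (hv _ _ _ (.inl rfl) hI))
  | forL j e x y P ih =>
    simp only [wv, wa, wl, List.mem_cons] at hv ha hl
    simp only [eval]
    exact foldl_inv (fun _ => I) (ht _ _ h) fun D a R t _ hI =>
      ih (fun s x v h => hv s x v (.inr (.inr h))) ha hl hr _
        (ht _ _ (hv _ _ _ (.inr (.inl rfl)) (hv _ _ _ (.inl rfl) hI)))
  | whl f e e' P ih =>
    simp only [eval]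
    exact whileIter_ind I (fun t hI => ih hv ha hl hr _ hI) ht _ _ (ht _ _ h)

theorem Cmd.eval_var {P : Cmd} {σ : St} {x : ℕ} (h : x ∉ P.wv) : (P.eval σ).var x = σ.var x :=
  P.eval_ind (fun s => s.var x = σ.var x) (fun _ _ h => h)
    (fun s y v hy hs => by
      have : x ≠ y := fun e => h (e ▸ hy)
      simpa [this] using hs) (fun _ _ _ _ _ h => h)
    (fun _ _ _ _ _ h => h) (fun _ _ _ h => h) σ rfl

theorem Cmd.eval_arr {P : Cmd} {σ : St} {j : Fin 8} (h : j ∉ P.wa) :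
    (P.eval σ).arr j = σ.arr j :=
  P.eval_ind (fun s => s.arr j = σ.arr j) (fun _ _ h => h) (fun _ _ _ _ h => h)
    (fun s y i v hy hs => by
      have : j ≠ y := fun e => h (e ▸ hy)
      simpa [this] using hs)
    (fun _ _ _ _ _ h => h) (fun _ _ _ h => h) σ rfl

theorem Cmd.eval_lst {P : Cmd} {σ : St} {j : Fin 16} (h : j ∉ P.wl) :
    (P.eval σ).lst j = σ.lst j :=
  P.eval_ind (fun s => s.lst j = σ.lst j) (fun _ _ h => h) (fun _ _ _ _ h => h)
    (fun _ _ _ _ _ h => h) (fun s y i v hy hs => by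
      have : j ≠ y := fun e => h (e ▸ hy)
      simpa [this] using hs) (fun _ _ _ h => h) σ rfl

theorem Cmd.eval_inp {P : Cmd} {σ : St} (h : P.reads = false) : (P.eval σ).inp = σ.inp :=
  P.eval_ind (fun s => s.inp = σ.inp) (fun _ _ h => h) (fun _ _ _ _ h => h)
    (fun _ _ _ _ _ h => h) (fun _ _ _ _ _ h => h) (fun _ _ h' _ => by simp [h] at h') σ rfl

theorem Cmd.tm_le_eval (P : Cmd) (σ : St) : σ.tm ≤ (P.eval σ).tm :=
  P.eval_ind (fun s => σ.tm ≤ s.tm) (fun _ _ h => by simp; omega) (fun _ _ _ _ h => h)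
    (fun _ _ _ _ _ h => h) (fun _ _ _ _ _ h => h) (fun _ _ _ h => h) σ le_rfl

theorem forIter_tm_le {f : ℕ → St → St} (hf : ∀ i s, s.tm ≤ (f i s).tm) (s : St) {m n : ℕ}
    (h : m ≤ n) : (forIter f s m).tm ≤ (forIter f s n).tm := by
  induction n, h using Nat.le_induction with
  | base => exact le_rfl
  | succ n _ ih => exact ih.trans (hf _ _)

theorem foldl_tm_le {α : Type*} {f : St → α → St} (hf : ∀ s a, s.tm ≤ (f s a).tm) (L : List α)
    (s : St) : s.tm ≤ (L.foldl f s).tm := by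
  induction L generalizing s with
  | nil => exact le_rfl
  | cons a L ih => exact (hf s a).trans (ih _)

theorem whileIter_tm_le {c : St → Prop} [DecidablePred c] {w : ℕ} {f : St → St}
    (hf : ∀ s, s.tm ≤ (f s).tm) (k : ℕ) (s : St) : s.tm ≤ (whileIter c w f k s).tm :=
  whileIter_ind (fun t => s.tm ≤ t.tm) (fun t h => h.trans (hf t))
    (fun t k h => h.trans (by simp)) k s le_rfl

/-! ### Values and list lengths are bounded by the running time -/

/-- All values in the state are at most `B` plus the time used so far, and the lists of each family
have total length at most the time used so far. -/
structure Bounded (B : ℕ) (σ : St) : Prop where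
  var : ∀ x, σ.var x ≤ B + σ.tm
  arr : ∀ j i, σ.arr j i ≤ B + σ.tm
  lst : ∀ j i, ∀ a ∈ σ.lst j i, a.1 ≤ B + σ.tm ∧ a.2 ≤ B + σ.tm
  inp : ∀ a ∈ σ.inp, a ≤ B
  length : ∀ j N, ∑ i ∈ Finset.range N, (σ.lst j i).length ≤ σ.tm

theorem Bounded.tick {B : ℕ} {σ : St} (h : Bounded B σ) (k : ℕ) : Bounded B (σ.tick k) where
  var x := (h.var x).trans (by simp)
  arr j i := (h.arr j i).trans (by simp)
  lst j i a ha := ⟨((h.lst j i a ha).1).trans (by simp),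
    ((h.lst j i a ha).2).trans (by simp)⟩
  inp := h.inp
  length j N := (h.length j N).trans (by simp)

theorem Bounded.setVar {B : ℕ} {σ : St} (h : Bounded B σ) {x v : ℕ} (hv : v ≤ B + σ.tm) :
    Bounded B (σ.setVar x v) where
  var y := by simp only [St.setVar_var, St.setVar_tm]; split; exacts [hv, h.var y]
  arr := h.arr
  lst := h.lst
  inp := h.inp
  length := h.length

theorem Bounded.eval {B : ℕ} {σ : St} (h : Bounded B σ) (e : Expr) :
    e.eval σ + 1 ≤ B + σ.tm + e.cost := by
  induction e with
  | var x => have := h.var x; simp; omega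
  | zero => simp
  | succ e ih => simp; omega
  | sub e f ih _ => simp; omega
  | get j e ih => have := h.arr j (e.eval σ); simp; omega

/-- A value exceeds the values from which it is computed by at most the time charged for it, and a
list gets longer only by `push`, which takes time. -/
theorem Bounded.cmd {B : ℕ} (P : Cmd) {σ : St} (h : Bounded B σ) : Bounded B (P.eval σ) := by
  induction P generalizing σ with
  | skip => exact h.tick _
  | set x e =>
    refine (h.tick (1 + e.cost)).setVar (x := x) (v := e.eval σ) ?_
    have := h.eval e; simp; omega
  | put j e f =>
    have := h.eval f
    have h' := h.tick (1 + e.cost + f.cost)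
    refine ⟨h'.var, fun j' i => ?_, h'.lst, h'.inp, h'.length⟩
    have h2 := h'.arr j' i
    by_cases hj : j' = j
    · subst hj
      by_cases hi : i = e.eval σ
      · simp [Cmd.eval, hi]; omega
      · simpa [Cmd.eval, hi] using h2
    · simpa [Cmd.eval, hj] using h2
  | push j e f g =>
    have h1 := h.eval f
    have h2 := h.eval g
    have h' := h.tick (1 + e.cost + f.cost + g.cost)
    refine ⟨h'.var, h'.arr, fun j' i a ha => ?_, h'.inp, fun j' N => ?_⟩
    · by_cases hj : j' = j
      · subst hj
        by_cases hi : i = e.eval σ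
        · simp only [Cmd.eval, St.tick_lst, St.cons_lst, if_true, hi, Function.update_self,
            List.mem_cons] at ha
          rcases ha with rfl | ha
          · simp [Cmd.eval]; omega
          · exact h'.lst _ _ a ha
        · exact h'.lst j' i a (by simpa [Cmd.eval, hi] using ha)
      · exact h'.lst j' i a (by simpa [Cmd.eval, hj] using ha)
    · by_cases hj : j' = j
      · subst hj
        have h3 := h.length j' N
        have h4 : ∑ i ∈ Finset.range N, (((Cmd.push j' e f g).eval σ).lst j' i).length ≤
            ∑ i ∈ Finset.range N, ((σ.lst j' i).length + if i = e.eval σ then 1 else 0) := by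
          refine Finset.sum_le_sum fun i _ => ?_
          by_cases hi : i = e.eval σ <;> simp [Cmd.eval, hi]
        rw [Finset.sum_add_distrib] at h4
        have h5 : ∑ i ∈ Finset.range N, (if i = e.eval σ then 1 else 0) ≤ 1 := by
          rw [Finset.sum_ite_eq']; split <;> simp
        simp only [Cmd.eval, St.tick_tm, St.cons_tm] at h4 ⊢
        omega
      · have := h'.length j' N
        simpa [Cmd.eval, hj] using this
  | read x =>
    have h' := h.tick 1
    cases hi : σ.inp with
    | nil =>
      have := h'.setVar (x := x) (v := 0) (by simp)
      exact ⟨by simpa [Cmd.eval, hi] using this.var, this.arr, this.lst, by simp [Cmd.eval, hi],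
        this.length⟩
    | cons a l =>
      have ha : a ≤ B := h.inp a (by simp [hi])
      have := h'.setVar (x := x) (v := a) (by omega)
      exact ⟨by simpa [Cmd.eval, hi] using this.var, this.arr, this.lst,
        fun b hb => h.inp b (by simp [Cmd.eval, hi] at hb; simp [hi, hb]), this.length⟩
  | seq P Q ihP ihQ => exact ihQ (ihP h)
  | ite e f P Q ihP ihQ =>
    simp only [Cmd.eval]
    split
    · exact ihP (h.tick _)
    · exact ihQ (h.tick _)
  | forN x e P ih =>
    have he := h.eval e
    refine (forN_inv (fun _ s => Bounded B s ∧ σ.tm + 1 + e.cost ≤ s.tm) ⟨h.tick _, ?_⟩ ?_).1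
    · simp; omega
    · intro i s hi ⟨hb, ht⟩
      have h1 := (hb.setVar (x := x) (v := i) (by omega)).tick 1
      refine ⟨ih h1, ?_⟩
      have := P.tm_le_eval ((s.setVar x i).tick 1)
      simp at this; omega
  | forL j e x y P ih =>
    refine (forL_inv (fun _ s => Bounded B s ∧ σ.tm ≤ s.tm) ⟨h.tick _, ?_⟩ ?_).1
    · simp
    · intro D a R s hi ⟨hb, ht⟩
      have hm := h.lst j (e.eval σ) a (by simp [hi])
      have h1 := ((hb.setVar (x := x) (v := a.1) (by omega)).setVar (x := y) (v := a.2)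
        (by simp; omega)).tick 1
      refine ⟨ih h1, ?_⟩
      have := P.tm_le_eval (((s.setVar x a.1).setVar y a.2).tick 1)
      simp at this; omega
  | whl f e e' P ih =>
    exact whileIter_ind _ (fun t ht => ih ht) (fun t k ht => ht.tick k) _ _ (h.tick _)

end RamLang

/-! ### Compilation to the word RAM -/

namespace RamLang

open WordRAM (Prog State Exec)

/-- `reg x := mem (base + 32 * reg r + slot)`; uses the temporaries `k` and `k + 1`. -/
def loadAt (k x r slot : ℕ) : Prog :=
  let a := 4 * k + 1
  .seq (.mov a r) (.seq (.add a a a) (.seq (.add a a a) (.seq (.add a a a) (.seq (.add a a a)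
    (.seq (.add a a a) (.seq (.add a a 3) (.seq (.imm (4 * (k + 1) + 1) slot)
      (.seq (.add a a (4 * (k + 1) + 1)) (.load x a)))))))))

/-- `mem (base + 32 * reg r + slot) := reg v`; uses the temporaries `k` and `k + 1`. -/
def storeAt (k r slot v : ℕ) : Prog :=
  let a := 4 * k + 1
  .seq (.mov a r) (.seq (.add a a a) (.seq (.add a a a) (.seq (.add a a a) (.seq (.add a a a)
    (.seq (.add a a a) (.seq (.add a a 3) (.seq (.imm (4 * (k + 1) + 1) slot)
      (.seq (.add a a (4 * (k + 1) + 1)) (.store a v)))))))))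

variable {W base B : ℕ}

theorem exec_loadAt {s : State} (k x r slot : ℕ) (hb : s.reg 3 = base)
    (hW : base + 32 * s.reg r + slot < W) :
    ∃ s', Exec W (loadAt k x r slot) s 10 s' ∧ s'.mem = s.mem ∧
      s'.reg x = s.mem (base + 32 * s.reg r + slot) ∧
      ∀ y, y ≠ x → y ≠ 4 * k + 1 → y ≠ 4 * (k + 1) + 1 → s'.reg y = s.reg y := by
  have e1 : 4 * (k + 1) + 1 ≠ 4 * k + 1 := by omega
  have e2 : 4 * k + 1 ≠ 4 * (k + 1) + 1 := by omega
  have e3 : 3 ≠ 4 * k + 1 := by omega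
  refine ⟨_, .seq (.mov ..) (.seq (.add _ _ _ _ ?_) (.seq (.add _ _ _ _ ?_)
    (.seq (.add _ _ _ _ ?_) (.seq (.add _ _ _ _ ?_) (.seq (.add _ _ _ _ ?_)
    (.seq (.add _ _ _ _ ?_) (.seq (.imm _ _ _ ?_) (.seq (.add _ _ _ _ ?_) (.load ..))))))))),
    ?_, ?_, ?_⟩
  all_goals
    try simp +contextual [State.setReg, Function.update_apply, e1, e2, e3, hb]
  any_goals omega
  congr 1; omega

theorem exec_storeAt {s : State} (k r slot v : ℕ) (hb : s.reg 3 = base)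
    (hW : base + 32 * s.reg r + slot < W) (hv : v ≠ 4 * k + 1) (hv' : v ≠ 4 * (k + 1) + 1) :
    ∃ s', Exec W (storeAt k r slot v) s 10 s' ∧
      s'.mem = Function.update s.mem (base + 32 * s.reg r + slot) (s.reg v) ∧
      ∀ y, y ≠ 4 * k + 1 → y ≠ 4 * (k + 1) + 1 → s'.reg y = s.reg y := by
  have e1 : 4 * (k + 1) + 1 ≠ 4 * k + 1 := by omega
  have e2 : 4 * k + 1 ≠ 4 * (k + 1) + 1 := by omega
  have e3 : 3 ≠ 4 * k + 1 := by omega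
  refine ⟨_, .seq (.mov ..) (.seq (.add _ _ _ _ ?_) (.seq (.add _ _ _ _ ?_)
    (.seq (.add _ _ _ _ ?_) (.seq (.add _ _ _ _ ?_) (.seq (.add _ _ _ _ ?_)
    (.seq (.add _ _ _ _ ?_) (.seq (.imm _ _ _ ?_) (.seq (.add _ _ _ _ ?_) (.store ..))))))))),
    ?_, ?_⟩
  all_goals
    try simp +contextual [State.setReg, State.setMem, Function.update_apply, e1, e2, e3, hb, hv,
      hv']
  any_goals omega
  congr 1; omega

/-- Evaluate an expression into the temporary `k`, using only temporaries from `k` on. -/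
def compE (k : ℕ) : Expr → Prog
  | .var x => .mov (4 * k + 1) (4 * x)
  | .zero => .imm (4 * k + 1) 0
  | .succ e => .seq (compE k e) (.seq (.imm (4 * (k + 1) + 1) 1)
      (.add (4 * k + 1) (4 * k + 1) (4 * (k + 1) + 1)))
  | .sub e f => .seq (compE k e) (.seq (compE (k + 1) f)
      (.sub (4 * k + 1) (4 * k + 1) (4 * (k + 1) + 1)))
  | .get j e => .seq (compE k e) (loadAt k (4 * k + 1) (4 * k + 1) j)

/-- Compilation of commands. The register `4 x` holds the variable `x`, the registers `4 k + 1`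
hold temporaries, the registers `4 k + 2` with `k ≥ d` hold loop counters, the register `3` holds
the length of the input, `7` the read position in the input, and `11` the index of the first free
list cell. The `i`-th entries of all arrays, the `i`-th head pointers of all families of lists, and
the `i`-th list cell occupy the addresses from `base + 32 i` to `base + 32 i + 26`. -/
def comp (d : ℕ) : Cmd → Prog
  | .skip => .skip
  | .set x e => .seq (compE 0 e) (.mov (4 * x) 1)
  | .put j e f => .seq (compE 0 e) (.seq (compE 1 f) (storeAt 2 1 j 5))
  | .push j e f g => .seq (compE 0 e) (.seq (compE 1 f) (.seq (compE 2 g)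
      (.seq (storeAt 3 11 24 5) (.seq (storeAt 3 11 25 9) (.seq (loadAt 3 5 1 (8 + j))
      (.seq (storeAt 3 11 26 5) (.seq (storeAt 3 1 (8 + j) 11)
      (.seq (.imm 5 1) (.add 11 11 5)))))))))
  | .read x => .ifLt 7 3 (.seq (.load (4 * x) 7) (.seq (.imm 1 1) (.add 7 7 1))) (.imm (4 * x) 0)
  | .seq P Q => .seq (comp d P) (comp d Q)
  | .ite e f P Q => .seq (compE 0 e) (.seq (compE 1 f) (.ifLt 1 5 (comp d P) (comp d Q)))
  | .forN x e P => .seq (compE 0 e) (.seq (.mov (4 * (d + 1) + 2) 1) (.seq (.imm (4 * d + 2) 0)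
      (.whileLt (4 * d + 2) (4 * (d + 1) + 2) (.seq (.mov (4 * x) (4 * d + 2))
        (.seq (comp (d + 2) P) (.seq (.imm 1 1) (.add (4 * d + 2) (4 * d + 2) 1)))))))
  | .forL j e x y P => .seq (compE 0 e) (.seq (loadAt 0 (4 * d + 2) 1 (8 + j))
      (.seq (.imm (4 * (d + 1) + 2) 0) (.whileLt (4 * (d + 1) + 2) (4 * d + 2)
        (.seq (loadAt 0 (4 * x) (4 * d + 2) 24) (.seq (loadAt 0 (4 * y) (4 * d + 2) 25)
          (.seq (comp (d + 2) P) (loadAt 0 (4 * d + 2) (4 * d + 2) 26)))))))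
  | .whl f e e' P => .seq (compE 0 f) (.seq (.mov (4 * d + 2) 1)
      (.seq (.imm (4 * (d + 1) + 2) 0) (.whileLt (4 * (d + 1) + 2) (4 * d + 2)
        (.seq (compE 0 e) (.seq (compE 1 e') (.ifLt 1 5
          (.seq (comp (d + 2) P) (.seq (.imm 1 1) (.sub (4 * d + 2) (4 * d + 2) 1)))
          (.imm (4 * d + 2) 0)))))))

/-- The pointer `h` leads to a chain of cells below `fp` that spells the list; `0` is the null
pointer. -/
def Chain (base : ℕ) (mem : ℕ → ℕ) (fp : ℕ) : ℕ → List (ℕ × ℕ) → Prop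
  | h, [] => h = 0
  | h, a :: L => 0 < h ∧ h < fp ∧ mem (base + 32 * h + 24) = a.1 ∧ mem (base + 32 * h + 25) = a.2 ∧
      Chain base mem fp (mem (base + 32 * h + 26)) L

/-- The machine state `s` represents the state `σ`. -/
structure Models (base : ℕ) (σ : St) (s : State) : Prop where
  var : ∀ x, s.reg (4 * x) = σ.var x
  hbase : s.reg 3 = base
  inp_end : s.reg 7 + σ.inp.length = base
  inp : ∀ i < σ.inp.length, s.mem (s.reg 7 + i) = σ.inp.getD i 0
  arr : ∀ (j : Fin 8) i, s.mem (base + 32 * i + j) = σ.arr j i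
  lst : ∀ (j : Fin 16) i, Chain base s.mem (s.reg 11) (s.mem (base + 32 * i + (8 + j))) (σ.lst j i)
  fp_pos : 1 ≤ s.reg 11
  fp_le : s.reg 11 ≤ 1 + σ.tm

/-- List cells, once written, are never changed: all cells of `s` are still there in `s'`. -/
structure Ext (base : ℕ) (s s' : State) : Prop where
  fp : s.reg 11 ≤ s'.reg 11
  mem : ∀ h < s.reg 11, ∀ c, 24 ≤ c → c < 27 →
    s'.mem (base + 32 * h + c) = s.mem (base + 32 * h + c)

theorem Ext.trans {s₁ s₂ s₃ : State} (h : Ext base s₁ s₂) (h' : Ext base s₂ s₃) :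
    Ext base s₁ s₃ where
  fp := h.fp.trans h'.fp
  mem i hi c hc hc' := (h'.mem i (hi.trans_le h.fp) c hc hc').trans (h.mem i hi c hc hc')

theorem Chain.ext {s s' : State} (h : Ext base s s') {p : ℕ} {L : List (ℕ × ℕ)}
    (hc : Chain base s.mem (s.reg 11) p L) : Chain base s'.mem (s'.reg 11) p L := by
  induction L generalizing p with
  | nil => exact hc
  | cons a L ih =>
    obtain ⟨h1, h2, h3, h4, h5⟩ := hc
    refine ⟨h1, h2.trans_le h.fp, ?_, ?_, ?_⟩
    · rw [h.mem _ h2 _ (by omega) (by omega), h3]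
    · rw [h.mem _ h2 _ (by omega) (by omega), h4]
    · rw [h.mem _ h2 _ (by omega) (by omega)]; exact ih h5

theorem Models.tick {σ : St} {s : State} (h : Models base σ s) (k : ℕ) : Models base (σ.tick k) s :=
  { h with fp_le := h.fp_le.trans (by simp) }

theorem Models.congr {σ : St} {s s' : State} (h : Models base σ s) (hm : s'.mem = s.mem)
    (hr : ∀ r, r % 4 ≠ 1 → r % 4 ≠ 2 → s'.reg r = s.reg r) : Models base σ s' := by
  have h3 := hr 3 (by omega) (by omega)
  have h7 := hr 7 (by omega) (by omega)
  have h11 := hr 11 (by omega) (by omega)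
  have h4 : ∀ x, s'.reg (4 * x) = s.reg (4 * x) := fun x => hr _ (by omega) (by omega)
  exact ⟨fun x => by rw [h4, h.var], by rw [h3, h.hbase], by rw [h7, h.inp_end],
    by rw [h7, hm]; exact h.inp, by rw [hm]; exact h.arr, by rw [hm, h11]; exact h.lst,
    by rw [h11]; exact h.fp_pos, by rw [h11]; exact h.fp_le⟩

theorem Ext.congr {s s' : State} (hm : s'.mem = s.mem) (h11 : s'.reg 11 = s.reg 11) :
    Ext base s s' := ⟨h11.ge, fun _ _ _ _ _ => by rw [hm]⟩

theorem Models.setVar {σ : St} {s s' : State} (h : Models base σ s) (hm : s'.mem = s.mem) {x v : ℕ}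
    (hx : s'.reg (4 * x) = v)
    (hr : ∀ r, r ≠ 4 * x → r % 4 ≠ 1 → r % 4 ≠ 2 → s'.reg r = s.reg r) :
    Models base (σ.setVar x v) s' := by
  have h3 := hr 3 (by omega) (by omega) (by omega)
  have h7 := hr 7 (by omega) (by omega) (by omega)
  have h11 := hr 11 (by omega) (by omega) (by omega)
  refine ⟨fun y => ?_, by rw [h3, h.hbase], by rw [h7]; exact h.inp_end,
    by rw [h7, hm]; exact h.inp, by rw [hm]; exact h.arr, by rw [hm, h11]; exact h.lst,
    by rw [h11]; exact h.fp_pos, by rw [h11]; exact h.fp_le⟩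
  by_cases hy : y = x
  · simp [hy, hx]
  · rw [hr _ (by omega) (by omega) (by omega), h.var]; simp [hy]

theorem exec_compE {σ : St} {s : State} (hR : Models base σ s) (hB : Bounded B σ) (e : Expr) (k : ℕ)
    (hW : base + 32 * (B + σ.tm + e.cost) + 64 ≤ W) :
    ∃ t s', Exec W (compE k e) s t s' ∧ t ≤ 12 * e.cost ∧ s'.mem = s.mem ∧
      s'.reg (4 * k + 1) = e.eval σ ∧ ∀ r, r % 4 ≠ 1 ∨ r < 4 * k + 1 → s'.reg r = s.reg r := by
  induction e generalizing k s with
  | var x =>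
    refine ⟨_, _, .mov .., by simp, rfl, ?_, ?_⟩
    · simp [State.setReg, hR.var]
    · intro r hr; simp [State.setReg, Function.update_apply]; omega
  | zero =>
    refine ⟨_, _, .imm _ _ _ (by omega), by simp, rfl, ?_, ?_⟩
    · simp [State.setReg]
    · intro r hr; simp [State.setReg, Function.update_apply]; omega
  | succ e ih =>
    simp only [Expr.cost] at hW
    obtain ⟨t, s1, h1, ht, hm, he, hr⟩ := ih hR k (by omega)
    have := hB.eval e
    have e1 : 4 * k + 1 ≠ 4 * (k + 1) + 1 := by omega
    refine ⟨_, _, .seq h1 (.seq (.imm _ _ _ (by omega)) (.add _ _ _ _ ?_)), ?_, hm, ?_, ?_⟩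
    · simp [State.setReg, Function.update_apply, he]; omega
    · simp; omega
    · simp [State.setReg, Function.update_apply, he]
    · intro r h; rw [← hr r h]; simp [State.setReg, Function.update_apply]
      rw [if_neg (by omega), if_neg (by omega)]
  | sub e f ihe ihf =>
    simp only [Expr.cost] at hW
    obtain ⟨t, s1, h1, ht, hm, he, hr⟩ := ihe hR k (by omega)
    obtain ⟨t', s2, h2, ht', hm', he', hr'⟩ := ihf
      (hR.congr hm fun r h _ => hr r (.inl h)) (k + 1) (by omega)
    refine ⟨_, _, .seq h1 (.seq h2 (.sub ..)), ?_, hm'.trans hm, ?_, ?_⟩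
    · simp; omega
    · simp [State.setReg, he', hr' (4 * k + 1) (by omega), he]
    · intro r h; rw [← hr r h, ← hr' r (by omega)]; simp [State.setReg, Function.update_apply]
      omega
  | get j e ih =>
    simp only [Expr.cost] at hW
    obtain ⟨t, s1, h1, ht, hm, he, hr⟩ := ih hR k (by omega)
    have := hB.eval e
    have hb : s1.reg 3 = base := by rw [hr 3 (by omega), hR.hbase]
    obtain ⟨s2, h2, hm2, he2, hr2⟩ := exec_loadAt (W := W) k (4 * k + 1) (4 * k + 1) j hb
      (by rw [he]; omega)
    refine ⟨_, _, .seq h1 h2, ?_, hm2.trans hm, ?_, ?_⟩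
    · simp; omega
    · rw [he2, hm, he, hR.arr]; rfl
    · intro r h; rw [hr2 r (by omega) (by omega) (by omega), hr r h]

/-- What the simulation of one command guarantees: the compiled program halts in a state that
represents the result, in time proportional to the ghost time. -/
def Sim (W base d : ℕ) (P : Prog) (σ σ' : St) (s : State) : Prop :=
  ∃ t s', Exec W P s t s' ∧ Models base σ' s' ∧ Ext base s s' ∧
    (∀ k < d, s'.reg (4 * k + 2) = s.reg (4 * k + 2)) ∧ t + 80 * σ.tm ≤ 80 * σ'.tm

theorem sim_push {σ : St} {s : State} (hR : Models base σ s) (hB : Bounded B σ) (d : ℕ)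
    (j : Fin 16) (e f g : Expr)
    (hW : base + 32 * (B + ((Cmd.push j e f g).eval σ).tm) + 64 ≤ W) :
    Sim W base d (comp d (.push j e f g)) σ ((Cmd.push j e f g).eval σ) s := by
  simp only [Cmd.eval, St.tick_tm, St.cons_tm] at hW
  have hj := j.isLt
  obtain ⟨t1, s1, h1, ht1, hm1, he1, hr1⟩ := exec_compE (W := W) hR hB e 0 (by omega)
  have hR1 := hR.congr hm1 fun r h _ => hr1 r (.inl h)
  obtain ⟨t2, s2, h2, ht2, hm2, he2, hr2⟩ := exec_compE (W := W) hR1 hB f 1 (by omega)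
  have hR2 := hR1.congr hm2 fun r h _ => hr2 r (.inl h)
  obtain ⟨t3, s3, h3, ht3, hm3, he3, hr3⟩ := exec_compE (W := W) hR2 hB g 2 (by omega)
  have hR3 := hR2.congr hm3 fun r h _ => hr3 r (.inl h)
  have h31 : s3.reg 1 = e.eval σ := by rw [hr3 _ (by omega), hr2 _ (by omega), he1]
  have h35 : s3.reg 5 = f.eval σ := by rw [hr3 _ (by omega), he2]
  have h39 : s3.reg 9 = g.eval σ := he3
  have hfp := hR3.fp_le
  have hfp' := hR3.fp_pos
  have hee := hB.eval e
  set fp := s3.reg 11 with hfpdef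
  obtain ⟨s4, h4, hm4, hr4⟩ := exec_storeAt (W := W) 3 11 24 5 hR3.hbase (by omega)
    (by omega) (by omega)
  have q4 : ∀ r, r < 13 → s4.reg r = s3.reg r := fun r hr => hr4 r (by omega) (by omega)
  obtain ⟨s5, h5, hm5, hr5⟩ := exec_storeAt (W := W) 3 11 25 9 ((q4 3 (by omega)).trans hR3.hbase)
    (by rw [q4 11 (by omega)]; omega) (by omega) (by omega)
  have q5 : ∀ r, r < 13 → s5.reg r = s3.reg r := fun r hr =>
    (hr5 r (by omega) (by omega)).trans (q4 r hr)
  obtain ⟨s6, h6, hm6, he6, hr6⟩ := exec_loadAt (W := W) 3 5 1 (8 + j)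
    ((q5 3 (by omega)).trans hR3.hbase) (by rw [q5 1 (by omega)]; omega)
  have q6 : ∀ r, r < 13 → r ≠ 5 → s6.reg r = s3.reg r := fun r hr h =>
    (hr6 r (by omega) (by omega) (by omega)).trans (q5 r hr)
  obtain ⟨s7, h7, hm7, hr7⟩ := exec_storeAt (W := W) 3 11 26 5
    ((q6 3 (by omega) (by omega)).trans hR3.hbase)
    (by rw [q6 11 (by omega) (by omega)]; omega) (by omega) (by omega)
  have q7 : ∀ r, r < 13 → r ≠ 5 → s7.reg r = s3.reg r := fun r hr h =>
    (hr7 r (by omega) (by omega)).trans (q6 r hr h)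
  obtain ⟨s8, h8, hm8, hr8⟩ := exec_storeAt (W := W) 3 1 (8 + j) 11
    ((q7 3 (by omega) (by omega)).trans hR3.hbase)
    (by rw [q7 1 (by omega) (by omega)]; omega) (by omega) (by omega)
  have q8 : ∀ r, r < 13 → r ≠ 5 → s8.reg r = s3.reg r := fun r hr h =>
    (hr8 r (by omega) (by omega)).trans (q7 r hr h)
  rw [q7 1 (by omega) (by omega), q7 11 (by omega) (by omega), h31, hm7, hm6, hm5,
    q6 11 (by omega) (by omega), he6, q5 1 (by omega), h31, hm4, q4 11 (by omega),
    q4 9 (by omega), h35, h39, hm5, hm4, q4 11 (by omega), q4 9 (by omega), h35, h39,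
    ← hfpdef] at hm8
  have hold : Function.update (Function.update s3.mem (base + 32 * fp + 24) (f.eval σ))
      (base + 32 * fp + 25) (g.eval σ) (base + 32 * e.eval σ + (8 + j)) =
      s3.mem (base + 32 * e.eval σ + (8 + j)) := by
    rw [Function.update_of_ne (by omega), Function.update_of_ne (by omega)]
  rw [hold] at hm8
  have hmem : ∀ a, (a ≠ base + 32 * fp + 24 ∧ a ≠ base + 32 * fp + 25 ∧ a ≠ base + 32 * fp + 26 ∧
      a ≠ base + 32 * e.eval σ + (8 + j)) → s8.mem a = s3.mem a := by
    intro a ha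
    rw [hm8, Function.update_of_ne ha.2.2.2, Function.update_of_ne ha.2.2.1,
      Function.update_of_ne ha.2.1, Function.update_of_ne ha.1]
  have m24 : s8.mem (base + 32 * fp + 24) = f.eval σ := by
    rw [hm8, Function.update_of_ne (by omega), Function.update_of_ne (by omega),
      Function.update_of_ne (by omega), Function.update_self]
  have m25 : s8.mem (base + 32 * fp + 25) = g.eval σ := by
    rw [hm8, Function.update_of_ne (by omega), Function.update_of_ne (by omega),
      Function.update_self]
  have m26 : s8.mem (base + 32 * fp + 26) = s3.mem (base + 32 * e.eval σ + (8 + j)) := by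
    rw [hm8, Function.update_of_ne (by omega), Function.update_self]
  have mh : s8.mem (base + 32 * e.eval σ + (8 + j)) = fp := by
    rw [hm8, Function.update_self]
  let s9 : State := (s8.setReg 5 1).setReg 11 (s8.reg 11 + 1)
  have h9 : Exec W (.seq (.imm 5 1) (.add 11 11 5)) s8 (1 + 1) s9 := by
    refine .seq (.imm _ _ _ (by omega)) (.add _ _ _ _ ?_)
    simp [State.setReg, q8 11 (by omega) (by omega)]; omega
  have q9 : ∀ r, r < 11 → r ≠ 5 → s9.reg r = s3.reg r := by
    intro r h h'
    rw [← q8 r (by omega) h']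
    simp only [s9, State.setReg, Function.update_apply]
    rw [if_neg (by omega), if_neg (by omega)]
  have qv : ∀ r, r % 4 ≠ 1 → r ≠ 11 → s9.reg r = s.reg r := by
    intro r hr hr'
    have : s9.reg r = s8.reg r := by
      simp only [s9, State.setReg, Function.update_apply]
      rw [if_neg (by omega), if_neg (by omega)]
    rw [this, hr8 r (by omega) (by omega), hr7 r (by omega) (by omega),
      hr6 r (by omega) (by omega) (by omega), hr5 r (by omega) (by omega),
      hr4 r (by omega) (by omega), hr3 r (by omega), hr2 r (by omega), hr1 r (by omega)]
  have m9 : s9.mem = s8.mem := rfl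
  have f9 : s9.reg 11 = fp + 1 := by
    simp [s9, State.setReg, q8 11 (by omega) (by omega), hfpdef]
  have hX : Ext base s3 s9 := by
    refine ⟨by omega, fun h hh c hc hc' => ?_⟩
    rw [m9, hmem _ (by omega)]
  refine ⟨_, s9, .seq h1 (.seq h2 (.seq h3 (.seq h4 (.seq h5 (.seq h6 (.seq h7 (.seq h8 h9))))))),
    ⟨?_, ?_, ?_, ?_, ?_, ?_, ?_, ?_⟩, ?_, ?_, ?_⟩
  · intro x; rw [qv _ (by omega) (by omega), hR.var]; rfl
  · rw [qv _ (by omega) (by omega), hR.hbase]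
  · rw [qv _ (by omega) (by omega)]; exact hR.inp_end
  · intro i hi
    have hi' : i < σ.inp.length := hi
    have hx := hR3.inp_end
    rw [q9 7 (by omega) (by omega), m9, hmem _ (by omega)]
    exact hR3.inp i hi
  · intro j' i
    have := j'.isLt
    rw [m9, hmem _ (by omega)]; exact hR3.arr j' i
  · intro j' i
    have := j'.isLt
    by_cases hji : j' = j ∧ i = e.eval σ
    · obtain ⟨rfl, rfl⟩ := hji
      rw [m9, mh]
      simp only [Cmd.eval, St.tick_lst, St.cons_lst, if_true, Function.update_self]
      refine ⟨by omega, by omega, m24, m25, ?_⟩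
      rw [m26]
      exact (hR3.lst j' _).ext hX
    · have hne : base + 32 * i + (8 + (j' : ℕ)) ≠ base + 32 * e.eval σ + (8 + j) := by
        intro h
        exact hji ⟨Fin.ext (by omega), by omega⟩
      have h1 : ((Cmd.push j e f g).eval σ).lst j' i = σ.lst j' i := by
        by_cases hj' : j' = j
        · have hi : i ≠ e.eval σ := fun h => hji ⟨hj', h⟩
          simp [Cmd.eval, hj', hi]
        · simp [Cmd.eval, hj']
      rw [h1, m9, hmem _ (by omega)]
      exact (hR3.lst j' i).ext hX
  · omega
  · simp only [Cmd.eval, St.tick_tm, St.cons_tm]; simp only [fp] at f9 ⊢; omega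
  · refine Ext.trans (Ext.congr (hm3.trans (hm2.trans hm1)) ?_) hX
    rw [hr3 _ (by omega), hr2 _ (by omega), hr1 _ (by omega)]
  · intro k _; exact qv _ (by omega) (by omega)
  · simp only [Cmd.eval, St.tick_tm, St.cons_tm]; omega

theorem Sim.seq {d : ℕ} {P Q : Prog} {σ₁ σ₂ σ₃ : St} {s : State} (hP : Sim W base d P σ₁ σ₂ s)
    (hQ : ∀ s', Models base σ₂ s' → Sim W base d Q σ₂ σ₃ s') :
    Sim W base d (.seq P Q) σ₁ σ₃ s := by
  obtain ⟨t, s', h, hR, hX, hd, ht⟩ := hP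
  obtain ⟨t', s'', h', hR', hX', hd', ht'⟩ := hQ s' hR
  exact ⟨_, _, .seq h h', hR', hX.trans hX', fun k hk => (hd' k hk).trans (hd k hk), by omega⟩

/-- Every compiled command simulates the command, provided that the words are large enough for the
values that can occur within the running time. -/
theorem sim_comp (P : Cmd) {σ : St} {s : State} (d : ℕ) (hR : Models base σ s) (hB : Bounded B σ)
    (hW : base + 32 * (B + (P.eval σ).tm) + 64 ≤ W) :
    Sim W base d (comp d P) σ (P.eval σ) s := by
  induction P generalizing σ s d with
  | skip => exact ⟨_, _, .skip _, hR.tick _, ⟨le_rfl, fun _ _ _ _ _ => rfl⟩, fun _ _ => rfl, by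
      simp [Cmd.eval]; omega⟩
  | set x e =>
    simp only [Cmd.eval, St.tick_tm, St.setVar_tm] at hW
    obtain ⟨t, s1, h1, ht, hm, he, hr⟩ := exec_compE (W := W) hR hB e 0 (by omega)
    have hR1 := hR.congr hm fun r h _ => hr r (.inl h)
    have hx : s1.reg 1 = e.eval σ := he
    have q : ∀ r, r ≠ 4 * x → (s1.setReg (4 * x) (s1.reg 1)).reg r = s1.reg r := fun r h => by
      simp [State.setReg, h]
    refine ⟨_, s1.setReg (4 * x) (s1.reg 1), .seq h1 (.mov ..), ?_, .congr hm ?_, ?_, ?_⟩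
    · exact ((hR1.setVar (x := x) (s' := s1.setReg (4 * x) (s1.reg 1)) rfl
        (by simp [State.setReg, hx]) fun r h _ _ => q r h).tick _)
    · rw [q _ (by omega), hr _ (by omega)]
    · intro k _; rw [q _ (by omega), hr _ (by omega)]
    · simp only [Cmd.eval, St.tick_tm, St.setVar_tm]; omega
  | put j e f =>
    simp only [Cmd.eval, St.tick_tm, St.setArr_tm] at hW
    have hj := j.isLt
    obtain ⟨t1, s1, h1, ht1, hm1, he1, hr1⟩ := exec_compE (W := W) hR hB e 0 (by omega)
    have hR1 := hR.congr hm1 fun r h _ => hr1 r (.inl h)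
    obtain ⟨t2, s2, h2, ht2, hm2, he2, hr2⟩ := exec_compE (W := W) hR1 hB f 1 (by omega)
    have hR2 := hR1.congr hm2 fun r h _ => hr2 r (.inl h)
    have q1 : s2.reg 1 = e.eval σ := by rw [hr2 _ (by omega), he1]
    have q5 : s2.reg 5 = f.eval σ := he2
    have hee := hB.eval e
    obtain ⟨s3, h3, hm3, hr3⟩ := exec_storeAt (W := W) 2 1 j 5 hR2.hbase (by omega) (by omega)
      (by omega)
    rw [q1, q5] at hm3
    have qv : ∀ r, r % 4 ≠ 1 → s3.reg r = s.reg r := fun r h => by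
      rw [hr3 _ (by omega) (by omega), hr2 _ (by omega), hr1 _ (by omega)]
    have hmem : ∀ a, a ≠ base + 32 * e.eval σ + j → s3.mem a = s2.mem a := fun a ha => by
      rw [hm3, Function.update_of_ne ha]
    have hX : Ext base s2 s3 := ⟨by rw [hr3 _ (by omega) (by omega)], fun h hh c hc hc' =>
      hmem _ (by omega)⟩
    refine ⟨_, s3, .seq h1 (.seq h2 h3),
      ⟨?_, ?_, ?_, ?_, ?_, ?_, ?_, ?_⟩, ?_, ?_, ?_⟩
    · intro x; rw [qv _ (by omega), hR.var]; rfl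
    · rw [qv _ (by omega), hR.hbase]
    · rw [qv _ (by omega)]; exact hR.inp_end
    · intro i hi
      have hi' : i < σ.inp.length := hi
      have hx := hR2.inp_end
      have h7 : s3.reg 7 = s2.reg 7 := hr3 _ (by omega) (by omega)
      rw [h7, hmem _ (by omega)]
      exact hR2.inp i hi
    · intro j' i
      have := j'.isLt
      by_cases hji : j' = j ∧ i = e.eval σ
      · obtain ⟨rfl, rfl⟩ := hji
        rw [hm3]; simp [Cmd.eval]
      · have hne : base + 32 * i + (j' : ℕ) ≠ base + 32 * e.eval σ + j := by
          intro h
          exact hji ⟨Fin.ext (by omega), by omega⟩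
        rw [hmem _ hne, hR2.arr]
        by_cases hj' : j' = j
        · have hi : i ≠ e.eval σ := fun h => hji ⟨hj', h⟩
          simp [Cmd.eval, hj', hi]
        · simp [Cmd.eval, hj']
    · intro j' i
      rw [hmem _ (by omega)]
      exact (hR2.lst j' i).ext hX
    · rw [qv _ (by omega)]; exact hR.fp_pos
    · rw [qv _ (by omega)]; exact (hR.tick _).fp_le
    · refine Ext.trans (Ext.congr (hm2.trans hm1) ?_) hX
      rw [hr2 _ (by omega), hr1 _ (by omega)]
    · intro k _; exact qv _ (by omega)
    · simp only [Cmd.eval, St.tick_tm, St.setArr_tm]; omega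
  | push j e f g => exact sim_push hR hB d j e f g hW
  | read x =>
    simp only [Cmd.eval, St.tick_tm, St.setVar_tm, St.setInp_tm] at hW
    have hend := hR.inp_end
    have hb := hR.hbase
    cases hi : σ.inp with
    | nil =>
      simp only [hi, List.length_nil] at hend
      refine ⟨_, _, .ifFalse (by omega) (.imm _ _ _ (by omega)), ?_, .congr rfl ?_, ?_, ?_⟩
      · have h' : σ.setInp [] = σ := by rw [← hi]; rfl
        simp only [Cmd.eval, hi, List.headD_nil, List.tail_nil, h']
        exact (hR.setVar (x := x) (s' := s.setReg (4 * x) 0) rfl (by simp [State.setReg])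
          fun r h _ _ => by simp [State.setReg, h]).tick _
      · simp only [State.setReg, Function.update_apply]; rw [if_neg (by omega)]
      · intro k _; simp only [State.setReg, Function.update_apply]; rw [if_neg (by omega)]
      · simp only [Cmd.eval, St.tick_tm, St.setVar_tm, St.setInp_tm]; omega
    | cons a l =>
      simp only [hi, List.length_cons] at hend
      have h0 := hR.inp 0 (by simp [hi])
      simp only [hi, Nat.add_zero, List.getD_cons_zero] at h0
      have hW1 : 1 < W := by omega
      let s1 : State := ((s.setReg (4 * x) a).setReg 1 1).setReg 7 (s.reg 7 + 1)
      have hx : Exec W (.add 7 7 1) ((s.setReg (4 * x) (s.mem (s.reg 7))).setReg 1 1) 1 s1 := by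
        have e7 : (7 : ℕ) ≠ 4 * x := by omega
        have := Exec.add (W := W) ((s.setReg (4 * x) a).setReg 1 1) 7 7 1
          (by simp [State.setReg, e7]; omega)
        simpa [State.setReg, h0, e7, s1] using this
      have q7 : s1.reg 7 = s.reg 7 + 1 := by simp [s1, State.setReg]
      have qx : s1.reg (4 * x) = a := by
        have e7 : 4 * x ≠ 7 := by omega
        have e1 : 4 * x ≠ 1 := by omega
        simp [s1, State.setReg, e7, e1]
      have qv : ∀ r, r ≠ 4 * x → r ≠ 1 → r ≠ 7 → s1.reg r = s.reg r := fun r h h1 h7 => by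
        simp [s1, State.setReg, h, h1, h7]
      refine ⟨_, s1, .ifTrue (by omega) (.seq (.load ..) (.seq (.imm _ 1 1 hW1) hx)),
        ⟨?_, ?_, ?_, ?_, ?_, ?_, ?_, ?_⟩, .congr rfl ?_, ?_, ?_⟩
      · intro y
        by_cases hy : y = x
        · subst hy; simp [Cmd.eval, hi, qx]
        · rw [qv _ (by omega) (by omega) (by omega), hR.var]; simp [Cmd.eval, hy]
      · rw [qv _ (by omega) (by omega) (by omega), hb]
      · simp [Cmd.eval, hi, q7]; omega
      · intro i hi'
        have := hR.inp (i + 1) (by simpa [Cmd.eval, hi] using hi')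
        rw [q7, show s.reg 7 + 1 + i = s.reg 7 + (i + 1) by omega]
        simpa [Cmd.eval, hi, s1, State.setReg] using this
      · exact hR.arr
      · rw [qv 11 (by omega) (by omega) (by omega)]; exact hR.lst
      · rw [qv 11 (by omega) (by omega) (by omega)]; exact hR.fp_pos
      · rw [qv 11 (by omega) (by omega) (by omega)]; exact (hR.tick _).fp_le
      · rw [qv 11 (by omega) (by omega) (by omega)]
      · intro k _; rw [qv _ (by omega) (by omega) (by omega)]
      · simp only [Cmd.eval, St.tick_tm, St.setVar_tm, St.setInp_tm]; omega
  | seq P Q ihP ihQ =>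
    have := Q.tm_le_eval (P.eval σ)
    simp only [Cmd.eval] at hW
    exact (ihP d hR hB (by omega)).seq fun s' hR' => ihQ d hR' (hB.cmd P) (by omega)
  | ite e f P Q ihP ihQ =>
    obtain ⟨R, hcR⟩ : ∃ R, R = if e.eval σ < f.eval σ then P else Q := ⟨_, rfl⟩
    have hev : (Cmd.ite e f P Q).eval σ = R.eval (σ.tick (1 + e.cost + f.cost)) := by
      simp only [Cmd.eval, hcR]; split <;> rfl
    have ihR : ∀ {σ : St} {s : State} (d : ℕ), Models base σ s → Bounded B σ →
      base + 32 * (B + (R.eval σ).tm) + 64 ≤ W →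
      Sim W base d (comp d R) σ (R.eval σ) s := by
      rw [hcR]; split; exacts [ihP, ihQ]
    rw [hev] at hW ⊢
    have hmono := R.tm_le_eval (σ.tick (1 + e.cost + f.cost))
    simp only [St.tick_tm] at hmono
    obtain ⟨t1, s1, h1, ht1, hm1, he1, hr1⟩ := exec_compE (W := W) hR hB e 0 (by omega)
    have hR1 := hR.congr hm1 fun r h _ => hr1 r (.inl h)
    obtain ⟨t2, s2, h2, ht2, hm2, he2, hr2⟩ := exec_compE (W := W) hR1 hB f 1 (by omega)
    have hR2 := hR1.congr hm2 fun r h _ => hr2 r (.inl h)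
    have q1 : s2.reg 1 = e.eval σ := by rw [hr2 _ (by omega), he1]
    have q5 : s2.reg 5 = f.eval σ := he2
    obtain ⟨t3, s3, h3, hR3, hX3, hd3, ht3⟩ := ihR d (hR2.tick (1 + e.cost + f.cost))
      (hB.tick _) hW
    simp only [St.tick_tm] at ht3
    have h3' : Exec W (.ifLt 1 5 (comp d P) (comp d Q)) s2 (t3 + 1) s3 := by
      by_cases hc : e.eval σ < f.eval σ
      · rw [if_pos hc] at hcR; subst hcR; exact .ifTrue (by rwa [q1, q5]) h3
      · rw [if_neg hc] at hcR; subst hcR; exact .ifFalse (by rwa [q1, q5]) h3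
    refine ⟨_, s3, .seq h1 (.seq h2 h3'), hR3, (Ext.congr (hm2.trans hm1) ?_).trans hX3, ?_, ?_⟩
    · rw [hr2 _ (by omega), hr1 _ (by omega)]
    · intro k hk; rw [hd3 k hk, hr2 _ (by omega), hr1 _ (by omega)]
    · omega
  | forN x e P ih =>
    obtain ⟨n, hn⟩ : ∃ n, n = e.eval σ := ⟨_, rfl⟩
    have hev := hB.eval e
    obtain ⟨f, hf⟩ : ∃ f : ℕ → St → St, f = fun i s => P.eval ((s.setVar x i).tick 1) := ⟨_, rfl⟩
    have hfm : ∀ i s, s.tm + 1 ≤ (f i s).tm := fun i s => by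
      rw [hf]; exact P.tm_le_eval ((s.setVar x i).tick 1)
    have hfm' : ∀ i s, s.tm ≤ (f i s).tm := fun i s => by have := hfm i s; omega
    obtain ⟨σ0, hσ0⟩ : ∃ σ0, σ0 = σ.tick (1 + e.cost) := ⟨_, rfl⟩
    have htm : σ0.tm = σ.tm + (1 + e.cost) := by rw [hσ0]; rfl
    have hres : (Cmd.forN x e P).eval σ = forIter f σ0 n := by rw [hn, hf, hσ0]; rfl
    rw [hres] at hW ⊢
    have hm0 := fun i => forIter_tm_le hfm' σ0 (Nat.zero_le i)
    simp only [forIter] at hm0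
    have hm0n := hm0 n
    have hBi : ∀ i ≤ n, Bounded B (forIter f σ0 i) := by
      intro i hi
      induction i with
      | zero => rw [forIter, hσ0]; exact hB.tick _
      | succ i ih' =>
        have := hm0 i
        rw [forIter, hf]
        exact (((hf ▸ ih' (by omega)).setVar (by rw [← hf]; omega)).tick 1).cmd P
    obtain ⟨t1, s1, h1, ht1, hm1, he1, hr1⟩ := exec_compE (W := W) hR hB e 0 (by omega)
    have hR1 := hR.congr hm1 fun r h _ => hr1 r (.inl h)
    have hx1 : s1.reg 1 = n := by rw [hn]; exact he1
    let s2 : State := (s1.setReg (4 * (d + 1) + 2) n).setReg (4 * d + 2) 0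
    have h2a : Exec W (.mov (4 * (d + 1) + 2) 1) s1 1 (s1.setReg (4 * (d + 1) + 2) n) := by
      rw [← hx1]; exact .mov ..
    have h2b : Exec W (.imm (4 * d + 2) 0) (s1.setReg (4 * (d + 1) + 2) n) 1 s2 :=
      .imm _ _ _ (by omega)
    have q2 : ∀ r, r ≠ 4 * (d + 1) + 2 → r ≠ 4 * d + 2 → s2.reg r = s1.reg r := fun r h h' => by
      simp [s2, State.setReg, h, h']
    have hR2 : Models base σ0 s2 := by
      rw [hσ0]
      exact (hR1.congr (s' := s2) rfl fun r _ h => q2 r (by omega) (by omega)).tick _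
    have key : ∀ k i, i + k = n → ∀ s, Models base (forIter f σ0 i) s → s.reg (4 * d + 2) = i →
        s.reg (4 * (d + 1) + 2) = n →
        ∃ t s', Exec W (.whileLt (4 * d + 2) (4 * (d + 1) + 2) (.seq (.mov (4 * x) (4 * d + 2))
          (.seq (comp (d + 2) P) (.seq (.imm 1 1) (.add (4 * d + 2) (4 * d + 2) 1))))) s t s' ∧
          Models base (forIter f σ0 n) s' ∧ Ext base s s' ∧
          (∀ k < d, s'.reg (4 * k + 2) = s.reg (4 * k + 2)) ∧
          t + 80 * (forIter f σ0 i).tm ≤ 80 * (forIter f σ0 n).tm + 1 := by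
      intro k
      induction k with
      | zero =>
        intro i hi s hs hc hl
        obtain rfl : i = n := by omega
        exact ⟨_, s, .whileFalse (by omega), hs, .congr rfl rfl, fun _ _ => rfl, by omega⟩
      | succ k ihk =>
        intro i hi s hs hc hl
        have hmi := forIter_tm_le hfm' σ0 (show i + 1 ≤ n by omega)
        have hmi0 := hm0 i
        have hmi1 : (forIter f σ0 i).tm + 1 ≤ (forIter f σ0 (i + 1)).tm := hfm i _
        have hfs : P.eval (((forIter f σ0 i).setVar x i).tick 1) = forIter f σ0 (i + 1) := by
          conv_rhs => rw [forIter, hf]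
          rw [hf]
        let s3 : State := s.setReg (4 * x) i
        have q3 : ∀ r, r ≠ 4 * x → s3.reg r = s.reg r := fun r h => by simp [s3, State.setReg, h]
        have hsv : Models base (((forIter f σ0 i).setVar x i).tick 1) s3 :=
          (hs.setVar (s' := s3) rfl (by simp [s3, State.setReg]) fun r h _ _ => q3 r h).tick 1
        have hBv := ((hBi i (by omega)).setVar (x := x) (v := i) (by omega)).tick 1
        obtain ⟨t4, s4, h4, hR4, hX4, hd4, ht4⟩ := ih (d + 2) hsv hBv (by rw [hfs]; omega)
        rw [hfs] at hR4 ht4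
        simp only [St.tick_tm, St.setVar_tm] at ht4
        have c4 : s4.reg (4 * d + 2) = i := by
          rw [hd4 d (by omega), q3 _ (by omega), hc]
        have l4 : s4.reg (4 * (d + 1) + 2) = n := by
          rw [hd4 (d + 1) (by omega), q3 _ (by omega), hl]
        let s5 : State := (s4.setReg 1 1).setReg (4 * d + 2) (i + 1)
        have h5 : Exec W (.seq (.imm 1 1) (.add (4 * d + 2) (4 * d + 2) 1)) s4 (1 + 1) s5 := by
          refine .seq (.imm _ _ _ (by omega)) ?_
          have e1 : 4 * d + 2 ≠ 1 := by omega
          have := Exec.add (W := W) (s4.setReg 1 1) (4 * d + 2) (4 * d + 2) 1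
            (by simp [State.setReg, e1, c4]; omega)
          simpa [State.setReg, c4, e1, s5] using this
        have q5 : ∀ r, r ≠ 1 → r ≠ 4 * d + 2 → s5.reg r = s4.reg r := fun r h h' => by
          simp [s5, State.setReg, h, h']
        obtain ⟨t6, s6, h6, hR6, hX6, hd6, ht6⟩ := ihk (i + 1) (by omega) s5
          (hR4.congr rfl fun r h h' => q5 r (by omega) (by omega))
          (by simp [s5, State.setReg]) (by rw [q5 _ (by omega) (by omega), l4])
        have hmov : Exec W (.mov (4 * x) (4 * d + 2)) s 1 s3 := by
          have := Exec.mov (W := W) s (4 * x) (4 * d + 2)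
          rwa [hc] at this
        refine ⟨_, s6, .whileTrue (by omega) (.seq hmov (.seq h4 h5)) h6, hR6, ?_, ?_, ?_⟩
        · have hX3 : Ext base s s3 := .congr rfl (q3 _ (by omega))
          have hX5 : Ext base s4 s5 := .congr rfl (q5 _ (by omega) (by omega))
          exact hX3.trans (hX4.trans (hX5.trans hX6))
        · intro k' hk'
          rw [hd6 k' hk', q5 _ (by omega) (by omega), hd4 _ (by omega), q3 _ (by omega)]
        · omega
    obtain ⟨t6, s6, h6, hR6, hX6, hd6, ht6⟩ := key n 0 (by omega) s2 hR2
      (by simp [s2, State.setReg]) (by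
        have e1 : 4 * (d + 1) + 2 ≠ 4 * d + 2 := by omega
        simp [s2, State.setReg, e1])
    refine ⟨_, s6, .seq h1 (.seq h2a (.seq h2b h6)), hR6, ?_, ?_, ?_⟩
    · exact ((Ext.congr hm1 (hr1 _ (by omega))).trans (Ext.congr (s' := s2) rfl
        (q2 _ (by omega) (by omega)))).trans hX6
    · intro k hk
      rw [hd6 k hk, q2 _ (by omega) (by omega), hr1 _ (by omega)]
    · simp only [forIter] at ht6
      omega
  | forL j e x y P ih =>
    have hev := hB.eval e
    have hj := j.isLt
    obtain ⟨f, hf⟩ : ∃ f : St → ℕ × ℕ → St,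
      f = fun s a => P.eval (((s.setVar x a.1).setVar y a.2).tick 1) := ⟨_, rfl⟩
    have hfm : ∀ s a, s.tm + 1 ≤ (f s a).tm := fun s a => by
      rw [hf]; exact P.tm_le_eval (((s.setVar x a.1).setVar y a.2).tick 1)
    have hfm' : ∀ s a, s.tm ≤ (f s a).tm := fun i s => by have := hfm i s; omega
    obtain ⟨σ0, hσ0⟩ : ∃ σ0, σ0 = σ.tick (1 + e.cost) := ⟨_, rfl⟩
    have htm : σ0.tm = σ.tm + (1 + e.cost) := by rw [hσ0]; rfl
    have hB0 : Bounded B σ0 := by rw [hσ0]; exact hB.tick _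
    have hres : (Cmd.forL j e x y P).eval σ = (σ.lst j (e.eval σ)).foldl f σ0 := by
      rw [hf, hσ0]; rfl
    rw [hres] at hW ⊢
    have hm0 := foldl_tm_le hfm' (σ.lst j (e.eval σ)) σ0
    obtain ⟨t1, s1, h1, ht1, hm1, he1, hr1⟩ := exec_compE (W := W) hR hB e 0 (by omega)
    have hR1 := hR.congr hm1 fun r h _ => hr1 r (.inl h)
    have hx1 : s1.reg 1 = e.eval σ := he1
    obtain ⟨s2, h2, hm2, he2, hr2⟩ := exec_loadAt (W := W) 0 (4 * d + 2) 1 (8 + j) hR1.hbase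
      (by omega)
    let s3 : State := s2.setReg (4 * (d + 1) + 2) 0
    have q3 : ∀ r, r ≠ 4 * (d + 1) + 2 → s3.reg r = s2.reg r := fun r h => by
      simp [s3, State.setReg, h]
    have q3' : ∀ r, r % 4 ≠ 1 → r ≠ 4 * (d + 1) + 2 → r ≠ 4 * d + 2 → s3.reg r = s.reg r :=
      fun r h h' h'' => by
        rw [q3 _ h', hr2 _ h'' (by omega) (by omega), hr1 _ (.inl h)]
    have hR3 : Models base σ0 s3 := by
      rw [hσ0]
      exact (hR.congr (s' := s3) (hm2.trans hm1) fun r h h' => q3' r h (by omega) (by omega)).tick _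
    have key : ∀ (L : List (ℕ × ℕ)) (σ : St) (s : State), Models base σ s → Bounded B σ →
        base + 32 * (B + (L.foldl f σ).tm) + 64 ≤ W →
        (∀ a ∈ L, a.1 ≤ B + σ.tm ∧ a.2 ≤ B + σ.tm) →
        Chain base s.mem (s.reg 11) (s.reg (4 * d + 2)) L → s.reg (4 * (d + 1) + 2) = 0 →
        ∃ t s', Exec W (.whileLt (4 * (d + 1) + 2) (4 * d + 2)
          (.seq (loadAt 0 (4 * x) (4 * d + 2) 24) (.seq (loadAt 0 (4 * y) (4 * d + 2) 25)
          (.seq (comp (d + 2) P) (loadAt 0 (4 * d + 2) (4 * d + 2) 26))))) s t s' ∧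
          Models base (L.foldl f σ) s' ∧ Ext base s s' ∧
          (∀ k < d, s'.reg (4 * k + 2) = s.reg (4 * k + 2)) ∧
          t + 80 * σ.tm ≤ 80 * (L.foldl f σ).tm + 1 := by
      intro L
      induction L with
      | nil =>
        intro σ s hs hBs hW hL hc hl
        have hc : s.reg (4 * d + 2) = 0 := hc
        exact ⟨_, s, .whileFalse (by omega), hs, .congr rfl rfl, fun _ _ => rfl, by simp; omega⟩
      | cons a L ihL =>
        intro σ s hs hBs hW hL hc hl
        obtain ⟨c1, c2, c3, c4, c5⟩ := hc
        have hfp := hs.fp_le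
        rw [List.foldl_cons] at hW ⊢
        have hml := foldl_tm_le hfm' L (f σ a)
        have hma := hfm σ a
        have hfs : P.eval (((σ.setVar x a.1).setVar y a.2).tick 1) = f σ a := by rw [hf]
        obtain ⟨ha1, ha2⟩ := hL a (by simp)
        obtain ⟨s4, h4, hm4, he4, hr4⟩ := exec_loadAt (W := W) 0 (4 * x) (4 * d + 2) 24 hs.hbase
          (by omega)
        rw [c3] at he4
        have hR4 : Models base (σ.setVar x a.1) s4 :=
          hs.setVar hm4 he4 fun r h h' _ => hr4 r h (by omega) (by omega)
        have q4 : s4.reg (4 * d + 2) = s.reg (4 * d + 2) := hr4 _ (by omega) (by omega) (by omega)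
        obtain ⟨s5, h5, hm5, he5, hr5⟩ := exec_loadAt (W := W) 0 (4 * y) (4 * d + 2) 25 hR4.hbase
          (by rw [q4]; omega)
        rw [q4, hm4, c4] at he5
        have hR5 : Models base (((σ.setVar x a.1).setVar y a.2).tick 1) s5 :=
          (hR4.setVar hm5 he5 fun r h h' _ => hr5 r h (by omega) (by omega)).tick 1
        have hB5 := ((hBs.setVar (x := x) ha1).setVar (x := y) ha2).tick 1
        have q5 : ∀ r, r % 4 ≠ 0 → r % 4 ≠ 1 → s5.reg r = s.reg r := fun r h h' => by
          rw [hr5 r (by omega) (by omega) (by omega), hr4 r (by omega) (by omega) (by omega)]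
        obtain ⟨t6, s6, h6, hR6, hX6, hd6, ht6⟩ := ih (d + 2) hR5 hB5 (by rw [hfs]; omega)
        have hB6 := hB5.cmd P
        rw [hfs] at hR6 ht6 hB6
        simp only [St.tick_tm, St.setVar_tm] at ht6
        have q6 : s6.reg (4 * d + 2) = s.reg (4 * d + 2) := by
          rw [hd6 d (by omega), q5 _ (by omega) (by omega)]
        have hX5 : Ext base s s5 := .congr (hm5.trans hm4) (q5 _ (by omega) (by omega))
        obtain ⟨s7, h7, hm7, he7, hr7⟩ := exec_loadAt (W := W) 0 (4 * d + 2) (4 * d + 2) 26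
          hR6.hbase (by rw [q6]; omega)
        rw [q6, hX6.mem _ (by rw [q5 _ (by omega) (by omega)]; exact c2) _ (by omega) (by omega),
          hX5.mem _ c2 _ (by omega) (by omega)] at he7
        have hX7 : Ext base s6 s7 := .congr hm7 (hr7 _ (by omega) (by omega) (by omega))
        obtain ⟨t8, s8, h8, hR8, hX8, hd8, ht8⟩ := ihL (f σ a) s7
          (hR6.congr hm7 fun r h h' => hr7 r (by omega) (by omega) (by omega)) hB6 hW
          (fun b hb => by
            have := hL b (by simp [hb])
            omega)
          (by rw [he7]; exact c5.ext (hX5.trans (hX6.trans hX7)))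
          (by rw [hr7 _ (by omega) (by omega) (by omega), hd6 (d + 1) (by omega),
                q5 _ (by omega) (by omega), hl])
        refine ⟨_, s8, .whileTrue (by omega) (.seq h4 (.seq h5 (.seq h6 h7))) h8, hR8,
          hX5.trans (hX6.trans (hX7.trans hX8)), ?_, ?_⟩
        · intro k hk
          rw [hd8 k hk, hr7 _ (by omega) (by omega) (by omega), hd6 k (by omega),
            q5 _ (by omega) (by omega)]
        · omega
    have hX3 : Ext base s s3 := .congr (hm2.trans hm1) (q3' _ (by omega) (by omega) (by omega))
    obtain ⟨t6, s6, h6, hR6, hX6, hd6, ht6⟩ := key (σ.lst j (e.eval σ)) σ0 s3 hR3 hB0 hW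
      (fun a ha => by
        have := hB.lst j _ a ha
        omega)
      (by
        rw [q3 (4 * d + 2) (by omega), he2, hx1, hm1]
        exact (hR.lst j _).ext hX3)
      (by simp [s3, State.setReg])
    refine ⟨_, s6, .seq h1 (.seq h2 (.seq (.imm _ _ _ (by omega)) h6)), hR6, hX3.trans hX6, ?_, ?_⟩
    · intro k hk
      rw [hd6 k hk, q3' _ (by omega) (by omega) (by omega)]
    · omega
  | whl f e e' P ih =>
    have hev := hB.eval f
    obtain ⟨g, hg⟩ : ∃ g : ℕ → St → St,
      g = whileIter (fun s => e.eval s < e'.eval s) (1 + e.cost + e'.cost) P.eval := ⟨_, rfl⟩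
    have hgm : ∀ k s, s.tm ≤ (g k s).tm := fun k s => by
      rw [hg]; exact whileIter_tm_le P.tm_le_eval k s
    obtain ⟨σ0, hσ0⟩ : ∃ σ0, σ0 = σ.tick (1 + f.cost) := ⟨_, rfl⟩
    have htm : σ0.tm = σ.tm + (1 + f.cost) := by rw [hσ0]; rfl
    have hB0 : Bounded B σ0 := by rw [hσ0]; exact hB.tick _
    have hres : (Cmd.whl f e e' P).eval σ = g (f.eval σ) σ0 := by rw [hg, hσ0]; rfl
    rw [hres] at hW ⊢
    have hm0 := hgm (f.eval σ) σ0
    obtain ⟨t1, s1, h1, ht1, hm1, he1, hr1⟩ := exec_compE (W := W) hR hB f 0 (by omega)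
    have hR1 := hR.congr hm1 fun r h _ => hr1 r (.inl h)
    have hx1 : s1.reg 1 = f.eval σ := he1
    let s2 : State := s1.setReg (4 * d + 2) (f.eval σ)
    have h2 : Exec W (.mov (4 * d + 2) 1) s1 1 s2 := by
      have := Exec.mov (W := W) s1 (4 * d + 2) 1
      rwa [hx1] at this
    let s3 : State := s2.setReg (4 * (d + 1) + 2) 0
    have q3 : ∀ r, r ≠ 4 * (d + 1) + 2 → r ≠ 4 * d + 2 → s3.reg r = s1.reg r := fun r h h' => by
      simp [s3, s2, State.setReg, h, h']
    have hR3 : Models base σ0 s3 := by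
      rw [hσ0]
      exact (hR1.congr (s' := s3) rfl fun r h h' => q3 r (by omega) (by omega)).tick _
    have key : ∀ (k : ℕ) (σ : St) (s : State), Models base σ s → Bounded B σ →
        base + 32 * (B + (g k σ).tm) + 64 ≤ W →
        s.reg (4 * d + 2) = k → s.reg (4 * (d + 1) + 2) = 0 →
        ∃ t s', Exec W (.whileLt (4 * (d + 1) + 2) (4 * d + 2)
          (.seq (compE 0 e) (.seq (compE 1 e') (.ifLt 1 5
          (.seq (comp (d + 2) P) (.seq (.imm 1 1) (.sub (4 * d + 2) (4 * d + 2) 1)))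
          (.imm (4 * d + 2) 0))))) s t s' ∧
          Models base (g k σ) s' ∧ Ext base s s' ∧
          (∀ k < d, s'.reg (4 * k + 2) = s.reg (4 * k + 2)) ∧
          t + 80 * σ.tm ≤ 80 * (g k σ).tm + 1 := by
      intro k
      induction k with
      | zero =>
        intro σ s hs hBs hW hc hl
        have : g 0 σ = σ := by rw [hg]; rfl
        rw [this]
        exact ⟨_, s, .whileFalse (by omega), hs, .congr rfl rfl, fun _ _ => rfl, by omega⟩
      | succ k ihk =>
        intro σ s hs hBs hW hc hl
        have hstep : g (k + 1) σ = if e.eval σ < e'.eval σ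
            then g k (P.eval (σ.tick (1 + e.cost + e'.cost)))
            else σ.tick (1 + e.cost + e'.cost) := by rw [hg]; rfl
        have hcost : σ.tm + (1 + e.cost + e'.cost) ≤ (g (k + 1) σ).tm := by
          rw [hstep]; split
          · exact (P.tm_le_eval (σ.tick (1 + e.cost + e'.cost))).trans (hgm _ _)
          · exact le_rfl
        obtain ⟨t4, s4, h4, ht4, hm4, he4, hr4⟩ := exec_compE (W := W) hs hBs e 0 (by omega)
        have hR4 := hs.congr hm4 fun r h _ => hr4 r (.inl h)
        obtain ⟨t5, s5, h5, ht5, hm5, he5, hr5⟩ := exec_compE (W := W) hR4 hBs e' 1 (by omega)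
        have hR5 := hR4.congr hm5 fun r h _ => hr5 r (.inl h)
        have p1 : s5.reg 1 = e.eval σ := by rw [hr5 _ (by omega), he4]
        have p5 : s5.reg 5 = e'.eval σ := he5
        have q5 : ∀ r, r % 4 ≠ 1 → s5.reg r = s.reg r := fun r h => by
          rw [hr5 _ (by omega), hr4 _ (by omega)]
        have hX5 : Ext base s s5 := .congr (hm5.trans hm4) (q5 _ (by omega))
        by_cases hlt : e.eval σ < e'.eval σ
        · rw [hstep, if_pos hlt] at hW ⊢
          have hmk := hgm k (P.eval (σ.tick (1 + e.cost + e'.cost)))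
          have hmp := P.tm_le_eval (σ.tick (1 + e.cost + e'.cost))
          obtain ⟨t6, s6, h6, hR6, hX6, hd6, ht6⟩ := ih (d + 2) (hR5.tick _)
            (hBs.tick (1 + e.cost + e'.cost)) (by omega)
          simp only [St.tick_tm] at ht6 hmp
          let s7 : State := (s6.setReg 1 1).setReg (4 * d + 2) k
          have e1 : 4 * d + 2 ≠ 1 := by omega
          have c6 : s6.reg (4 * d + 2) = k + 1 := by
            rw [hd6 d (by omega), q5 _ (by omega), hc]
          have h7 : Exec W (.seq (.imm 1 1) (.sub (4 * d + 2) (4 * d + 2) 1)) s6 (1 + 1) s7 := by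
            refine .seq (.imm _ _ _ (by omega)) ?_
            have := Exec.sub (W := W) (s6.setReg 1 1) (4 * d + 2) (4 * d + 2) 1
            simpa [State.setReg, c6, e1, s7] using this
          have q7 : ∀ r, r ≠ 1 → r ≠ 4 * d + 2 → s7.reg r = s6.reg r := fun r h h' => by
            simp [s7, State.setReg, h, h']
          have hX7 : Ext base s6 s7 := .congr rfl (q7 _ (by omega) (by omega))
          obtain ⟨t8, s8, h8, hR8, hX8, hd8, ht8⟩ := ihk _ s7
            (hR6.congr (s' := s7) rfl fun r h h' => q7 r (by omega) (by omega))
            ((hBs.tick _).cmd P) hW (by simp [s7, State.setReg])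
            (by rw [q7 _ (by omega) (by omega), hd6 (d + 1) (by omega), q5 _ (by omega), hl])
          refine ⟨_, s8, .whileTrue (by omega) (.seq h4 (.seq h5 (.ifTrue (by rwa [p1, p5])
            (.seq h6 h7)))) h8, hR8, hX5.trans (hX6.trans (hX7.trans hX8)), ?_, ?_⟩
          · intro k' hk
            rw [hd8 k' hk, q7 _ (by omega) (by omega), hd6 k' (by omega), q5 _ (by omega)]
          · omega
        · rw [hstep, if_neg hlt] at hW ⊢
          let s6 : State := s5.setReg (4 * d + 2) 0
          have q6 : ∀ r, r ≠ 4 * d + 2 → s6.reg r = s5.reg r := fun r h => by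
            simp [s6, State.setReg, h]
          have hX6 : Ext base s5 s6 := .congr rfl (q6 _ (by omega))
          have z6 : s6.reg (4 * d + 2) = 0 := by simp [s6, State.setReg]
          refine ⟨_, s6, .whileTrue (by omega) (.seq h4 (.seq h5 (.ifFalse (by rwa [p1, p5])
            (.imm _ _ _ (by omega))))) (.whileFalse (by change ¬ _ < s6.reg _; omega)),
            (hR5.congr (s' := s6) rfl fun r h h' => q6 r (by omega)).tick _, hX5.trans hX6, ?_, ?_⟩
          · intro k' hk
            rw [q6 _ (by omega), q5 _ (by omega)]
          · simp only [St.tick_tm]; omega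
    have q3' : ∀ r, r % 4 ≠ 1 → r ≠ 4 * (d + 1) + 2 → r ≠ 4 * d + 2 → s3.reg r = s.reg r :=
      fun r h h' h'' => by rw [q3 _ h' h'', hr1 _ (.inl h)]
    have hX3 : Ext base s s3 := .congr hm1 (q3' _ (by omega) (by omega) (by omega))
    have e1 : 4 * d + 2 ≠ 4 * (d + 1) + 2 := by omega
    obtain ⟨t6, s6, h6, hR6, hX6, hd6, ht6⟩ := key (f.eval σ) σ0 s3 hR3 hB0 hW
      (by simp [s3, s2, State.setReg, e1]) (by simp [s3, State.setReg])
    refine ⟨_, s6, .seq h1 (.seq h2 (.seq (.imm _ _ _ (by omega)) h6)), hR6, hX3.trans hX6, ?_, ?_⟩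
    · intro k hk
      rw [hd6 k hk, q3' _ (by omega) (by omega) (by omega)]
    · omega

end RamLang

/-! ### Complete programs: finding the end of the input, and copying the result -/

namespace RamLang

open WordRAM (Prog State Exec)

variable {W base B : ℕ}

/-- The loop that skips one block of the input after the other; `reg 3` is the position. -/
def skipBlocks : Prog :=
  .whileLt 2 9 (.seq (.load 5 3) (.seq (.add 5 5 5) (.seq (.add 3 3 5) (.seq (.add 3 3 1)
    (.add 2 2 1)))))

theorem length_pairBlock (b : List (ℕ × ℕ)) :
    (SepTree.pairBlock b).length = 2 * b.length + 1 := by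
  induction b with
  | nil => rfl
  | cons a b ih => simp [SepTree.pairBlock] at ih ⊢; omega

theorem exec_skipBlocks {input : List ℕ} (hW : 2 * input.length + 1 < W)
    (bs : List (List (ℕ × ℕ))) :
    ∀ (pre : List ℕ) (s : State), input = pre ++ bs.flatMap SepTree.pairBlock →
      s.mem = (fun a => input.getD a 0) → s.reg 3 = pre.length →
      s.reg 2 + bs.length = s.reg 9 → s.reg 9 ≤ input.length → s.reg 1 = 1 →
      ∃ t s', Exec W skipBlocks s t s' ∧ t ≤ 6 * bs.length + 1 ∧ s'.mem = s.mem ∧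
        s'.reg 3 = input.length ∧ ∀ r, r ≠ 2 → r ≠ 3 → r ≠ 5 → s'.reg r = s.reg r := by
  induction bs with
  | nil =>
    intro pre s hi hm h3 h2 h9 h1
    refine ⟨_, s, .whileFalse (by simp at h2; omega), by simp, rfl, ?_, fun _ _ _ _ => rfl⟩
    rw [h3, hi]; simp
  | cons b bs ih =>
    intro pre s hi hm h3 h2 h9 h1
    have hlen : s.mem (s.reg 3) = b.length := by
      rw [hm, h3, hi]; simp [SepTree.pairBlock, List.getElem?_append_right]
    have hl : pre.length + (2 * b.length + 1) + (bs.flatMap SepTree.pairBlock).length =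
        input.length := by
      rw [hi]; simp [length_pairBlock]; omega
    simp only [List.length_cons] at h2
    let s1 : State := ((s.setReg 5 (b.length + b.length)).setReg 3
      (pre.length + (2 * b.length + 1))).setReg 2 (s.reg 2 + 1)
    obtain ⟨t, s', h, ht, hm', h3', hr⟩ := ih (pre ++ SepTree.pairBlock b) s1
      (by rw [hi]; simp) hm (by simp [s1, State.setReg, length_pairBlock])
      (by simp [s1, State.setReg]; omega) (by simp [s1, State.setReg]; omega)
      (by simp [s1, State.setReg, h1])
    have hb : ∃ t, t = 5 ∧ Exec W (.seq (.load 5 3) (.seq (.add 5 5 5) (.seq (.add 3 3 5)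
        (.seq (.add 3 3 1) (.add 2 2 1))))) s t s1 := by
      have hs1 : s1 = (((((s.setReg 5 (s.mem (s.reg 3))).setReg 5 (b.length + b.length)).setReg 3
          (pre.length + (b.length + b.length))).setReg 3
          (pre.length + (b.length + b.length) + 1)).setReg 2 (s.reg 2 + 1)) := by
        simp only [s1, State.setReg, Function.update_idem]
        rw [show pre.length + (2 * b.length + 1) = pre.length + (b.length + b.length) + 1 by omega]
      refine ⟨1 + (1 + (1 + (1 + 1))), rfl, ?_⟩
      rw [hs1]
      refine .seq (.load ..) (.seq (s₂ := (s.setReg 5 (s.mem (s.reg 3))).setReg 5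
        (b.length + b.length)) ?_ (.seq (s₂ := ((s.setReg 5 (s.mem (s.reg 3))).setReg 5
        (b.length + b.length)).setReg 3 (pre.length + (b.length + b.length))) ?_
        (.seq (s₂ := (((s.setReg 5 (s.mem (s.reg 3))).setReg 5
        (b.length + b.length)).setReg 3 (pre.length + (b.length + b.length))).setReg 3
        (pre.length + (b.length + b.length) + 1)) ?_ ?_)))
      · have := Exec.add (W := W) (s.setReg 5 (s.mem (s.reg 3))) 5 5 5
          (by simp [State.setReg, hlen]; omega)
        simpa [State.setReg, hlen] using this
      · have := Exec.add (W := W) ((s.setReg 5 (s.mem (s.reg 3))).setReg 5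
          (b.length + b.length)) 3 3 5 (by simp [State.setReg, h3]; omega)
        simpa [State.setReg, h3] using this
      · have := Exec.add (W := W) (((s.setReg 5 (s.mem (s.reg 3))).setReg 5
          (b.length + b.length)).setReg 3 (pre.length + (b.length + b.length))) 3 3 1
          (by simp [State.setReg, h1]; omega)
        simpa [State.setReg, h1] using this
      · have := Exec.add (W := W) ((((s.setReg 5 (s.mem (s.reg 3))).setReg 5
          (b.length + b.length)).setReg 3 (pre.length + (b.length + b.length))).setReg 3
          (pre.length + (b.length + b.length) + 1)) 2 2 1
          (by simp [State.setReg, h1]; omega)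
        simpa [State.setReg, h1] using this
    obtain ⟨tb, rfl, hb⟩ := hb
    refine ⟨_, s', .whileTrue (by omega) hb h, ?_, hm', h3', ?_⟩
    · simp; omega
    · intro r h2 h3 h5
      rw [hr r h2 h3 h5]; simp [s1, State.setReg, h2, h3, h5]

/-- The length of the input goes to `reg 3`, and the first list cell will be the one with
index `1`. -/
def entryCode : Prog :=
  .seq (.imm 1 1) (.seq (.load 5 1) (.seq (.add 5 5 5) (.seq (.imm 1 2) (.seq (.add 3 1 5)
    (.seq (.load 9 3) (.seq (.add 9 9 9) (.seq (.imm 1 1) (.seq (.add 3 3 1)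
      (.seq skipBlocks (.imm 11 1))))))))))

/-- The input words of a graph and a list of blocks of pairs, two for each separation. -/
def inputWords (n : ℕ) (E : List (ℕ × ℕ)) (p : ℕ) (bs : List (List (ℕ × ℕ))) : List ℕ :=
  n :: SepTree.pairBlock E ++ p :: bs.flatMap SepTree.pairBlock

/-- The initial state of the source language. -/
def initSt (input : List ℕ) : St where
  var _ := 0
  arr _ _ := 0
  lst _ _ := []
  inp := input
  tm := 0

theorem exec_entryCode {n p : ℕ} {E : List (ℕ × ℕ)} {bs : List (List (ℕ × ℕ))}
    (hbs : bs.length = 2 * p) (hW : 2 * (inputWords n E p bs).length + 2 < W) :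
    ∃ t s', Exec W entryCode (WordRAM.initState (inputWords n E p bs)) t s' ∧
      t ≤ 12 * (inputWords n E p bs).length + 20 ∧
      Models (inputWords n E p bs).length (initSt (inputWords n E p bs)) s' := by
  obtain ⟨input, hinp⟩ : ∃ l, l = inputWords n E p bs := ⟨_, rfl⟩
  rw [← hinp] at hW ⊢
  set s := WordRAM.initState input with hs
  have hlen : input.length = 2 * E.length + 3 + (bs.flatMap SepTree.pairBlock).length := by
    rw [hinp]; simp [inputWords, length_pairBlock]; omega
  have hbl : bs.length ≤ (bs.flatMap SepTree.pairBlock).length := by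
    clear * -
    induction bs with
    | nil => simp
    | cons b bs ih => simp [length_pairBlock]; omega
  have hmem : s.mem = fun a => input.getD a 0 := rfl
  have hreg : ∀ r, s.reg r = 0 := fun _ => rfl
  have hm1 : s.mem 1 = E.length := by rw [hmem, hinp]; simp [inputWords, SepTree.pairBlock]
  have hmp : s.mem (2 + (E.length + E.length)) = p := by
    rw [hmem, hinp]
    have h1 : inputWords n E p bs = (n :: SepTree.pairBlock E) ++ p ::
      bs.flatMap SepTree.pairBlock := rfl
    have h2 : (n :: SepTree.pairBlock E).length = 2 + (E.length + E.length) := by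
      simp [length_pairBlock]; omega
    rw [h1, ← h2]
    simp only [List.getD_eq_getElem?_getD]
    rw [List.getElem?_append_right le_rfl]; simp
  obtain ⟨s1, hs1⟩ : ∃ s1 : State, s1 = (((((((((s.setReg 1 1).setReg 5 E.length).setReg 5
    (E.length + E.length)).setReg 1 2).setReg 3 (2 + (E.length + E.length))).setReg 9 p).setReg 9
    (p + p)).setReg 1 1).setReg 3 (2 + (E.length + E.length) + 1)) := ⟨_, rfl⟩
  have q1 : s1.reg 1 = 1 := by simp [hs1, State.setReg]
  have q3 : s1.reg 3 = 2 + (E.length + E.length) + 1 := by simp [hs1, State.setReg]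
  have q9 : s1.reg 9 = p + p := by simp [hs1, State.setReg]
  have q : ∀ r, r ≠ 1 → r ≠ 3 → r ≠ 5 → r ≠ 9 → s1.reg r = 0 := fun r h1 h3 h5 h9 => by
    simp [hs1, State.setReg, h1, h3, h5, h9, hreg]
  have qm : s1.mem = s.mem := by simp [hs1, State.setReg]
  obtain ⟨t, s2, h2, ht, m2, r3, r2⟩ := exec_skipBlocks (W := W) (input := input) (by omega) bs
    (n :: SepTree.pairBlock E ++ [p]) s1 (by rw [hinp]; simp [inputWords]) (qm.trans hmem)
    (by rw [q3]; simp [length_pairBlock]; omega) (by rw [q9, q 2] <;> omega) (by omega) q1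
  have hex : Exec W entryCode s (1 + (1 + (1 + (1 + (1 + (1 + (1 + (1 + (1 + (t + 1))))))))))
      (s2.setReg 11 1) := by
    refine .seq (.imm _ _ _ (by omega)) (.seq (.load ..) (.seq (.add _ _ _ _ ?_)
      (.seq (.imm _ _ _ (by omega)) (.seq (.add _ _ _ _ ?_) (.seq (.load ..)
      (.seq (.add _ _ _ _ ?_) (.seq (.imm _ _ _ (by omega)) (.seq (.add _ _ _ _ ?_)
      (.seq ?_ (.imm _ _ _ (by omega)))))))))))
    · simp [State.setReg, hm1]; omega
    · simp [State.setReg, hm1]; omega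
    · simp [State.setReg, hm1, hmp]; omega
    · simp [State.setReg, hm1, hmp]; omega
    · convert h2 using 1
      rw [hs1]
      simp [State.setReg, hm1, hmp]
  have r11 : ∀ r, r ≠ 11 → (s2.setReg 11 1).reg r = s2.reg r := fun r h => by
    simp [State.setReg, h]
  have z11 : (s2.setReg 11 1).reg 11 = 1 := by simp [State.setReg]
  have mm : (s2.setReg 11 1).mem = s.mem := m2.trans qm
  refine ⟨_, _, hex, by omega, ?_, ?_, ?_, ?_, ?_, ?_, ?_, ?_⟩
  · intro x
    rw [r11 _ (by omega), r2 _ (by omega) (by omega) (by omega),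
      q _ (by omega) (by omega) (by omega) (by omega)]
    rfl
  · rw [r11 _ (by omega), r3]
  · rw [r11 _ (by omega), r2 _ (by omega) (by omega) (by omega),
      q _ (by omega) (by omega) (by omega) (by omega)]
    simp [initSt]
  · intro i _
    rw [r11 _ (by omega), r2 _ (by omega) (by omega) (by omega),
      q _ (by omega) (by omega) (by omega) (by omega), mm, hmem]
    simp [initSt]
  · intro j i
    rw [mm, hmem]
    simp only [initSt]
    rw [List.getD_eq_getElem?_getD, List.getElem?_eq_none (by omega)]; rfl
  · intro j i
    rw [mm, hmem]
    simp only [initSt, Chain]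
    rw [List.getD_eq_getElem?_getD, List.getElem?_eq_none (by omega)]; rfl
  · rw [z11]
  · rw [z11]; omega

/-- The loop that copies the first components of a list, starting with the cell in `reg 2`, to
consecutive addresses from `reg 6` on. -/
def copyLoop : Prog :=
  .whileLt 10 2 (.seq (loadAt 0 9 2 24) (.seq (.store 6 9) (.seq (.imm 9 1) (.seq (.add 6 6 9)
    (loadAt 0 2 2 26)))))

theorem Chain.mem_congr {mem mem' : ℕ → ℕ} {fp : ℕ}
    (h : ∀ a < base + 32 * fp, mem' a = mem a) {p : ℕ} {L : List (ℕ × ℕ)}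
    (hc : Chain base mem fp p L) : Chain base mem' fp p L := by
  induction L generalizing p with
  | nil => exact hc
  | cons a L ih =>
    obtain ⟨h1, h2, h3, h4, h5⟩ := hc
    refine ⟨h1, h2, ?_, ?_, ?_⟩
    · rw [h _ (by omega), h3]
    · rw [h _ (by omega), h4]
    · rw [h _ (by omega)]; exact ih h5

theorem exec_copyLoop {fp : ℕ} (L : List (ℕ × ℕ)) :
    ∀ s : State, s.reg 3 = base → s.reg 10 = 0 → base + 32 * fp ≤ s.reg 6 →
      s.reg 6 + L.length + 2 ≤ W → base + 32 * fp + 32 ≤ W → Chain base s.mem fp (s.reg 2) L →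
      ∃ t s', Exec W copyLoop s t s' ∧ t ≤ 24 * L.length + 1 ∧ s'.reg 0 = s.reg 0 ∧
        (∀ a < s.reg 6, s'.mem a = s.mem a) ∧
        ∀ i < L.length, s'.mem (s.reg 6 + i) = (L.map Prod.fst).getD i 0 := by
  induction L with
  | nil =>
    intro s h3 h10 h6 hW hW' hc
    have hc : s.reg 2 = 0 := hc
    exact ⟨_, s, .whileFalse (by omega), by simp, rfl, fun _ _ => rfl, by simp⟩
  | cons a L ih =>
    intro s h3 h10 h6 hW hW' hc
    obtain ⟨c1, c2, c3, c4, c5⟩ := hc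
    simp only [List.length_cons] at hW
    obtain ⟨s1, h1, hm1, he1, hr1⟩ := exec_loadAt (W := W) 0 9 2 24 h3 (by omega)
    rw [c3] at he1
    have p6 : s1.reg 6 = s.reg 6 := hr1 _ (by omega) (by omega) (by omega)
    obtain ⟨s2, hs2⟩ : ∃ s2 : State, s2 =
      ((s1.setMem (s.reg 6) a.1).setReg 9 1).setReg 6 (s.reg 6 + 1) := ⟨_, rfl⟩
    have x1 : Exec W (.store 6 9) s1 1 (s1.setMem (s.reg 6) a.1) := by
      rw [← p6, ← he1]; exact .store ..
    have x2 : Exec W (.imm 9 1) (s1.setMem (s.reg 6) a.1) 1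
        ((s1.setMem (s.reg 6) a.1).setReg 9 1) :=
      .imm _ _ _ (by omega)
    have x3 : Exec W (.add 6 6 9) ((s1.setMem (s.reg 6) a.1).setReg 9 1) 1 s2 := by
      have := Exec.add (W := W) ((s1.setMem (s.reg 6) a.1).setReg 9 1) 6 6 9
        (by simp [State.setReg, State.setMem, p6]; omega)
      rw [hs2]
      simpa [State.setReg, State.setMem, p6] using this
    have q2 : ∀ r, r ≠ 9 → r ≠ 6 → s2.reg r = s1.reg r := fun r h h' => by
      simp [hs2, State.setReg, State.setMem, h, h']
    have q6 : s2.reg 6 = s.reg 6 + 1 := by simp [hs2, State.setReg]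
    have m2 : ∀ b, s2.mem b = if b = s.reg 6 then a.1 else s.mem b := fun b => by
      simp [hs2, State.setReg, State.setMem, Function.update_apply, hm1]
    have r22 : s2.reg 2 = s.reg 2 := by
      rw [q2 _ (by omega) (by omega), hr1 _ (by omega) (by omega) (by omega)]
    obtain ⟨s3, h4, hm3, he3, hr3⟩ := exec_loadAt (W := W) (s := s2) 0 2 2 26
      (by rw [q2 _ (by omega) (by omega), hr1 _ (by omega) (by omega) (by omega), h3])
      (by rw [r22]; omega)
    rw [r22, m2, if_neg (by omega)] at he3
    have p36 : s3.reg 6 = s.reg 6 + 1 := by rw [hr3 _ (by omega) (by omega) (by omega), q6]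
    have p3 : ∀ r, r ≠ 1 → r ≠ 2 → r ≠ 5 → r ≠ 9 → r ≠ 6 → s3.reg r = s.reg r :=
      fun r ha hb hc hd he => by
        rw [hr3 _ (by omega) (by omega) (by omega), q2 _ (by omega) (by omega),
          hr1 _ (by omega) (by omega) (by omega)]
    obtain ⟨t, s4, h5, ht, z4, m4, o4⟩ := ih s3
      (by rw [p3 _ (by omega) (by omega) (by omega) (by omega) (by omega), h3])
      (by rw [p3 _ (by omega) (by omega) (by omega) (by omega) (by omega), h10])
      (by omega) (by omega) hW'
      (by
        rw [he3]
        refine c5.mem_congr fun b hb => ?_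
        rw [hm3, m2, if_neg (by omega)])
    refine ⟨_, s4, .whileTrue (by omega) (.seq h1 (.seq x1 (.seq x2 (.seq x3 h4)))) h5,
      ?_, ?_, ?_, ?_⟩
    · simp; omega
    · rw [z4, p3 _ (by omega) (by omega) (by omega) (by omega) (by omega)]
    · intro b hb
      rw [m4 _ (by omega), hm3, m2, if_neg (by omega)]
    · intro i hi
      cases i with
      | zero =>
        rw [Nat.add_zero, m4 _ (by omega), hm3, m2, if_pos rfl]; simp
      | succ i =>
        have := o4 i (by simpa using hi)
        rw [show s.reg 6 + (i + 1) = s3.reg 6 + i by omega, this]; simp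

/-- Copy the list with key `0` of the family `0` to fresh consecutive addresses. -/
def exitCode : Prog :=
  .seq (.imm 5 0) (.seq (loadAt 0 2 5 8) (.seq (.mov 0 11) (.seq (.add 0 0 0) (.seq (.add 0 0 0)
    (.seq (.add 0 0 0) (.seq (.add 0 0 0) (.seq (.add 0 0 0) (.seq (.add 0 0 3)
      (.seq (.mov 6 0) (.seq (.imm 10 0) copyLoop))))))))))

theorem exec_exitCode {σ : St} {s : State} (hR : Models base σ s)
    (hW : base + 32 * (1 + σ.tm) + (σ.lst 0 0).length + 64 ≤ W) :
    ∃ t s', Exec W exitCode s t s' ∧ t ≤ 24 * (σ.lst 0 0).length + 30 ∧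
      s'.Outputs ((σ.lst 0 0).map Prod.fst) := by
  have hfp := hR.fp_le
  have hch := hR.lst 0 0
  obtain ⟨L, hL⟩ : ∃ L, L = σ.lst 0 0 := ⟨_, rfl⟩
  rw [← hL] at hW hch ⊢
  obtain ⟨fp, hfp'⟩ : ∃ fp, fp = s.reg 11 := ⟨_, rfl⟩
  rw [← hfp'] at hfp hch
  have x0 : Exec W (.imm 5 0) s 1 (s.setReg 5 0) := .imm _ _ _ (by omega)
  obtain ⟨s1, h1, hm1, he1, hr1⟩ := exec_loadAt (W := W) (base := base) (s := s.setReg 5 0)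
    0 2 5 8 (by simp [State.setReg, hR.hbase]) (by simp [State.setReg]; omega)
  have q1 : ∀ r, r ≠ 1 → r ≠ 2 → r ≠ 5 → s1.reg r = s.reg r := fun r h h' h'' => by
    rw [hr1 _ (by omega) (by omega) (by omega)]; simp [State.setReg, h'']
  have q11 : s1.reg 11 = fp := by rw [q1 _ (by omega) (by omega) (by omega), hfp']
  have q3 : s1.reg 3 = base := by rw [q1 _ (by omega) (by omega) (by omega), hR.hbase]
  obtain ⟨s2, hs2⟩ : ∃ s2 : State, s2 = ((s1.setReg 0 (base + 32 * fp)).setReg 6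
    (base + 32 * fp)).setReg 10 0 := ⟨_, rfl⟩
  have m2 : s2.mem = s.mem := by rw [hs2]; exact hm1
  obtain ⟨t, s3, h3, ht, z3, -, o3⟩ := exec_copyLoop (W := W) (base := base) (fp := fp) L s2
    (by simp [hs2, State.setReg, q3]) (by simp [hs2, State.setReg])
    (by simp [hs2, State.setReg]) (by simp [hs2, State.setReg]; omega) (by omega)
    (by
      have : s2.reg 2 = s.mem (base + 8) := by
        have : s2.reg 2 = s1.reg 2 := by simp [hs2, State.setReg]
        rw [this, he1]; simp [State.setReg]
      rw [this, m2]
      simpa using hch)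
  have s26 : s2.reg 6 = base + 32 * fp := by simp [hs2, State.setReg]
  have s20 : s2.reg 0 = base + 32 * fp := by simp [hs2, State.setReg]
  have hex : Exec W exitCode s (1 + (10 + (1 + (1 + (1 + (1 + (1 + (1 + (1 + (1 + (1 + t)))))))))))
      s3 := by
    refine .seq x0 (.seq h1 (.seq (.mov ..) (.seq (.add _ _ _ _ ?_) (.seq (.add _ _ _ _ ?_)
      (.seq (.add _ _ _ _ ?_) (.seq (.add _ _ _ _ ?_) (.seq (.add _ _ _ _ ?_)
      (.seq (.add _ _ _ _ ?_) (.seq (.mov ..) (.seq (.imm _ _ _ (by omega)) ?_))))))))))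
    any_goals (simp [State.setReg, q11, q3]; omega)
    convert h3 using 1
    rw [hs2]
    simp only [State.setReg, Function.update_idem, Function.update_self, q11, q3, ne_eq,
      OfNat.ofNat_ne_zero, not_false_eq_true, Function.update_of_ne]
    have : fp + fp + (fp + fp) + (fp + fp + (fp + fp)) + (fp + fp + (fp + fp) +
      (fp + fp + (fp + fp))) + (fp + fp + (fp + fp) + (fp + fp + (fp + fp)) +
      (fp + fp + (fp + fp) + (fp + fp + (fp + fp)))) + base = base + 32 * fp := by omega
    rw [this]
  refine ⟨_, s3, hex, by omega, ?_⟩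
  intro i hi
  rw [z3, s20, ← s26]
  exact o3 i (by simpa using hi)

/-- The complete program: read the input, run `P`, write the list with key `0` of the
family `0`. -/
def program (P : Cmd) : Prog := .seq entryCode (.seq (comp 0 P) exitCode)

/-- The compiled program computes what the command computes, in proportional time, as soon as
all words fit that can arise within the running time. -/
theorem exec_program (P : Cmd) {n p : ℕ} {E : List (ℕ × ℕ)} {bs : List (List (ℕ × ℕ))}
    (hbs : bs.length = 2 * p) {input : List ℕ} (hin : input = inputWords n E p bs)
    (hB : ∀ a ∈ input, a ≤ B)
    (hW : 2 * input.length + 32 * B + 33 * (P.eval (initSt input)).tm + 128 ≤ W) :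
    ∃ t s, Exec W (program P) (WordRAM.initState input) t s ∧
      t ≤ 12 * input.length + 104 * (P.eval (initSt input)).tm + 50 ∧
      s.Outputs (((P.eval (initSt input)).lst 0 0).map Prod.fst) := by
  obtain ⟨t1, s1, h1, ht1, hR1⟩ := exec_entryCode (W := W) (n := n) (p := p) (E := E) hbs
    (by rw [← hin]; omega)
  rw [← hin] at h1 ht1 hR1
  have hB0 : Bounded B (initSt input) :=
    ⟨fun _ => by simp [initSt], fun _ _ => by simp [initSt], fun _ _ a ha => by simp [initSt] at ha,
      hB, fun _ _ => by simp [initSt]⟩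
  obtain ⟨t2, s2, h2, hR2, -, -, ht2⟩ := sim_comp (W := W) P 0 hR1 hB0 (by omega)
  have hlen := (hB0.cmd P).length 0 1
  simp only [Finset.sum_range_one] at hlen
  obtain ⟨t3, s3, h3, ht3, ho⟩ := exec_exitCode (W := W) hR2 (by omega)
  refine ⟨_, s3, .seq h1 (.seq h2 h3), ?_, ho⟩
  have h0 : (initSt input).tm = 0 := rfl
  rw [h0] at ht2
  omega

end RamLang

/-! ### The tree-decomposition defined by a laminar family -/

namespace Laminar

open SepTree Finset

variable {V τ : Type*} [Fintype V] [DecidableEq V] [Fintype τ] [DecidableEq τ]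

/-- A family of distinct vertex sets `X t`, with vertex boundaries `S t`, in which any two sets are
nested or disjoint with no edge between them; `X root` is the whole vertex set, `par t` is the
smallest set that strictly contains `X t`, and `home v` is the smallest set that contains `v`. -/
structure Family (G : SimpleGraph V) (X S : τ → Finset V) (root : τ) (par : τ → τ)
    (home : V → τ) : Prop where
  root_X : X root = univ
  mem_S : ∀ t x, x ∈ S t ↔ x ∉ X t ∧ ∃ y ∈ X t, G.Adj x y
  nonempty : ∀ t, (X t).Nonempty
  cases : ∀ a b, a ≠ b → X a ⊂ X b ∨ X b ⊂ X a ∨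
    Disjoint (X a) (X b) ∧ Disjoint (X a) (S b) ∧ Disjoint (X b) (S a)
  ssubset_par : ∀ t, t ≠ root → X t ⊂ X (par t)
  par_subset : ∀ t, t ≠ root → ∀ j, X t ⊂ X j → X (par t) ⊆ X j
  mem_home : ∀ x, x ∈ X (home x)
  home_subset : ∀ x j, x ∈ X j → X (home x) ⊆ X j

/-- The tree in which every node other than the root is joined to its parent. -/
def tree (root : τ) (par : τ → τ) : SimpleGraph τ :=
  SimpleGraph.fromRel fun a b => a ≠ root ∧ par a = b

/-- The vertices at home at `t`, and the boundary of `X t`. -/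
def bag (S : τ → Finset V) (home : V → τ) (t : τ) : Set V := {x | home x = t ∨ x ∈ S t}

/-- The one of the two homes whose set is smaller. -/
def top (X : τ → Finset V) (home : V → τ) (u v : V) : τ :=
  if (X (home u)).card < (X (home v)).card then home u else home v

namespace Family

variable {G : SimpleGraph V} {X S : τ → Finset V} {root : τ} {par : τ → τ} {home : V → τ}
  (h : Family G X S root par home)
include h

theorem inj {a b : τ} (hab : X a = X b) : a = b := by
  by_contra hne
  rcases h.cases a b hne with h1 | h1 | ⟨h1, -, -⟩
  · exact h1.ne hab
  · exact h1.ne hab.symm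
  · rw [hab, disjoint_self] at h1
    exact (h.nonempty b).ne_empty h1

theorem ssubset_of_ne {a b : τ} (hab : X a ⊆ X b) (hne : a ≠ b) : X a ⊂ X b :=
  hab.ssubset_of_ne fun e => hne (h.inj e)

theorem not_mem_X {t : τ} {x : V} (hx : x ∈ S t) : x ∉ X t := ((h.mem_S t x).1 hx).1

theorem ssubset_root {t : τ} (ht : t ≠ root) : X t ⊂ X root :=
  h.ssubset_of_ne (by rw [h.root_X]; exact subset_univ _) ht

theorem comparable {a b : τ} {x : V} (ha : x ∈ X a) (hb : x ∈ X b) : X a ⊆ X b ∨ X b ⊆ X a := by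
  by_cases hab : a = b
  · subst hab; exact .inl subset_rfl
  rcases h.cases a b hab with h1 | h1 | ⟨h1, -, -⟩
  · exact .inl h1.subset
  · exact .inr h1.subset
  · exact absurd hb (disjoint_left.1 h1 ha)

theorem ssubset_of_mem_S {a b : τ} {x : V} (ha : x ∈ X a) (hb : x ∈ S b) : X b ⊂ X a := by
  have hne : a ≠ b := fun e => h.not_mem_X hb (e ▸ ha)
  rcases h.cases a b hne with h1 | h1 | ⟨-, h1, -⟩
  · exact absurd (h1.subset ha) (h.not_mem_X hb)
  · exact h1
  · exact absurd hb (disjoint_left.1 h1 ha)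

theorem mem_X_or_mem_S {a b : τ} (hab : X a ⊆ X b) {x : V} (hx : x ∈ S a) : x ∈ X b ∨ x ∈ S b := by
  by_cases hb : x ∈ X b
  · exact .inl hb
  · obtain ⟨-, y, hy, hxy⟩ := (h.mem_S a x).1 hx
    exact .inr ((h.mem_S b x).2 ⟨hb, y, hab hy, hxy⟩)

theorem home_eq {x : V} {t : τ} (hx : x ∈ X t) (ht : X t ⊆ X (home x)) : home x = t :=
  h.inj ((h.home_subset x t hx).antisymm ht)

/-- Induction from the root to the leaves. -/
theorem up_induction {P : τ → Prop} (hr : P root) (hs : ∀ t, t ≠ root → P (par t) → P t) (t : τ) :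
    P t := by
  induction hk : (univ : Finset V).card - (X t).card using Nat.strong_induction_on
    generalizing t with
  | _ k ih =>
    by_cases ht : t = root
    · exact ht ▸ hr
    · refine hs t ht (ih _ ?_ _ rfl)
      have h1 := card_lt_card (h.ssubset_par t ht)
      have h2 := card_le_card (subset_univ (X (par t)))
      omega

theorem tree_adj {a b : τ} : (tree root par).Adj a b ↔
    a ≠ root ∧ par a = b ∨ b ≠ root ∧ par b = a := by
  rw [tree, SimpleGraph.fromRel_adj]
  refine ⟨fun h => h.2, fun hab => ⟨?_, hab⟩⟩
  rintro rfl
  rcases hab with ⟨h1, h2⟩ | ⟨h1, h2⟩ <;>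
  · have := h.ssubset_par a h1
    rw [h2] at this
    exact this.ne rfl

theorem edge_injOn : Set.InjOn (fun t => s(t, par t)) {t | t ≠ root} := by
  intro a ha b hb hab
  rcases Sym2.eq_iff.1 hab with ⟨h1, -⟩ | ⟨h1, h2⟩
  · exact h1
  · have e1 := h.ssubset_par a ha
    have e2 := h.ssubset_par b hb
    rw [h2] at e1
    rw [← h1] at e2
    exact absurd e2 e1.asymm

theorem edgeSet_tree : (tree root par).edgeSet = (fun t => s(t, par t)) '' {t | t ≠ root} := by
  ext e
  induction e with
  | _ a b =>
    rw [SimpleGraph.mem_edgeSet, h.tree_adj]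
    constructor
    · rintro (⟨h1, h2⟩ | ⟨h1, h2⟩)
      · exact ⟨a, h1, by simp [h2]⟩
      · exact ⟨b, h1, by simp [h2, Sym2.eq_swap]⟩
    · rintro ⟨t, h1, h2⟩
      rcases Sym2.eq_iff.1 h2 with ⟨rfl, rfl⟩ | ⟨rfl, rfl⟩
      · exact .inl ⟨h1, rfl⟩
      · exact .inr ⟨h1, rfl⟩

theorem tree_connected : (tree root par).Connected := by
  have hr : ∀ t, (tree root par).Reachable t root := fun t => by
    induction t using h.up_induction with
    | hr => exact .refl _
    | hs t ht ih => exact (SimpleGraph.Adj.reachable (h.tree_adj.2 (.inl ⟨ht, rfl⟩))).trans ih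
  exact { preconnected := fun a b => (hr a).trans (hr b).symm, nonempty := ⟨root⟩ }

theorem tree_isTree : (tree root par).IsTree := by
  rw [SimpleGraph.isTree_iff_connected_and_card]
  refine ⟨h.tree_connected, ?_⟩
  rw [h.edgeSet_tree, Nat.card_image_of_injOn h.edge_injOn]
  have : ({t | t ≠ root} : Set τ) = ((univ.erase root : Finset τ) : Set τ) := by ext; simp
  rw [this, Nat.card_coe_set_eq, Set.ncard_coe_finset, card_erase_of_mem (mem_univ _),
    Nat.card_eq_fintype_card, ← Finset.card_univ]
  have : 0 < (univ : Finset τ).card := card_pos.2 ⟨root, mem_univ _⟩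
  omega

/-- If a boundary vertex of `X t` is at home at the parent or beyond, it is in the parent's bag. -/
theorem mem_bag_par {t : τ} (ht : t ≠ root) {x : V} (hx : x ∈ S t) : x ∈ bag S home (par t) := by
  rcases h.mem_X_or_mem_S (h.ssubset_par t ht).subset hx with h1 | h1
  · left
    exact h.home_eq h1 (h.par_subset t ht _ (h.ssubset_of_mem_S (h.mem_home x) hx))
  · exact .inr h1

theorem not_mem_X_of_mem_bag_par {t : τ} (ht : t ≠ root) {x : V} (hx : x ∈ bag S home (par t)) :
    x ∉ X t := by
  have hp := h.ssubset_par t ht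
  intro hxt
  rcases hx with h1 | h1
  · have := h.home_subset x t hxt
    rw [h1] at this
    exact hp.not_subset this
  · exact h.not_mem_X h1 (hp.subset hxt)

theorem mem_of_mem_bag {t : τ} {x : V} (hx : x ∈ bag S home t) : x ∈ X t ∨ x ∈ S t := by
  rcases hx with h1 | h1
  · exact .inl (h1 ▸ h.mem_home x)
  · exact .inr h1

/-- The adhesion set of the edge from `t` to its parent is the boundary of `X t`. -/
theorem bag_inter_bag_par {t : τ} (ht : t ≠ root) {x : V} :
    x ∈ bag S home t ∧ x ∈ bag S home (par t) ↔ x ∈ S t :=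
  ⟨fun ⟨h1, h2⟩ => (h.mem_of_mem_bag h1).resolve_left (h.not_mem_X_of_mem_bag_par ht h2),
    fun hx => ⟨.inr hx, h.mem_bag_par ht hx⟩⟩

theorem S_root : S root = ∅ := by
  ext x
  rw [h.mem_S, h.root_X]; simp

theorem isTreeDecomposition : IsTreeDecomposition G (tree root par) (bag S home) where
  isTree := h.tree_isTree
  edge_mem := by
    have key : ∀ u v, G.Adj u v → (v ∈ bag S home (home u)) ∨ (u ∈ bag S home (home v)) := by
      intro u v huv
      by_cases hv : v ∈ X (home u)
      · by_cases hu : u ∈ X (home v)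
        · left; left
          exact h.inj ((h.home_subset v _ hv).antisymm (h.home_subset u _ hu))
        · right; right
          exact (h.mem_S _ _).2 ⟨hu, v, h.mem_home v, huv⟩
      · left; right
        exact (h.mem_S _ _).2 ⟨hv, u, h.mem_home u, huv.symm⟩
    intro u v huv
    rcases key u v huv with h1 | h1
    · exact ⟨_, .inl rfl, h1⟩
    · exact ⟨_, h1, .inl rfl⟩
  connected v := by
    have hr : ∀ t, ∀ ht : v ∈ bag S home t,
        ((tree root par).induce {t | v ∈ bag S home t}).Reachable
          ⟨t, ht⟩ ⟨home v, .inl rfl⟩ := by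
      intro t
      induction t using h.up_induction with
      | hr =>
        intro ht
        rcases ht with h1 | h1
        · subst h1; exact .refl _
        · rw [h.S_root] at h1; simp at h1
      | hs t htr ih =>
        intro ht
        rcases ht with h1 | h1
        · subst h1; exact .refl _
        · have hp := h.mem_bag_par htr h1
          refine (SimpleGraph.Adj.reachable ?_).trans (ih hp)
          exact h.tree_adj.2 (.inl ⟨htr, rfl⟩)
    exact { preconnected := fun a b => (hr a.1 a.2).trans (hr b.1 b.2).symm
            nonempty := ⟨⟨home v, .inl rfl⟩⟩ }

theorem subset_iff_of_adj {t a b : τ} (ht : t ≠ root)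
    (hab : ((tree root par).deleteEdges {s(t, par t)}).Adj a b) : X a ⊆ X t ↔ X b ⊆ X t := by
  rw [SimpleGraph.deleteEdges_adj, h.tree_adj] at hab
  obtain ⟨h1, h2⟩ := hab
  have key : ∀ a, a ≠ root → s(a, par a) ≠ s(t, par t) → (X a ⊆ X t ↔ X (par a) ⊆ X t) := by
    intro a ha hne
    have hat : a ≠ t := by rintro rfl; exact hne rfl
    exact ⟨fun h3 => h.par_subset a ha t (h.ssubset_of_ne h3 hat),
      fun h3 => (h.ssubset_par a ha).subset.trans h3⟩
  rcases h1 with ⟨h1, rfl⟩ | ⟨h1, rfl⟩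
  · exact key a h1 h2
  · exact (key b h1 (by rwa [Sym2.eq_swap])).symm

theorem adj_par {t a : τ} (ht : t ≠ root) (ha : a ≠ root) (hat : a ≠ t) :
    ((tree root par).deleteEdges {s(t, par t)}).Adj a (par a) := by
  rw [SimpleGraph.deleteEdges_adj]
  refine ⟨h.tree_adj.2 (.inl ⟨ha, rfl⟩), fun e => hat (h.edge_injOn ha ht e)⟩

theorem subset_iff_of_reachable {t a b : τ} (ht : t ≠ root)
    (hab : ((tree root par).deleteEdges {s(t, par t)}).Reachable a b) :
    X a ⊆ X t ↔ X b ⊆ X t := by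
  obtain ⟨w⟩ := hab
  induction w with
  | nil => exact Iff.rfl
  | cons hadj _ ih => exact (h.subset_iff_of_adj ht hadj).trans ih

theorem reachable_iff {t r : τ} (ht : t ≠ root) :
    ((tree root par).deleteEdges {s(t, par t)}).Reachable t r ↔ X r ⊆ X t := by
  constructor
  · intro hr
    exact (h.subset_iff_of_reachable ht hr).1 subset_rfl
  · induction r using h.up_induction with
    | hr => intro hr; exact absurd hr (h.ssubset_root ht).not_subset
    | hs r hr ih =>
      intro hrt
      by_cases e : r = t
      · rw [e]
      · exact (ih (h.par_subset r hr t (h.ssubset_of_ne hrt e))).trans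
          (h.adj_par ht hr e).reachable.symm

theorem reachable_par_iff {t r : τ} (ht : t ≠ root) :
    ((tree root par).deleteEdges {s(t, par t)}).Reachable (par t) r ↔ ¬ X r ⊆ X t := by
  have hp : ¬ X (par t) ⊆ X t := (h.ssubset_par t ht).not_subset
  constructor
  · intro hr
    rwa [← h.subset_iff_of_reachable ht hr]
  · intro hr
    have key : ∀ r, ¬ X r ⊆ X t →
        ((tree root par).deleteEdges {s(t, par t)}).Reachable r root := by
      intro r
      induction r using h.up_induction with
      | hr => intro _; exact .refl _
      | hs r hr ih =>
        intro hrt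
        have e : r ≠ t := by rintro rfl; exact hrt subset_rfl
        exact (h.adj_par ht hr e).reachable.trans
          (ih fun h3 => hrt ((h.ssubset_par r hr).subset.trans h3))
    exact (key _ hp).trans (key _ hr).symm

theorem edgeSep_eq {t : τ} (ht : t ≠ root) : edgeSep (tree root par) (bag S home) s(t, par t) =
    s(((X t ∪ S t : Finset V) : Set V), ((X t : Finset V) : Set V)ᶜ) := by
  rw [edgeSep, Sym2.map_mk]
  congr 1
  · ext x
    simp only [Set.mem_ofPred_eq, h.reachable_iff ht, coe_union, Set.mem_union, mem_coe]
    constructor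
    · rintro ⟨r, hr, hx⟩
      rcases h.mem_of_mem_bag hx with h1 | h1
      · exact .inl (hr h1)
      · exact h.mem_X_or_mem_S hr h1
    · rintro (hx | hx)
      · exact ⟨home x, h.home_subset x t hx, .inl rfl⟩
      · exact ⟨t, subset_rfl, .inr hx⟩
  · ext x
    simp only [Set.mem_ofPred_eq, h.reachable_par_iff ht, Set.mem_compl_iff, mem_coe]
    constructor
    · rintro ⟨r, hr, hx⟩ hxt
      rcases hx with h1 | h1
      · exact hr (h1 ▸ h.home_subset x t hxt)
      · exact hr (h.ssubset_of_mem_S hxt h1).subset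
    · intro hx
      exact ⟨home x, fun h1 => hx (h1 (h.mem_home x)), .inl rfl⟩

theorem induces (hinj : Set.InjOn (fun t => s(((X t ∪ S t : Finset V) : Set V),
    ((X t : Finset V) : Set V)ᶜ)) {t | t ≠ root}) :
    Induces ((fun t => s(((X t ∪ S t : Finset V) : Set V), ((X t : Finset V) : Set V)ᶜ)) ''
      {t | t ≠ root}) (tree root par) (bag S home) := by
  rw [Induces, h.edgeSet_tree]
  refine ⟨?_, ?_, ?_⟩
  · rintro _ ⟨t, ht, rfl⟩
    exact ⟨t, ht, (h.edgeSep_eq ht).symm⟩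
  · rintro _ ⟨t, ht, rfl⟩ _ ⟨u, hu, rfl⟩ e
    simp only [h.edgeSep_eq ht, h.edgeSep_eq hu] at e
    have := hinj ht hu e
    rw [this]
  · rintro _ ⟨t, ht, rfl⟩
    exact ⟨_, ⟨t, ht, rfl⟩, h.edgeSep_eq ht⟩

/-! ### The torsos -/

/-- The homes of the ends of an edge, or of two vertices in a common boundary, lie on a path towards
the root. -/
theorem homes_comparable {u v : V} (hH : G.Adj u v ∨ ∃ i, u ∈ S i ∧ v ∈ S i) :
    X (home u) ⊆ X (home v) ∨ X (home v) ⊆ X (home u) := by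
  rcases hH with huv | ⟨i, hu, hv⟩
  · by_cases hv : v ∈ X (home u)
    · exact .inr (h.home_subset v _ hv)
    · exact .inl (h.ssubset_of_mem_S (h.mem_home v)
        ((h.mem_S _ _).2 ⟨hv, u, h.mem_home u, huv.symm⟩)).subset
  · obtain ⟨x, hx⟩ := h.nonempty i
    exact h.comparable ((h.ssubset_of_mem_S (h.mem_home u) hu).subset hx)
      ((h.ssubset_of_mem_S (h.mem_home v) hv).subset hx)

theorem top_eq_left {u v : V} (huv : X (home u) ⊆ X (home v)) : top X home u v = home u := by
  rw [top]
  split_ifs with h1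
  · rfl
  · exact h.inj (eq_of_subset_of_card_le huv (by omega)).symm

omit h in
theorem top_eq_right {u v : V} (huv : X (home v) ⊆ X (home u)) : top X home u v = home v := by
  rw [top]
  split_ifs with h1
  · exact absurd (card_le_card huv) (by omega)
  · rfl

theorem exists_child {i t : τ} (hit : X i ⊂ X t) : ∃ j, j ≠ root ∧ par j = t ∧ X i ⊆ X j := by
  obtain ⟨j, hj, hmax⟩ := exists_max_image (univ.filter fun j => X i ⊆ X j ∧ X j ⊂ X t)
    (fun j => (X j).card) ⟨i, by simp [hit]⟩
  simp only [mem_filter, mem_univ, true_and] at hj hmax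
  have hjr : j ≠ root := by
    rintro rfl
    exact (h.root_X ▸ hj.2).not_subset (subset_univ _)
  refine ⟨j, hjr, ?_, hj.1⟩
  by_contra hne
  have h1 := h.ssubset_of_ne (h.par_subset j hjr t hj.2) hne
  have h2 := hmax (par j) ⟨hj.1.trans (h.ssubset_par j hjr).subset, h1⟩
  have h3 := card_lt_card (h.ssubset_par j hjr)
  omega

/-- An edge of the graph or of an adhesion set belongs to the torso at the lower of the homes of
its endpoints. -/
theorem torso_adj_home {u v : V} (huv : u ≠ v) (hH : G.Adj u v ∨ ∃ i, u ∈ S i ∧ v ∈ S i)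
    (hs : X (home u) ⊆ X (home v)) :
    (torso G (tree root par) (bag S home) (home u)).Adj u v := by
  have hub : u ∈ bag S home (home u) := .inl rfl
  rcases hH with hadj | ⟨i, hu, hv⟩
  · refine ⟨huv, hub, ?_, .inl hadj⟩
    by_cases hv : v ∈ X (home u)
    · exact .inl (h.home_eq hv hs)
    · exact .inr ((h.mem_S _ _).2 ⟨hv, u, h.mem_home u, hadj.symm⟩)
  · obtain ⟨j, hjr, hjt, hij⟩ := h.exists_child (h.ssubset_of_mem_S (h.mem_home u) hu)
    have hjt' : X j ⊂ X (home u) := hjt ▸ h.ssubset_par j hjr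
    have huj : u ∈ S j := (h.mem_X_or_mem_S hij hu).resolve_left fun h1 =>
      hjt'.not_subset (h.home_subset u j h1)
    have hvj : v ∈ S j := (h.mem_X_or_mem_S hij hv).resolve_left fun h1 =>
      hjt'.not_subset (hs.trans (h.home_subset v j h1))
    have hu' := (h.bag_inter_bag_par hjr).2 huj
    have hv' := (h.bag_inter_bag_par hjr).2 hvj
    rw [hjt] at hu' hv'
    exact ⟨huv, hu'.2, hv'.2, .inr ⟨j, h.tree_adj.2 (.inr ⟨hjr, hjt⟩), ⟨hu'.2, hu'.1⟩,
      ⟨hv'.2, hv'.1⟩⟩⟩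

theorem torso_adj_iff {t : τ} {u v : V} : (torso G (tree root par) (bag S home) t).Adj u v ↔
    u ≠ v ∧ ((u ∈ S t ∧ v ∈ S t) ∨
      (G.Adj u v ∨ ∃ i, u ∈ S i ∧ v ∈ S i) ∧ top X home u v = t) := by
  constructor
  · rintro ⟨huv, hu, hv, hadj⟩
    refine ⟨huv, ?_⟩
    by_cases hS : u ∈ S t ∧ v ∈ S t
    · exact .inl hS
    right
    have hH : G.Adj u v ∨ ∃ i, u ∈ S i ∧ v ∈ S i := by
      rcases hadj with h1 | ⟨t', htt', hu', hv'⟩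
      · exact .inl h1
      · rcases h.tree_adj.1 htt' with ⟨hr, rfl⟩ | ⟨hr, rfl⟩
        · exact .inr ⟨t, (h.bag_inter_bag_par hr).1 hu', (h.bag_inter_bag_par hr).1 hv'⟩
        · exact .inr ⟨t', (h.bag_inter_bag_par hr).1 hu'.symm, (h.bag_inter_bag_par hr).1 hv'.symm⟩
    refine ⟨hH, ?_⟩
    have key : ∀ v, v ∈ bag S home t → X t ⊆ X (home v) := by
      rintro v (rfl | hv)
      · exact subset_rfl
      · exact (h.ssubset_of_mem_S (h.mem_home v) hv).subset
    rcases hu with rfl | hu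
    · exact h.top_eq_left (key v hv)
    · rcases hv with rfl | hv
      · exact top_eq_right (key u (.inr hu))
      · exact absurd ⟨hu, hv⟩ hS
  · rintro ⟨huv, ⟨hu, hv⟩ | ⟨hH, rfl⟩⟩
    · have ht : t ≠ root := by rintro rfl; rw [h.S_root] at hu; simp at hu
      have hu' := (h.bag_inter_bag_par ht).2 hu
      have hv' := (h.bag_inter_bag_par ht).2 hv
      exact ⟨huv, .inr hu, .inr hv, .inr ⟨par t, h.tree_adj.2 (.inl ⟨ht, rfl⟩), hu', hv'⟩⟩
    · rcases h.homes_comparable hH with h1 | h1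
      · rw [h.top_eq_left h1]
        exact h.torso_adj_home huv hH h1
      · rw [top_eq_right h1]
        refine SimpleGraph.Subgraph.adj_symm _ (h.torso_adj_home huv.symm ?_ h1)
        rcases hH with h2 | ⟨i, hu, hv⟩
        · exact .inl h2.symm
        · exact .inr ⟨i, hv, hu⟩

end Family

end Laminar

/-! ### The algorithm -/

/-!
The nodes are the numbers `0, …, p` of the separations and of the root `p`. Variables, arrays and
families of lists are numbered as follows; lists without a natural key have the key `0`.

* Variables: `0`, `1`, `2` hold `n`, `m`, `p`; `3` is a separation; `4`, `5` are vertices; `6`, `7`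
  are the ends of an interval; `8` is the end of the previous interval; `9` is the number of
  vertices not seen in an interval; `10` is the length of a representation; `11` is the current vertex
  of a walk or sweep; `12` is the current node of the sweep; `13` is a counter; `14` is a loop index;
  `15`, `16` are the sizes of the complements of `A` and `B`; `17` receives unused components of
  pairs; `18` is a node.
* Arrays: `0` size of `X`, `1` parent, `2` home, `3` marks of vertices, `4` last separation (plus
  one) with a gap that starts at the vertex, `5` end of this gap.
* Lists: `0` output; `1` larger neighbours of a vertex; `2`, `11` complements of `A` and `B` as
  intervals; `3` intervals of `X`; `4` separator; `5` separations of a given size; `6` all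
  separations by increasing size; `7`, `8` separations with an interval of `X` that starts (ends) at
  a given vertex; `9` bags; `10` edges of the torsos.
-/

namespace RamLang

/-- Read `n`, the number of edges, and the edges; the list with key `u` of the family `1` receives
the larger endpoints of the edges whose smaller endpoint is `u`. -/
def readGraph : Cmd :=
  .read 0 ;; .read 1 ;; .forN 14 (.var 1) (.read 4 ;; .read 5 ;;
    .ite (.var 4) (.var 5) (.push 1 (.var 4) (.var 5) .zero) (.push 1 (.var 5) (.var 4) .zero))

/-- Read the representation of a side of the separation number `var 3`, put the half-open intervals
of the complement on a list, and leave the size of the complement in `var 9`. -/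
def readGaps (j : Fin 16) : Cmd :=
  .read 10 ;; .set 8 .zero ;; .set 9 (.var 0) ;;
  .forN 14 (.var 10) (.read 6 ;; .read 7 ;;
    .ite (.var 8) (.var 6) (.push j (.var 3) (.var 8) (.var 6)) .skip ;;
    .set 8 (.succ (.var 7)) ;; .set 9 (.sub (.var 9) (.sub (.succ (.var 7)) (.var 6)))) ;;
  .ite (.var 8) (.var 0) (.push j (.var 3) (.var 8) (.var 0)) .skip

/-- Choose the intervals in the family `j` to be those of the set `X` of the separation; the size,
in `var r`, goes to array `0`, and the separation to the list of all separations of this size. -/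
def choose (j : Fin 16) (r : ℕ) : Cmd :=
  .put 0 (.var 3) (.var r) ;; .push 5 (.var r) (.var 3) .zero ;;
  .forL j (.var 3) 6 7 (.push 3 (.var 3) (.var 6) (.var 7))

/-- At the start of each interval in the family `j`, note the end in array `5`, and the separation
in array `4`. -/
def stamp (j : Fin 16) : Cmd :=
  .forL j (.var 3) 6 7 (.put 4 (.var 6) (.succ (.var 3)) ;; .put 5 (.var 6) (.var 7))

/-- Walk through all vertices, jumping over the stamped intervals, and collect the vertices met:
the separator. -/
def walk : Cmd :=
  .set 11 .zero ;; .whl (.var 0) (.var 11) (.var 0)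
    (.ite (.var 3) (.get 4 (.var 11)) (.set 11 (.get 5 (.var 11)))
      (.push 4 (.var 3) (.var 11) .zero ;; .set 11 (.succ (.var 11))))

/-- Read one separation. -/
def readSep : Cmd :=
  readGaps 2 ;; .set 15 (.var 9) ;; readGaps 11 ;; .set 16 (.var 9) ;;
  .ite (.var 16) (.succ (.var 15)) (choose 11 16) (choose 2 15) ;;
  stamp 2 ;; stamp 11 ;; walk

/-- Read all separations. The root is the node number `p`, and its set has size `n`. -/
def readSeps : Cmd :=
  .read 2 ;; .put 0 (.var 2) (.var 0) ;; .forN 3 (.var 2) readSep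

/-- Put the separations on one list, by increasing size. -/
def sortSeps : Cmd :=
  .forN 14 (.succ (.var 0)) (.forL 5 (.sub (.var 0) (.var 14)) 3 17 (.push 6 .zero (.var 3) .zero))

/-- Sort the intervals by their starts (family `7`) and by their ends (family `8`). -/
def bucket : Cmd :=
  .forL 6 .zero 3 17 (.forL 3 (.var 3) 6 7
    (.push 7 (.var 6) (.var 3) .zero ;; .push 8 (.var 7) (.var 3) .zero))

/-- Sweep over the vertices; `var 12` is the smallest set that contains the current vertex.
Array `1` receives the parents, array `2` the homes, and family `9` the vertices at home at each
node. -/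
def sweep : Cmd :=
  .set 12 (.var 2) ;; .forN 11 (.var 0) (
    .forL 8 (.var 11) 3 17
      (.ite (.get 0 (.var 3)) (.get 0 (.var 12)) .skip (.set 12 (.get 1 (.var 3)))) ;;
    .forL 7 (.var 11) 3 17 (.put 1 (.var 3) (.var 12) ;; .set 12 (.var 3)) ;;
    .put 2 (.var 11) (.var 12) ;; .push 9 (.var 12) (.var 11) .zero)

/-- Add the separators to the bags, and all pairs inside separators to the lists of edges of the
torsos (family `10`) and of the graph. -/
def fill : Cmd :=
  .forN 3 (.var 2) (.forL 4 (.var 3) 4 17 (.push 9 (.var 3) (.var 4) .zero ;;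
    .forL 4 (.var 3) 5 17 (.ite (.var 4) (.var 5)
      (.push 1 (.var 4) (.var 5) .zero ;; .push 10 (.var 3) (.var 4) (.var 5)) .skip)))

/-- Go through all edges, each of them once (array `3` holds marks), and add each to the torso of
the lower home of its endpoints. -/
def distribute : Cmd :=
  .forN 4 (.var 0) (.forL 1 (.var 4) 5 17 (.ite (.get 3 (.var 5)) (.succ (.var 4))
    (.put 3 (.var 5) (.succ (.var 4)) ;;
      .ite (.get 0 (.get 2 (.var 4))) (.get 0 (.get 2 (.var 5)))
        (.push 10 (.get 2 (.var 4)) (.var 4) (.var 5))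
        (.push 10 (.get 2 (.var 5)) (.var 4) (.var 5)))
    .skip))

/-- Write the torsos, from the last word to the first. -/
def writeTorsos : Cmd :=
  .forN 14 (.succ (.var 2)) (.set 18 (.sub (.var 2) (.var 14)) ;; .set 13 .zero ;;
    .forL 10 (.var 18) 4 5 (.push 0 .zero (.var 5) .zero ;; .push 0 .zero (.var 4) .zero ;;
      .set 13 (.succ (.var 13))) ;;
    .push 0 .zero (.var 13) .zero)

/-- Write the bags, from the last word to the first. -/
def writeBags : Cmd :=
  .forN 14 (.succ (.var 2)) (.set 18 (.sub (.var 2) (.var 14)) ;; .set 13 .zero ;;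
    .forL 9 (.var 18) 4 17 (.push 0 .zero (.var 4) .zero ;; .set 13 (.succ (.var 13))) ;;
    .push 0 .zero (.var 13) .zero)

/-- Write the tree. -/
def writeTree : Cmd :=
  .forN 3 (.var 2) (.push 0 .zero (.get 1 (.var 3)) .zero ;; .push 0 .zero (.var 3) .zero) ;;
  .push 0 .zero (.var 2) .zero ;; .push 0 .zero (.succ (.var 2)) .zero

/-- Everything after the input has been read. -/
def build : Cmd :=
  sortSeps ;; bucket ;; sweep ;; fill ;; distribute ;; writeTorsos ;; writeBags ;; writeTree

/-- The algorithm. -/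
def algorithm : Cmd := readGraph ;; readSeps ;; build

/-! ### Reading the graph -/

/-- The words of a list of pairs. -/
abbrev words (L : List (ℕ × ℕ)) : List ℕ := L.flatMap fun e => [e.1, e.2]

theorem words_drop {L : List (ℕ × ℕ)} {i : ℕ} (hi : i < L.length) :
    words (L.drop i) = (L[i]).1 :: (L[i]).2 :: words (L.drop (i + 1)) := by
  rw [List.drop_eq_getElem_cons hi, words, List.flatMap_cons]; rfl

/-- An edge is stored at its smaller end. The list may contain repetitions; only its elements
matter, as repetitions are removed when the edges are distributed. -/
theorem readGraph_spec {σ : St} {n : ℕ} {E : List (ℕ × ℕ)} {rest : List ℕ}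
    (hinp : σ.inp = n :: SepTree.pairBlock E ++ rest) (hl : σ.lst 1 = fun _ => []) :
    let σ' := readGraph.eval σ
    σ'.inp = rest ∧ σ'.var 0 = n ∧ σ'.tm ≤ σ.tm + 10 * E.length + 10 ∧
      ∀ u v, v ∈ (σ'.lst 1 u).map Prod.fst ↔ ∃ e ∈ E, u = min e.1 e.2 ∧ v = max e.1 e.2 := by
  obtain ⟨s1, hs1⟩ : ∃ s1, s1 = (Cmd.read 1).eval ((Cmd.read 0).eval σ) := ⟨_, rfl⟩
  have h0 : s1.var 0 = n := by simp [hs1, Cmd.eval, hinp]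
  have h1 : s1.var 1 = E.length := by simp [hs1, Cmd.eval, hinp, SepTree.pairBlock]
  have hi1 : s1.inp = words E ++ rest := by simp [hs1, Cmd.eval, hinp, SepTree.pairBlock]
  have hl1 : s1.lst 1 = fun _ => [] := by simp [hs1, Cmd.eval, hl]
  have ht1 : s1.tm = σ.tm + 2 := by simp [hs1, Cmd.eval]
  have key := forN_inv (x := 14) (e := .var 1) (P := .read 4 ;; .read 5 ;;
    .ite (.var 4) (.var 5) (.push 1 (.var 4) (.var 5) .zero) (.push 1 (.var 5) (.var 4) .zero))
    (σ := s1) (fun i s => s.inp = words (E.drop i) ++ rest ∧ s.var 0 = n ∧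
      s.tm ≤ σ.tm + 4 + 10 * i ∧ ∀ u v, v ∈ (s.lst 1 u).map Prod.fst ↔
        ∃ e ∈ E.take i, u = min e.1 e.2 ∧ v = max e.1 e.2) ?_ ?_
  · simp only [Expr.eval, h1] at key
    obtain ⟨k1, k2, k3, k4⟩ := key
    simp only [readGraph, Cmd.eval] at hs1 k1 k2 k3 k4 ⊢
    rw [← hs1]
    refine ⟨by simpa using k1, k2, by omega, by simpa using k4⟩
  · refine ⟨by simpa using hi1, by simpa using h0, by simp [ht1], ?_⟩
    simp [hl1]
  · rintro i s hi ⟨k1, k2, k3, k4⟩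
    simp only [Expr.eval, h1] at hi
    rw [words_drop hi] at k1
    simp only [Cmd.eval, Expr.eval, St.tick_inp, St.setVar_inp, St.setInp_inp, k1, St.tick_var,
      St.setVar_var, St.setInp_var, List.cons_append, List.headD_cons, List.tail_cons]
    simp only [Nat.reduceEqDiff, if_true, if_false]
    have hmem : ∀ e, e ∈ E.take (i + 1) ↔ e ∈ E.take i ∨ e = E[i] := by
      intro e
      rw [List.take_succ_eq_append_getElem hi, List.mem_append, List.mem_singleton]
    have hpush : ∀ (a b : ℕ), a = min E[i].1 E[i].2 → b = max E[i].1 E[i].2 → ∀ (u v : ℕ),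
        v ∈ (Function.update (s.lst 1) a ((b, 0) :: s.lst 1 a) u).map Prod.fst ↔
        ∃ e ∈ E.take (i + 1), u = min e.1 e.2 ∧ v = max e.1 e.2 := by
      intro a b ha hb u v
      have h2 : v ∈ (Function.update (s.lst 1) a ((b, 0) :: s.lst 1 a) u).map Prod.fst ↔
          v ∈ (s.lst 1 u).map Prod.fst ∨ u = a ∧ v = b := by
        by_cases hu : u = a
        · subst hu; simp [or_comm]
        · simp [hu]
      rw [h2, k4]
      simp only [hmem, or_and_right, exists_or, exists_eq_left, ha, hb]
    split
    · rename_i hlt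
      refine ⟨by simp, by simp [k2], by simp; omega, ?_⟩
      simpa using hpush _ _ (by omega) (by omega)
    · rename_i hlt
      refine ⟨by simp, by simp [k2], by simp; omega, ?_⟩
      simpa using hpush _ _ (by omega) (by omega)

/-! ### Complements of unions of intervals -/

/-- One step of `readGaps`: the gaps found so far, the end of the last interval, and the number of
vertices not in an interval seen so far. -/
def gapStep (g : List (ℕ × ℕ) × ℕ × ℕ) (I : ℕ × ℕ) : List (ℕ × ℕ) × ℕ × ℕ :=
  (if g.2.1 < I.1 then (g.2.1, I.1) :: g.1 else g.1, I.2 + 1, g.2.2 - (I.2 + 1 - I.1))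

/-- The gaps between the intervals in `L`, as half-open intervals, from right to left. -/
def gaps (n : ℕ) (L : List (ℕ × ℕ)) : List (ℕ × ℕ) :=
  let g := L.foldl gapStep ([], 0, n)
  if g.2.1 < n then (g.2.1, n) :: g.1 else g.1

/-- The number of vertices in no interval of `L`. -/
def gapSize (n : ℕ) (L : List (ℕ × ℕ)) : ℕ := (L.foldl gapStep ([], 0, n)).2.2

/-- The vertices in no interval of `L`. -/
def compl (n : ℕ) (L : List (ℕ × ℕ)) : Finset ℕ :=
  (Finset.range n).filter fun x => ¬ ∃ I ∈ L, I.1 ≤ x ∧ x ≤ I.2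

/-- `L` is the representation of some subset of `{0, …, n - 1}`. -/
structure IsRep (n : ℕ) (L : List (ℕ × ℕ)) : Prop where
  le : ∀ I ∈ L, I.1 ≤ I.2
  lt : ∀ I ∈ L, I.2 < n
  gap : L.Pairwise fun I J => I.2 + 1 < J.1

/-- `U` lists the maximal half-open intervals of which `X` is the disjoint union. -/
structure IsIntervals (n : ℕ) (U : List (ℕ × ℕ)) (X : Finset ℕ) : Prop where
  lt : ∀ I ∈ U, I.1 < I.2
  le : ∀ I ∈ U, I.2 ≤ n
  sub : ∀ I ∈ U, ∀ x, I.1 ≤ x → x < I.2 → x ∈ X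
  left_max : ∀ I ∈ U, ∀ y, y + 1 = I.1 → y ∉ X
  right_max : ∀ I ∈ U, I.2 ∉ X
  cover : ∀ x ∈ X, ∃ I ∈ U, I.1 ≤ x ∧ x < I.2
  nodup : (U.map Prod.fst).Nodup

/-- One pass over the representation of a set finds the intervals of the complement, and its
size. -/
theorem gaps_spec {n : ℕ} {L : List (ℕ × ℕ)} (h : IsRep n L) :
    IsIntervals n (gaps n L) (compl n L) ∧ (gaps n L).length ≤ L.length + 1 ∧
      gapSize n L = (compl n L).card := by
  have hC : ∀ x, x ∈ compl n L ↔ x < n ∧ ¬ ∃ I ∈ L, I.1 ≤ x ∧ x ≤ I.2 := fun x => by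
    simp [compl]
  have hprev : ∀ (D : List (ℕ × ℕ)) (q : ℕ), D ⊆ L → (q = 0 ∨ ∃ I ∈ D, I.2 + 1 = q) →
      ∀ y, y + 1 = q → y ∉ compl n L := by
    rintro D q hD (rfl | ⟨I, hI, rfl⟩) y hy
    · omega
    · rw [hC]
      rintro ⟨-, h2⟩
      exact h2 ⟨I, hD hI, by have := h.le I (hD hI); omega, by omega⟩
  have key := foldl_inv (f := gapStep) (s := ([], 0, n)) (L := L) (fun D g =>
    (∀ I ∈ D, I.2 < g.2.1) ∧ g.2.1 ≤ n ∧ (g.2.1 = 0 ∨ ∃ I ∈ D, I.2 + 1 = g.2.1) ∧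
    (∀ I ∈ g.1, I.1 < I.2 ∧ I.2 < g.2.1 ∧ (∀ x, I.1 ≤ x → x < I.2 → x ∈ compl n L) ∧
      (∀ y, y + 1 = I.1 → y ∉ compl n L) ∧ I.2 ∉ compl n L) ∧
    (∀ x ∈ compl n L, x < g.2.1 → ∃ I ∈ g.1, I.1 ≤ x ∧ x < I.2) ∧
    (g.1.map Prod.fst).Nodup ∧ g.1.length ≤ D.length ∧
    g.2.2 + g.2.1 = n + ((compl n L).filter (· < g.2.1)).card) ?_ ?_
  · obtain ⟨k0, k1, k2, k3, k4, k5, k6, k7⟩ := key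
    obtain ⟨g, hg⟩ : ∃ g, g = L.foldl gapStep ([], 0, n) := ⟨_, rfl⟩
    rw [← hg] at k0 k1 k2 k3 k4 k5 k6 k7
    replace k2 : ∀ y, y + 1 = g.2.1 → y ∉ compl n L := hprev L g.2.1 (List.Subset.refl L) k2
    have hlast : ∀ x, g.2.1 ≤ x → x < n → x ∈ compl n L := by
      intro x hx hxn
      rw [hC]
      refine ⟨hxn, ?_⟩
      rintro ⟨I, hI, h1, h2⟩
      have := k0 I hI
      omega
    have hgaps : gaps n L = if g.2.1 < n then (g.2.1, n) :: g.1 else g.1 := by rw [hg]; rfl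
    have hsize : gapSize n L = g.2.2 := by rw [hg]; rfl
    refine ⟨?_, ?_, ?_⟩
    · rw [hgaps]
      split
      · rename_i hlt
        constructor
        · rintro I hI
          rcases List.mem_cons.1 hI with rfl | hI
          · exact hlt
          · exact (k3 I hI).1
        · rintro I hI
          rcases List.mem_cons.1 hI with rfl | hI
          · exact le_rfl
          · exact (k3 I hI).2.1.le.trans k1
        · rintro I hI
          rcases List.mem_cons.1 hI with rfl | hI
          · exact fun x => hlast x
          · exact (k3 I hI).2.2.1
        · rintro I hI
          rcases List.mem_cons.1 hI with rfl | hI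
          · exact k2
          · exact (k3 I hI).2.2.2.1
        · rintro I hI
          rcases List.mem_cons.1 hI with rfl | hI
          · simp [hC]
          · exact (k3 I hI).2.2.2.2
        · intro x hx
          by_cases hxg : x < g.2.1
          · obtain ⟨I, hI, h1⟩ := k4 x hx hxg
            exact ⟨I, by simp [hI], h1⟩
          · exact ⟨_, List.mem_cons_self, by simpa using hxg, ((hC x).1 hx).1⟩
        · rw [List.map_cons, List.nodup_cons]
          refine ⟨?_, k5⟩
          rintro hm
          obtain ⟨I, hI, h1⟩ := List.mem_map.1 hm
          have := k3 I hI
          simp only at h1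
          omega
      · rename_i hlt
        exact ⟨fun I hI => (k3 I hI).1, fun I hI => (k3 I hI).2.1.le.trans k1,
          fun I hI => (k3 I hI).2.2.1, fun I hI => (k3 I hI).2.2.2.1,
          fun I hI => (k3 I hI).2.2.2.2,
          fun x hx => k4 x hx (by have := ((hC x).1 hx).1; omega), k5⟩
    · rw [hgaps]
      split
      · rw [List.length_cons]; omega
      · omega
    · have : (compl n L).card = ((compl n L).filter (· < g.2.1)).card + (n - g.2.1) := by
        rw [← Finset.card_filter_add_card_filter_not (· < g.2.1)]
        congr 1
        have : (compl n L).filter (fun a => ¬ a < g.2.1) = Finset.Ico g.2.1 n := by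
          ext x
          simp only [Finset.mem_filter, Finset.mem_Ico, not_lt]
          exact ⟨fun hx => ⟨hx.2, ((hC x).1 hx.1).1⟩, fun hx => ⟨hlast x hx.1 hx.2, hx.1⟩⟩
        rw [this, Nat.card_Ico]
      omega
  · simp
  · rintro D ⟨a, b⟩ R ⟨gl, prev, rem⟩ hL ⟨k0, k1, k2, k3, k4, k5, k6, k7⟩
    simp only at k0 k1 k2 k3 k4 k5 k6 k7
    have hab : a ≤ b := h.le (a, b) (by simp [hL])
    have hbn : b < n := h.lt (a, b) (by simp [hL])
    have hpw := h.gap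
    rw [hL, List.pairwise_append] at hpw
    obtain ⟨-, hpw2, hpw1⟩ := hpw
    have hpa : prev ≤ a := by
      rcases k2 with rfl | ⟨I, hI, rfl⟩
      · omega
      · exact (hpw1 I hI (a, b) (by simp)).le
    have hnew : ∀ x, prev ≤ x → x < a → x ∈ compl n L := by
      intro x h1 h2
      rw [hC]
      refine ⟨by omega, ?_⟩
      rintro ⟨I, hI, h3, h4⟩
      rw [hL, List.mem_append, List.mem_cons] at hI
      rcases hI with hI | rfl | hI
      · have := k0 I hI; omega
      · simp only at h3; omega
      · have := (List.pairwise_cons.1 hpw2).1 I hI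
        simp only at this; omega
    have hcov : ∀ x, a ≤ x → x ≤ b → x ∉ compl n L := by
      intro x h1 h2
      rw [hC]
      rintro ⟨-, h3⟩
      exact h3 ⟨(a, b), by simp [hL], h1, h2⟩
    refine ⟨?_, hbn, .inr ⟨(a, b), by simp, rfl⟩, ?_, ?_, ?_, ?_, ?_⟩
    · intro I hI
      rcases List.mem_append.1 hI with hI | hI
      · have := k0 I hI; simp only [gapStep]; omega
      · simp only [List.mem_singleton] at hI; subst hI; simp [gapStep]
    · intro I hI
      have hI : I ∈ gl ∨ prev < a ∧ I = (prev, a) := by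
        simp only [gapStep] at hI
        split at hI
        · rcases List.mem_cons.1 hI with rfl | hI
          · exact .inr ⟨by assumption, rfl⟩
          · exact .inl hI
        · exact .inl hI
      rcases hI with hI | ⟨h1, rfl⟩
      · obtain ⟨h1, h2, h3⟩ := k3 I hI
        exact ⟨h1, by simp only [gapStep]; omega, h3⟩
      · exact ⟨h1, by simp only [gapStep]; omega, hnew, hprev D prev (by simp [hL]) k2,
          hcov a le_rfl hab⟩
    · intro x hx hxb
      simp only [gapStep] at hxb ⊢
      by_cases hxp : x < prev
      · obtain ⟨I, hI, h1⟩ := k4 x hx hxp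
        exact ⟨I, by split <;> simp [hI], h1⟩
      · have hxa : x < a := by
          by_contra h1
          exact hcov x (by omega) (by omega) hx
        rw [if_pos (by omega)]
        exact ⟨_, List.mem_cons_self, by simpa using hxp, hxa⟩
    · simp only [gapStep]
      split
      · rw [List.map_cons, List.nodup_cons]
        refine ⟨?_, k5⟩
        rintro hm
        obtain ⟨I, hI, h1⟩ := List.mem_map.1 hm
        have := k3 I hI
        simp only at h1
        omega
      · exact k5
    · simp only [gapStep]
      split <;> simp only [List.length_append, List.length_cons, List.length_nil] <;> omega
    · have h1 : ((compl n L).filter (· < b + 1)).card =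
          ((compl n L).filter (· < prev)).card + (a - prev) := by
        rw [← Nat.card_Ico, ← Finset.card_union_of_disjoint]
        · congr 1
          ext x
          simp only [Finset.mem_filter, Finset.mem_union, Finset.mem_Ico]
          constructor
          · rintro ⟨h1, h2⟩
            by_cases hxp : x < prev
            · exact .inl ⟨h1, hxp⟩
            · refine .inr ⟨by omega, ?_⟩
              by_contra h3
              exact hcov x (by omega) (by omega) h1
          · rintro (⟨h1, h2⟩ | ⟨h1, h2⟩)
            · exact ⟨h1, by omega⟩
            · exact ⟨hnew x h1 h2, by omega⟩
        · rw [Finset.disjoint_left]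
          intro x h1 h2
          simp only [Finset.mem_filter, Finset.mem_Ico] at h1 h2
          omega
      simp only [gapStep]
      omega

end RamLang

/-! ### Reading the separations -/

namespace RamLang

theorem readGaps_spec {j : Fin 16} {σ : St} {n i : ℕ} {L : List (ℕ × ℕ)} {rest : List ℕ}
    (hinp : σ.inp = SepTree.pairBlock L ++ rest) (hn : σ.var 0 = n) (hi : σ.var 3 = i)
    (hl : σ.lst j i = []) :
    let σ' := (readGaps j).eval σ
    σ'.inp = rest ∧ σ'.lst j i = gaps n L ∧ (∀ u, u ≠ i → σ'.lst j u = σ.lst j u) ∧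
      σ'.var 9 = gapSize n L ∧ σ'.tm ≤ σ.tm + 20 * L.length + 20 := by
  obtain ⟨s1, hs1⟩ : ∃ s1, s1 = (Cmd.set 9 (.var 0)).eval ((Cmd.set 8 .zero).eval
    ((Cmd.read 10).eval σ)) := ⟨_, rfl⟩
  have a0 : s1.var 0 = n := by simp [hs1, Cmd.eval, hn]
  have a3 : s1.var 3 = i := by simp [hs1, Cmd.eval, hi]
  have a8 : s1.var 8 = 0 := by simp [hs1, Cmd.eval]
  have a9 : s1.var 9 = n := by simp [hs1, Cmd.eval, hn]
  have a10 : s1.var 10 = L.length := by simp [hs1, Cmd.eval, hinp, SepTree.pairBlock]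
  have ai : s1.inp = words L ++ rest := by simp [hs1, Cmd.eval, hinp, SepTree.pairBlock]
  have al : s1.lst j = σ.lst j := by simp [hs1, Cmd.eval]
  have at1 : s1.tm = σ.tm + 5 := by simp [hs1, Cmd.eval]
  obtain ⟨body, hbody⟩ : ∃ b, b = Cmd.read 6 ;; .read 7 ;;
    .ite (.var 8) (.var 6) (.push j (.var 3) (.var 8) (.var 6)) .skip ;;
    .set 8 (.succ (.var 7)) ;; .set 9 (.sub (.var 9) (.sub (.succ (.var 7)) (.var 6))) := ⟨_, rfl⟩
  have key := forN_inv (x := 14) (e := .var 10) (P := body)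
    (σ := s1) (fun t s => s.inp = words (L.drop t) ++ rest ∧ s.var 0 = n ∧ s.var 3 = i ∧
      (s.lst j i, s.var 8, s.var 9) = (L.take t).foldl gapStep ([], 0, n) ∧
      (∀ u, u ≠ i → s.lst j u = σ.lst j u) ∧
      s.tm ≤ σ.tm + 7 + 20 * t) ?_ ?_
  · simp only [Expr.eval, a10] at key
    obtain ⟨s2, hs2⟩ : ∃ s2, s2 = (Cmd.forN 14 (.var 10) body).eval s1 := ⟨_, rfl⟩
    rw [← hs2] at key
    obtain ⟨k1, k2, k3, k4, k5, k6⟩ := key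
    rw [List.take_length] at k4
    have hfin : (readGaps j).eval σ =
      (Cmd.ite (.var 8) (.var 0) (.push j (.var 3) (.var 8) (.var 0)) .skip).eval s2 := by
      rw [hs2, hs1, hbody]; rfl
    have e1 : s2.lst j i = (L.foldl gapStep ([], 0, n)).1 := by rw [← k4]
    have e8 : s2.var 8 = (L.foldl gapStep ([], 0, n)).2.1 := by rw [← k4]
    have e9 : s2.var 9 = gapSize n L := by rw [gapSize, ← k4]
    simp only [hfin, gaps, ← e1, ← e8]
    simp only [Cmd.eval, Expr.eval, k2, k3]
    split
    · refine ⟨by simpa using k1, by simp [k3, k2], ?_, by simpa using e9, ?_⟩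
      · intro u hu; simp [k3, hu, k5 u hu]
      · simp; omega
    · refine ⟨by simpa using k1, by simp, ?_, by simpa using e9, ?_⟩
      · intro u hu; simp [k5 u hu]
      · simp; omega
  · refine ⟨by simpa using ai, by simpa using a0, by simpa using a3, ?_, ?_, ?_⟩
    · simp [al, hl, a8, a9]
    · simp [al]
    · simp [at1]
  · rintro t s ht ⟨k1, k2, k3, k4, k5, k6⟩
    simp only [Expr.eval, a10] at ht
    rw [words_drop ht] at k1
    rw [List.take_succ_eq_append_getElem ht, List.foldl_append, ← k4]
    rw [hbody]
    simp only [Cmd.eval, Expr.eval, St.tick_inp, St.setVar_inp, St.setInp_inp, k1, St.tick_var,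
      St.setVar_var, St.setInp_var, List.cons_append, List.headD_cons, List.tail_cons]
    simp only [Nat.reduceEqDiff, if_true, if_false]
    split
    · rename_i hlt
      refine ⟨by simp, by simp [k2], by simp [k3], ?_, ?_, by simp; omega⟩
      · simp [gapStep, k3, hlt]
      · intro u hu; simp [k3, hu, k5 u hu]
    · rename_i hlt
      refine ⟨by simp, by simp [k2], by simp [k3], ?_, ?_, by simp; omega⟩
      · simp [gapStep, k3, hlt]
      · intro u hu; simp [k3, hu, k5 u hu]

theorem choose_spec {j : Fin 16} {r : ℕ} {σ : St} {i : ℕ} (hi : σ.var 3 = i)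
    (hj5 : j ≠ 5) (hl : σ.lst 3 i = []) :
    let σ' := (choose j r).eval σ
    σ'.lst 3 i = (σ.lst j i).reverse ∧ (∀ u, u ≠ i → σ'.lst 3 u = σ.lst 3 u) ∧
      σ'.arr 0 = Function.update (σ.arr 0) i (σ.var r) ∧
      (σ'.lst 5 = Function.update (σ.lst 5) (σ.var r) ((i, 0) :: σ.lst 5 (σ.var r))) ∧
      σ'.tm ≤ σ.tm + 5 * (σ.lst j i).length + 10 := by
  obtain ⟨s1, hs1⟩ : ∃ s1, s1 = (Cmd.push 5 (.var r) (.var 3) .zero).eval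
    ((Cmd.put 0 (.var 3) (.var r)).eval σ) := ⟨_, rfl⟩
  have a3 : s1.var 3 = i := by simp [hs1, Cmd.eval, hi]
  have aj : s1.lst j = σ.lst j := by simp [hs1, Cmd.eval, hj5]
  have al : s1.lst 3 = σ.lst 3 := by simp [hs1, Cmd.eval]
  have key := forL_inv (j := j) (e := .var 3) (x := 6) (y := 7)
    (P := .push 3 (.var 3) (.var 6) (.var 7)) (σ := s1)
    (fun D s => s.var 3 = i ∧ s.lst 3 i = D.reverse ∧ (∀ u, u ≠ i → s.lst 3 u = σ.lst 3 u) ∧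
      s.arr 0 = s1.arr 0 ∧ s.lst 5 = s1.lst 5 ∧ s.tm ≤ s1.tm + 2 + 5 * D.length) ?_ ?_
  · simp only [Expr.eval, a3, aj] at key
    obtain ⟨-, k2, k3, k4, k5, k6⟩ := key
    have hfin : (choose j r).eval σ =
      (Cmd.forL j (.var 3) 6 7 (.push 3 (.var 3) (.var 6) (.var 7))).eval s1 := by
      rw [hs1]; rfl
    simp only [hfin]
    refine ⟨k2, k3, ?_, ?_, ?_⟩
    · rw [k4, hs1]; simp [Cmd.eval, hi]
    · rw [k5, hs1]; simp [Cmd.eval, hi]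
    · have : s1.tm = σ.tm + 7 := by simp [hs1, Cmd.eval]
      omega
  · simp [a3, al, hl]
  · rintro D a R s - ⟨k1, k2, k3, k4, k5, k6⟩
    refine ⟨by simp [Cmd.eval, k1], by simp [Cmd.eval, k1, k2], ?_, by simp [Cmd.eval, k4],
      by simp [Cmd.eval, k5], by simp [Cmd.eval]; omega⟩
    intro u hu; simp [Cmd.eval, k1, hu, k3 u hu]

theorem stamp_spec {j : Fin 16} {σ : St} {i : ℕ} (hi : σ.var 3 = i)
    (hnd : ((σ.lst j i).map Prod.fst).Nodup) :
    let σ' := (stamp j).eval σ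
    (∀ a, a ∉ (σ.lst j i).map Prod.fst → σ'.arr 4 a = σ.arr 4 a ∧ σ'.arr 5 a = σ.arr 5 a) ∧
    (∀ I ∈ σ.lst j i, σ'.arr 4 I.1 = i + 1 ∧ σ'.arr 5 I.1 = I.2) ∧
      σ'.tm ≤ σ.tm + 10 * (σ.lst j i).length + 10 := by
  have key := forL_inv (j := j) (e := .var 3) (x := 6) (y := 7)
    (P := .put 4 (.var 6) (.succ (.var 3)) ;; .put 5 (.var 6) (.var 7)) (σ := σ)
    (fun D s => s.var 3 = i ∧
      (∀ a, a ∉ D.map Prod.fst → s.arr 4 a = σ.arr 4 a ∧ s.arr 5 a = σ.arr 5 a) ∧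
      (∀ I ∈ D, s.arr 4 I.1 = i + 1 ∧ s.arr 5 I.1 = I.2) ∧
      s.tm ≤ σ.tm + 2 + 10 * D.length) ?_ ?_
  · simp only [Expr.eval, hi] at key
    obtain ⟨-, k2, k3, k4⟩ := key
    exact ⟨k2, k3, by simp only [stamp]; omega⟩
  · simp [hi]
  · rintro D a R s hL ⟨k1, k2, k3, k4⟩
    simp only [Expr.eval, hi] at hL
    rw [hL] at hnd
    refine ⟨by simp [Cmd.eval, k1], ?_, ?_, by simp [Cmd.eval]; omega⟩
    · intro b hb
      simp only [List.map_append, List.map_cons, List.map_nil, List.mem_append,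
        List.mem_singleton, not_or] at hb
      simpa [Cmd.eval, hb.2] using k2 b hb.1
    · intro I hI
      rcases List.mem_append.1 hI with hI | hI
      · have hne : I.1 ≠ a.1 := by
          simp only [List.map_append, List.map_cons, List.nodup_append] at hnd
          exact hnd.2.2 _ (List.mem_map_of_mem hI) _ (by simp)
        simpa [Cmd.eval, hne] using k3 I hI
      · simp only [List.mem_singleton] at hI
        subst hI
        simp [Cmd.eval, k1]

theorem countP_lt_countP {α : Type*} {p q : α → Bool} {L : List α} (h : ∀ x ∈ L, p x → q x)
    {a : α} (ha : a ∈ L) (hq : q a) (hp : ¬ p a) : L.countP p < L.countP q := by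
  obtain ⟨l₁, l₂, rfl⟩ := List.append_of_mem ha
  have h1 := List.countP_mono_left (l := l₁) (p := p) (q := q) fun x hx => h x (by simp [hx])
  have h2 := List.countP_mono_left (l := l₂) (p := p) (q := q) fun x hx => h x (by simp [hx])
  simp only [List.countP_append, List.countP_cons, hq, hp]
  simp; omega

/-- The walk meets exactly the vertices in no interval. Each step but the last either finds such a
vertex or passes an interval, so the number of steps is bounded. -/
theorem walk_spec {σ : St} {n i : ℕ} {U : List (ℕ × ℕ)} (hn : σ.var 0 = n) (hi : σ.var 3 = i)
    (hl : σ.lst 4 i = []) (hlt : ∀ I ∈ U, I.1 < I.2 ∧ I.2 ≤ n)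
    (hdisj : ∀ I ∈ U, ∀ J ∈ U, I = J ∨ I.2 ≤ J.1 ∨ J.2 ≤ I.1)
    (hstamp : ∀ a, i < σ.arr 4 a → (a, σ.arr 5 a) ∈ U) (hstamp' : ∀ I ∈ U, i < σ.arr 4 I.1) :
    let σ' := walk.eval σ
    (∀ v, v ∈ (σ'.lst 4 i).map Prod.fst ↔ v < n ∧ ¬ ∃ I ∈ U, I.1 ≤ v ∧ v < I.2) ∧
      ((σ'.lst 4 i).map Prod.fst).Nodup ∧ (∀ u, u ≠ i → σ'.lst 4 u = σ.lst 4 u) ∧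
      σ'.tm ≤ σ.tm + 20 * (U.length + (σ'.lst 4 i).length) + 20 := by
  obtain ⟨s1, hs1⟩ : ∃ s1, s1 = ((Cmd.set 11 .zero).eval σ).tick 2 := ⟨_, rfl⟩
  obtain ⟨body, hbody⟩ : ∃ b, b = Cmd.ite (.var 3) (.get 4 (.var 11)) (.set 11 (.get 5 (.var 11)))
      (.push 4 (.var 3) (.var 11) .zero ;; .set 11 (.succ (.var 11))) := ⟨_, rfl⟩
  have hev : walk.eval σ = whileIter (fun s => (Expr.var 11).eval s < (Expr.var 0).eval s) 3
      body.eval n s1 := by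
    rw [hs1, hbody, ← hn]; rfl
  obtain ⟨j, s, hI, hend⟩ := whileIter_inv
    (c := fun s => (Expr.var 11).eval s < (Expr.var 0).eval s) (w := 3) (f := body.eval) (k := n)
    (s := s1) (fun j s => s.var 0 = n ∧ s.var 3 = i ∧ s.arr 4 = σ.arr 4 ∧ s.arr 5 = σ.arr 5 ∧
      n ≤ s.var 11 + j ∧ s.var 11 ≤ n ∧ (∀ I ∈ U, I.2 ≤ s.var 11 ∨ s.var 11 ≤ I.1) ∧
      (∀ v, v ∈ (s.lst 4 i).map Prod.fst ↔ v < s.var 11 ∧ ¬ ∃ I ∈ U, I.1 ≤ v ∧ v < I.2) ∧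
      ((s.lst 4 i).map Prod.fst).Nodup ∧ (∀ u, u ≠ i → s.lst 4 u = σ.lst 4 u) ∧
      s.tm ≤ σ.tm + 10 + 20 * (U.countP (fun I => decide (I.2 ≤ s.var 11)) + (s.lst 4 i).length))
    (by
      simp [hs1, Cmd.eval, hn, hi, hl]; omega)
    (by
      rintro j s hc ⟨k0, k3, ka4, ka5, kj, kn, kU, kv, knd, ku, kt⟩
      have hc : s.var 11 < n := by simpa [k0] using hc
      rw [hbody]
      simp only [Cmd.eval, Expr.eval, St.tick_var, St.tick_arr, k3, ka4, ka5]
      split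
      · rename_i hst
        obtain ⟨b, hb⟩ : ∃ b, b = σ.arr 5 (s.var 11) := ⟨_, rfl⟩
        have hm := hstamp _ hst
        rw [← hb] at hm ⊢
        have hb2 := hlt _ hm
        simp only at hb2
        have hcnt := countP_lt_countP (L := U) (p := fun I => decide (I.2 ≤ s.var 11))
          (q := fun I => decide (I.2 ≤ b)) (by simp; omega) hm (by simp) (by simp; omega)
        refine ⟨by simp [k0], by simp [k3], by simp [ka4], by simp [ka5], by simp; omega,
          by simp; omega, ?_, ?_, by simpa using knd, by simpa using ku, by simp; omega⟩
        · intro I hI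
          simp only [St.tick_var, St.setVar_var, if_true]
          rcases kU I hI with h1 | h1
          · left; omega
          · rcases hdisj I hI _ hm with rfl | h2 | h2
            · left; exact le_rfl
            · left; simp only at h2; omega
            · right; exact h2
        · intro v
          simp only [St.tick_var, St.setVar_var, if_true, St.tick_lst, St.setVar_lst, kv]
          constructor
          · rintro ⟨h1, h2⟩; exact ⟨by omega, h2⟩
          · rintro ⟨h1, h2⟩
            refine ⟨?_, h2⟩
            by_contra h3
            exact h2 ⟨_, hm, by simp only; omega, h1⟩
      · rename_i hst
        have hcnt := List.countP_mono_left (l := U) (p := fun I => decide (I.2 ≤ s.var 11))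
          (q := fun I => decide (I.2 ≤ s.var 11 + 1)) (by simp; omega)
        have hfree : ¬ ∃ I ∈ U, I.1 ≤ s.var 11 ∧ s.var 11 < I.2 := by
          rintro ⟨I, hI, h1, h2⟩
          rcases kU I hI with h3 | h3
          · omega
          · have : I.1 = s.var 11 := by omega
            exact hst (this ▸ hstamp' I hI)
        refine ⟨by simp [k0], by simp [k3], by simp [ka4], by simp [ka5], by simp; omega,
          by simp; omega, ?_, ?_, ?_, ?_, ?_⟩
        · intro I hI
          have := kU I hI
          have h2 := hlt I hI
          by_cases h3 : I.1 = s.var 11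
          · exact absurd ⟨I, hI, by omega, by omega⟩ hfree
          · simp; omega
        · intro v
          simp only [St.tick_var, St.setVar_var, if_true, St.tick_lst, St.setVar_lst, k3,
            St.cons_lst, Function.update_self, List.map_cons, List.mem_cons, kv, St.cons_var]
          constructor
          · rintro (rfl | ⟨h1, h2⟩)
            · exact ⟨by omega, hfree⟩
            · exact ⟨by omega, h2⟩
          · rintro ⟨h1, h2⟩
            by_cases h3 : v = s.var 11
            · exact .inl h3
            · exact .inr ⟨by omega, h2⟩
        · simp only [St.tick_lst, St.setVar_lst, k3, St.cons_lst, if_true, Function.update_self,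
            List.map_cons, List.nodup_cons, kv]
          exact ⟨by omega, knd⟩
        · intro u hu
          simp [k3, hu, ku u hu]
        · simp [k3]; omega)
  obtain ⟨k0, k3, ka4, ka5, kj, kn, kU, kv, knd, ku, kt⟩ := hI
  have h11 : s.var 11 = n := by
    rcases hend with ⟨h1, -⟩ | ⟨h1, -⟩
    · omega
    · have : ¬ s.var 11 < n := by simpa [k0] using h1
      omega
  have hcnt : U.countP (fun I => decide (I.2 ≤ s.var 11)) ≤ U.length := List.countP_le_length
  rw [h11] at kv
  have hres : (walk.eval σ).lst = s.lst ∧ (walk.eval σ).tm ≤ s.tm + 3 := by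
    rw [hev]
    rcases hend with ⟨-, h1⟩ | ⟨-, h1⟩ <;> rw [h1] <;> simp
  simp only [hres.1]
  exact ⟨kv, knd, ku, by omega⟩

end RamLang

namespace RamLang

namespace IsIntervals

variable {n : ℕ} {U : List (ℕ × ℕ)} {X : Finset ℕ} (h : IsIntervals n U X)
include h

theorem mem_starts {a : ℕ} : a ∈ U.map Prod.fst ↔ a ∈ X ∧ ∀ y, y + 1 = a → y ∉ X := by
  constructor
  · intro ha
    obtain ⟨I, hI, rfl⟩ := List.mem_map.1 ha
    exact ⟨h.sub I hI _ le_rfl (h.lt I hI), h.left_max I hI⟩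
  · rintro ⟨h1, h2⟩
    obtain ⟨I, hI, h3, h4⟩ := h.cover a h1
    refine List.mem_map.2 ⟨I, hI, ?_⟩
    by_contra hne
    exact h2 (a - 1) (by omega) (h.sub I hI _ (by omega) (by omega))

theorem mem_stops {b : ℕ} : b ∈ U.map Prod.snd ↔ b ∉ X ∧ ∃ y, y + 1 = b ∧ y ∈ X := by
  constructor
  · intro ha
    obtain ⟨I, hI, rfl⟩ := List.mem_map.1 ha
    have := h.lt I hI
    exact ⟨h.right_max I hI, I.2 - 1, by omega, h.sub I hI _ (by omega) (by omega)⟩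
  · rintro ⟨h1, y, h2, h3⟩
    obtain ⟨I, hI, h4, h5⟩ := h.cover y h3
    refine List.mem_map.2 ⟨I, hI, ?_⟩
    by_contra hne
    exact h1 (h.sub I hI _ (by omega) (by omega))

theorem eq_or_disjoint {I J : ℕ × ℕ} (hI : I ∈ U) (hJ : J ∈ U) :
    I = J ∨ I.2 ≤ J.1 ∨ J.2 ≤ I.1 := by
  have key : ∀ I ∈ U, ∀ J ∈ U, I.1 < J.1 → I.2 ≤ J.1 := by
    intro I hI J hJ hlt
    by_contra h1
    exact h.left_max J hJ (J.1 - 1) (by omega) (h.sub I hI _ (by omega) (by omega))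
  rcases lt_trichotomy I.1 J.1 with h1 | h1 | h1
  · exact .inr (.inl (key I hI J hJ h1))
  · exact .inl (List.inj_on_of_nodup_map h.nodup hI hJ h1)
  · exact .inr (.inr (key J hJ I hI h1))

theorem reverse : IsIntervals n U.reverse X where
  lt I hI := h.lt I (by simpa using hI)
  le I hI := h.le I (by simpa using hI)
  sub I hI := h.sub I (by simpa using hI)
  left_max I hI := h.left_max I (by simpa using hI)
  right_max I hI := h.right_max I (by simpa using hI)
  cover x hx := by simpa using h.cover x hx
  nodup := by rw [List.map_reverse]; exact List.nodup_reverse.2 h.nodup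

end IsIntervals

/-- Of the two representations of a separation, the one of the larger side; `X` is its
complement. -/
def larger (n : ℕ) (A B : List (ℕ × ℕ)) : List (ℕ × ℕ) :=
  if gapSize n B < gapSize n A + 1 then B else A

/-- The separator of the separation with the given representations. -/
def separator (n : ℕ) (A B : List (ℕ × ℕ)) : Finset ℕ :=
  (Finset.range n).filter fun v => v ∉ compl n A ∧ v ∉ compl n B

/-- What is stored about the separation number `i`. Stamps of earlier separations need not be
erased: `hst` says that they are smaller than the stamp `i + 1`. -/
theorem readSep_spec {σ : St} {n i : ℕ} {A B : List (ℕ × ℕ)} {rest : List ℕ}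
    (hinp : σ.inp = SepTree.pairBlock A ++ (SepTree.pairBlock B ++ rest)) (hn : σ.var 0 = n)
    (hi : σ.var 3 = i) (h2 : σ.lst 2 i = []) (h11 : σ.lst 11 i = []) (h3 : σ.lst 3 i = [])
    (h4 : σ.lst 4 i = []) (hst : ∀ a, σ.arr 4 a ≤ i) (hA : IsRep n A) (hB : IsRep n B)
    (hAB : Disjoint (compl n A) (compl n B)) :
    let σ' := readSep.eval σ
    let L := larger n A B
    σ'.inp = rest ∧ σ'.lst 3 i = (gaps n L).reverse ∧
      σ'.arr 0 = Function.update (σ.arr 0) i (gapSize n L) ∧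
      σ'.lst 5 = Function.update (σ.lst 5) (gapSize n L) ((i, 0) :: σ.lst 5 (gapSize n L)) ∧
      (∀ v, v ∈ (σ'.lst 4 i).map Prod.fst ↔ v ∈ separator n A B) ∧
      ((σ'.lst 4 i).map Prod.fst).Nodup ∧
      (∀ u, u ≠ i → σ'.lst 2 u = σ.lst 2 u ∧ σ'.lst 11 u = σ.lst 11 u ∧ σ'.lst 3 u = σ.lst 3 u ∧
        σ'.lst 4 u = σ.lst 4 u) ∧ (∀ a, σ'.arr 4 a ≤ i + 1) ∧
      σ'.tm ≤ σ.tm + 60 * (A.length + B.length) + 20 * (σ'.lst 4 i).length + 200 := by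
  obtain ⟨hgA, hlA, hsA⟩ := gaps_spec hA
  obtain ⟨hgB, hlB, hsB⟩ := gaps_spec hB
  -- the two representations are read
  obtain ⟨s1, hs1⟩ : ∃ s, s = (readGaps 2).eval σ := ⟨_, rfl⟩
  obtain ⟨a1, a2, a3, a4, a5⟩ := readGaps_spec hinp hn hi h2
  rw [← hs1] at a1 a2 a3 a4 a5
  obtain ⟨s2, hs2⟩ : ∃ s, s = (Cmd.set 15 (.var 9)).eval s1 := ⟨_, rfl⟩
  obtain ⟨s3, hs3⟩ : ∃ s, s = (readGaps 11).eval s2 := ⟨_, rfl⟩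
  have v1 : ∀ x, x ∉ (readGaps 2).wv → s1.var x = σ.var x := fun x hx => by
    rw [hs1, Cmd.eval_var hx]
  have l1 : ∀ j, j ∉ (readGaps 2).wl → s1.lst j = σ.lst j := fun j hj => by
    rw [hs1, Cmd.eval_lst hj]
  have r1 : ∀ j, s1.arr j = σ.arr j := fun j => by
    rw [hs1, Cmd.eval_arr (by simp [readGaps, Cmd.wa])]
  have v2 : ∀ x, s2.var x = if x = 15 then gapSize n A else s1.var x := fun x => by
    simp [hs2, Cmd.eval, a4]
  have l2 : s2.lst = s1.lst := by simp [hs2, Cmd.eval]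
  have r2 : s2.arr = s1.arr := by simp [hs2, Cmd.eval]
  have t2 : s2.tm = s1.tm + 2 := by simp [hs2, Cmd.eval]
  obtain ⟨b1, b2, b3, b4, b5⟩ := readGaps_spec (j := 11) (σ := s2) (n := n) (i := i) (L := B)
    (rest := rest) (by simp [hs2, Cmd.eval, a1]) (by rw [v2, v1 0 (by decide)]; simp [hn])
    (by rw [v2, v1 3 (by decide)]; simp [hi]) (by rw [l2, l1 11 (by decide), h11])
  rw [← hs3] at b1 b2 b3 b4 b5
  have v3 : ∀ x, x ∉ (readGaps 11).wv → s3.var x = s2.var x := fun x hx => by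
    rw [hs3, Cmd.eval_var hx]
  have l3 : ∀ j, j ∉ (readGaps 11).wl → s3.lst j = s2.lst j := fun j hj => by
    rw [hs3, Cmd.eval_lst hj]
  have r3 : ∀ j, s3.arr j = σ.arr j := fun j => by
    rw [hs3, Cmd.eval_arr (by simp [readGaps, Cmd.wa]), r2, r1]
  obtain ⟨s4, hs4⟩ : ∃ s, s = ((Cmd.set 16 (.var 9)).eval s3).tick 4 := ⟨_, rfl⟩
  have v4 : ∀ x, s4.var x = if x = 16 then gapSize n B else s3.var x := fun x => by
    simp [hs4, Cmd.eval, b4]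
  have l4 : s4.lst = s3.lst := by simp [hs4, Cmd.eval]
  have r4 : s4.arr = s3.arr := by simp [hs4, Cmd.eval]
  have t4 : s4.tm = s3.tm + 6 := by simp [hs4, Cmd.eval]
  have i4 : s4.inp = rest := by simp [hs4, Cmd.eval, b1]
  have w16 : s4.var 16 = gapSize n B := by simp [v4]
  have w15 : s4.var 15 = gapSize n A := by
    rw [v4, if_neg (by decide), v3 15 (by decide), v2, if_pos rfl]
  have w3 : s4.var 3 = i := by
    rw [v4, if_neg (by decide), v3 3 (by decide), v2, if_neg (by decide), v1 3 (by decide), hi]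
  have w0 : s4.var 0 = n := by
    rw [v4, if_neg (by decide), v3 0 (by decide), v2, if_neg (by decide), v1 0 (by decide), hn]
  have g2 : s4.lst 2 i = gaps n A := by rw [l4, l3 2 (by decide), l2, a2]
  have g11 : s4.lst 11 i = gaps n B := by rw [l4, b2]
  have g3 : s4.lst 3 = σ.lst 3 := by rw [l4, l3 3 (by decide), l2, l1 3 (by decide)]
  have g4 : s4.lst 4 = σ.lst 4 := by rw [l4, l3 4 (by decide), l2, l1 4 (by decide)]
  have g5 : s4.lst 5 = σ.lst 5 := by rw [l4, l3 5 (by decide), l2, l1 5 (by decide)]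
  -- one of the two families of intervals is chosen
  obtain ⟨j, r, hj5, hj, hr, hjr⟩ : ∃ j r, j ≠ 5 ∧ s4.lst j i = gaps n (larger n A B) ∧
      s4.var r = gapSize n (larger n A B) ∧
      readSep.eval σ = walk.eval ((stamp 11).eval ((stamp 2).eval ((choose j r).eval s4))) := by
    have hev : readSep.eval σ = walk.eval ((stamp 11).eval ((stamp 2).eval
        (if s4.var 16 < s4.var 15 + 1 then (choose 11 16).eval s4
          else (choose 2 15).eval s4))) := by
      rw [hs4, hs3, hs2, hs1]; rfl
    rw [w16, w15] at hev
    by_cases hlt : gapSize n B < gapSize n A + 1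
    · refine ⟨11, 16, by decide, ?_, ?_, ?_⟩
      · rw [g11, larger, if_pos hlt]
      · rw [w16, larger, if_pos hlt]
      · rw [hev, if_pos hlt]
    · refine ⟨2, 15, by decide, ?_, ?_, ?_⟩
      · rw [g2, larger, if_neg hlt]
      · rw [w15, larger, if_neg hlt]
      · rw [hev, if_neg hlt]
  have hlL : (gaps n (larger n A B)).length ≤ A.length + B.length + 1 := by
    rw [larger]; split <;> omega
  obtain ⟨s5, hs5⟩ : ∃ s, s = (choose j r).eval s4 := ⟨_, rfl⟩
  obtain ⟨c1, c2, c3, c4, c5⟩ := choose_spec (r := r) w3 hj5 (by rw [g3, h3])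
  rw [← hs5] at c1 c2 c3 c4 c5
  rw [hj] at c1 c5
  rw [hr] at c3 c4
  have v5 : ∀ x, x ≠ 6 → x ≠ 7 → s5.var x = s4.var x := fun x h6 h7 => by
    rw [hs5, Cmd.eval_var (by simp [choose, Cmd.wv, h6, h7])]
  have l5 : ∀ j, j ≠ 3 → j ≠ 5 → s5.lst j = s4.lst j := fun x h6 h7 => by
    rw [hs5, Cmd.eval_lst (by simp [choose, Cmd.wl, h6, h7])]
  have r5 : ∀ j, j ≠ 0 → s5.arr j = σ.arr j := fun x h6 => by
    rw [hs5, Cmd.eval_arr (by simp [choose, Cmd.wa, h6]), r4, r3]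
  have i5 : s5.inp = rest := by rw [hs5, Cmd.eval_inp rfl, i4]
  have w5 : s5.var 3 = i := by rw [v5 3 (by decide) (by decide), w3]
  have g52 : s5.lst 2 i = gaps n A := by rw [l5 2 (by decide) (by decide), g2]
  have g511 : s5.lst 11 i = gaps n B := by rw [l5 11 (by decide) (by decide), g11]
  -- the starts of all gaps are stamped
  obtain ⟨s6, hs6⟩ : ∃ s, s = (stamp 2).eval s5 := ⟨_, rfl⟩
  obtain ⟨d1, d2, d3⟩ := stamp_spec (j := 2) (σ := s5) w5 (by rw [g52]; exact hgA.nodup)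
  rw [← hs6, g52] at d1 d2 d3
  have v6 : ∀ x, x ≠ 6 → x ≠ 7 → s6.var x = s5.var x := fun x h6 h7 => by
    rw [hs6, Cmd.eval_var (by simp [stamp, Cmd.wv, h6, h7])]
  have l6 : s6.lst = s5.lst := by
    funext j; rw [hs6, Cmd.eval_lst (by simp [stamp, Cmd.wl])]
  have r6 : ∀ j, j ≠ 4 → j ≠ 5 → s6.arr j = s5.arr j := fun x h4 h5 => by
    rw [hs6, Cmd.eval_arr (by simp [stamp, Cmd.wa, h4, h5])]
  obtain ⟨s7, hs7⟩ : ∃ s, s = (stamp 11).eval s6 := ⟨_, rfl⟩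
  have w6 : s6.var 3 = i := by rw [v6 3 (by decide) (by decide), w5]
  obtain ⟨e1, e2, e3⟩ := stamp_spec (j := 11) (σ := s6) w6 (by rw [l6, g511]; exact hgB.nodup)
  rw [← hs7, l6, g511] at e1 e2 e3
  have v7 : ∀ x, x ≠ 6 → x ≠ 7 → s7.var x = s6.var x := fun x h6 h7 => by
    rw [hs7, Cmd.eval_var (by simp [stamp, Cmd.wv, h6, h7])]
  have l7 : s7.lst = s5.lst := by
    funext j; rw [hs7, Cmd.eval_lst (by simp [stamp, Cmd.wl]), l6]
  have r7 : ∀ j, j ≠ 4 → j ≠ 5 → s7.arr j = s5.arr j := fun x h4 h5 => by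
    rw [hs7, Cmd.eval_arr (by simp [stamp, Cmd.wa, h4, h5]), r6 x h4 h5]
  have st4 : ∀ a, i < s7.arr 4 a → (a, s7.arr 5 a) ∈ gaps n A ++ gaps n B := by
    intro a ha
    by_cases hB' : a ∈ (gaps n B).map Prod.fst
    · obtain ⟨I, hI, rfl⟩ := List.mem_map.1 hB'
      rw [(e2 I hI).2]
      exact List.mem_append_right _ hI
    · rw [(e1 a hB').1] at ha
      rw [(e1 a hB').2]
      by_cases hA' : a ∈ (gaps n A).map Prod.fst
      · obtain ⟨I, hI, rfl⟩ := List.mem_map.1 hA'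
        rw [(d2 I hI).2]
        exact List.mem_append_left _ hI
      · rw [(d1 a hA').1, r5 4 (by decide)] at ha
        exact absurd (hst a) (by omega)
  have st4' : ∀ I ∈ gaps n A ++ gaps n B, s7.arr 4 I.1 = i + 1 := by
    intro I hI
    by_cases hB' : I.1 ∈ (gaps n B).map Prod.fst
    · obtain ⟨J, hJ, hJI⟩ := List.mem_map.1 hB'
      rw [← hJI, (e2 J hJ).1]
    · rw [(e1 _ hB').1]
      rcases List.mem_append.1 hI with hI | hI
      · exact (d2 I hI).1
      · exact absurd (List.mem_map_of_mem hI) hB'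
  have st4'' : ∀ a, s7.arr 4 a ≤ i + 1 := by
    intro a
    by_cases ha : i < s7.arr 4 a
    · exact (st4' _ (st4 a ha)).le
    · omega
  -- the walk finds the vertices outside all gaps
  obtain ⟨s8, hs8⟩ : ∃ s, s = walk.eval s7 := ⟨_, rfl⟩
  have w7 : s7.var 3 = i := by rw [v7 3 (by decide) (by decide), w6]
  have w70 : s7.var 0 = n := by
    rw [v7 0 (by decide) (by decide), v6 0 (by decide) (by decide), v5 0 (by decide) (by decide),
      w0]
  obtain ⟨f1, f2, f3, f4⟩ := walk_spec (U := gaps n A ++ gaps n B) w70 w7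
    (by rw [l7, l5 4 (by decide) (by decide), g4, h4])
    (by
      intro I hI
      rcases List.mem_append.1 hI with hI | hI
      · exact ⟨hgA.lt I hI, hgA.le I hI⟩
      · exact ⟨hgB.lt I hI, hgB.le I hI⟩)
    (by
      have key : ∀ I ∈ gaps n A, ∀ J ∈ gaps n B, I.2 ≤ J.1 ∨ J.2 ≤ I.1 := by
        intro I hI J hJ
        by_contra hc
        have := hgA.lt I hI
        have := hgB.lt J hJ
        exact Finset.disjoint_left.1 hAB (hgA.sub I hI (max I.1 J.1) (by omega) (by omega))
          (hgB.sub J hJ (max I.1 J.1) (by omega) (by omega))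
      intro I hI J hJ
      rcases List.mem_append.1 hI with hI | hI <;> rcases List.mem_append.1 hJ with hJ | hJ
      · exact hgA.eq_or_disjoint hI hJ
      · exact .inr (key I hI J hJ)
      · exact .inr (key J hJ I hI).symm
      · exact hgB.eq_or_disjoint hI hJ) st4 fun I hI => by rw [st4' I hI]; omega
  rw [← hs8] at f1 f2 f3 f4
  have l8 : ∀ j, j ≠ 4 → s8.lst j = s5.lst j := fun j hj => by
    rw [hs8, Cmd.eval_lst (by simp [walk, Cmd.wl, hj]), l7]
  have r8 : s8.arr = s7.arr := by
    funext j; rw [hs8, Cmd.eval_arr (by simp [walk, Cmd.wa])]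
  have i8 : s8.inp = rest := by
    rw [hs8, Cmd.eval_inp rfl, hs7, Cmd.eval_inp rfl, hs6, Cmd.eval_inp rfl, i5]
  rw [List.length_append] at f4
  simp only [hjr, ← hs5, ← hs6, ← hs7, ← hs8]
  refine ⟨i8, ?_, ?_, ?_, ?_, f2, ?_, ?_, by omega⟩
  · rw [l8 3 (by decide), c1]
  · rw [r8, r7 0 (by decide) (by decide), c3, r4, r3]
  · rw [l8 5 (by decide), c4, g5]
  · intro v
    rw [f1, separator, Finset.mem_filter, Finset.mem_range]
    constructor
    · rintro ⟨hv, hU⟩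
      refine ⟨hv, fun hvA => ?_, fun hvB => ?_⟩
      · obtain ⟨I, hI, h1⟩ := hgA.cover v hvA
        exact hU ⟨I, List.mem_append_left _ hI, h1⟩
      · obtain ⟨I, hI, h1⟩ := hgB.cover v hvB
        exact hU ⟨I, List.mem_append_right _ hI, h1⟩
    · rintro ⟨hv, hvA, hvB⟩
      refine ⟨hv, ?_⟩
      rintro ⟨I, hI, h1, h2⟩
      rcases List.mem_append.1 hI with hI | hI
      · exact hvA (hgA.sub I hI v h1 h2)
      · exact hvB (hgB.sub I hI v h1 h2)
  · intro u hu
    refine ⟨?_, ?_, ?_, ?_⟩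
    · rw [l8 2 (by decide), l5 2 (by decide) (by decide), l4, l3 2 (by decide), l2, a3 u hu]
    · rw [l8 11 (by decide), l5 11 (by decide) (by decide), l4, b3 u hu, l2, l1 11 (by decide)]
    · rw [l8 3 (by decide), c2 u hu, g3]
    · rw [f3 u hu, l7, l5 4 (by decide) (by decide), g4]
  · intro a; rw [r8]; exact st4'' a

/-- What is known after the separations with numbers below `q` have been read. -/
structure SepsRead (n q K : ℕ) (X S : ℕ → Finset ℕ) (σ : St) : Prop where
  size : ∀ i < q, σ.arr 0 i = (X i).card
  intervals : ∀ i < q, IsIntervals n (σ.lst 3 i) (X i)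
  intervals_length : ∀ i < q, (σ.lst 3 i).length ≤ K
  mem_sep : ∀ i < q, ∀ v, v ∈ (σ.lst 4 i).map Prod.fst ↔ v ∈ S i
  sep_nodup : ∀ i < q, ((σ.lst 4 i).map Prod.fst).Nodup
  mem_bySize : ∀ s i, i ∈ (σ.lst 5 s).map Prod.fst ↔ i < q ∧ (X i).card = s
  bySize_nodup : ∀ s, ((σ.lst 5 s).map Prod.fst).Nodup

/-- The time for a separation is proportional to the length of its representation and the size of
its separator, and does not involve `n`. -/
theorem readSeps_spec {σ : St} {n p k l : ℕ} {A B : ℕ → List (ℕ × ℕ)}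
    (hinp : σ.inp = p :: (List.range p).flatMap fun i =>
      SepTree.pairBlock (A i) ++ SepTree.pairBlock (B i))
    (hn : σ.var 0 = n) (hl : ∀ j : Fin 16, j ≠ 1 → σ.lst j = fun _ => [])
    (hst : ∀ a, σ.arr 4 a = 0)
    (hA : ∀ i < p, IsRep n (A i)) (hB : ∀ i < p, IsRep n (B i))
    (hAB : ∀ i < p, Disjoint (compl n (A i)) (compl n (B i)))
    (hlen : ∀ i < p, (A i).length + (B i).length ≤ l)
    (hk : ∀ i < p, (separator n (A i) (B i)).card ≤ k) :
    let σ' := readSeps.eval σ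
    SepsRead n p (l + 1) (fun i => compl n (larger n (A i) (B i)))
      (fun i => separator n (A i) (B i)) σ' ∧ σ'.var 0 = n ∧ σ'.var 2 = p ∧ σ'.arr 0 p = n ∧
      σ'.tm ≤ σ.tm + p * (60 * l + 20 * k + 201) + 10 := by
  obtain ⟨s1, hs1⟩ : ∃ s, s = (Cmd.put 0 (.var 2) (.var 0)).eval ((Cmd.read 2).eval σ) := ⟨_, rfl⟩
  have a0 : s1.var 0 = n := by simp [hs1, Cmd.eval, hn]
  have a2 : s1.var 2 = p := by simp [hs1, Cmd.eval, hinp]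
  have ar : s1.arr 0 p = n := by simp [hs1, Cmd.eval, hinp, hn]
  have ai : s1.inp = (List.range p).flatMap fun i =>
      SepTree.pairBlock (A i) ++ SepTree.pairBlock (B i) := by simp [hs1, Cmd.eval, hinp]
  have al : ∀ j : Fin 16, j ≠ 1 → s1.lst j = fun _ => [] := fun j hj => by
    simp [hs1, Cmd.eval, hl j hj]
  have a4 : ∀ a, s1.arr 4 a = 0 := fun a => by simp [hs1, Cmd.eval, hst]
  have at1 : s1.tm = σ.tm + 4 := by simp [hs1, Cmd.eval]
  have key := forN_inv (x := 3) (e := .var 2) (P := readSep) (σ := s1) (fun i s =>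
    SepsRead n i (l + 1) (fun i => compl n (larger n (A i) (B i)))
      (fun i => separator n (A i) (B i)) s ∧ s.var 0 = n ∧ s.var 2 = p ∧ s.arr 0 p = n ∧
    s.inp = ((List.range p).drop i).flatMap (fun i =>
      SepTree.pairBlock (A i) ++ SepTree.pairBlock (B i)) ∧
    (∀ u, i ≤ u → s.lst 2 u = [] ∧ s.lst 11 u = [] ∧ s.lst 3 u = [] ∧ s.lst 4 u = []) ∧
    (∀ a, s.arr 4 a ≤ i) ∧ s.tm ≤ σ.tm + 6 + i * (60 * l + 20 * k + 201)) ?_ ?_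
  · simp only [Expr.eval, a2] at key
    obtain ⟨k1, k2, k3, k4, k5, k6, k7, k8⟩ := key
    simp only [readSeps, Cmd.eval] at hs1 k1 k2 k3 k4 k8 ⊢
    rw [← hs1]
    exact ⟨k1, k2, k3, k4, by omega⟩
  · refine ⟨⟨by simp, by simp, by simp, by simp, by simp, ?_, ?_⟩, by simpa using a0,
      by simpa using a2, by simpa using ar, by simpa using ai, ?_, ?_, ?_⟩
    · intro s i; simp [al 5 (by decide)]
    · intro s; simp [al 5 (by decide)]
    · intro u _
      simp [al]
    · intro a; simp [a4]
    · simp [at1]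
  · rintro i s hi ⟨k1, k2, k3, k4, k5, k6, k7, k8⟩
    simp only [Expr.eval, a2] at hi
    rw [List.drop_eq_getElem_cons (by simpa using hi), List.flatMap_cons, List.getElem_range,
      List.append_assoc] at k5
    obtain ⟨m2, m11, m3, m4⟩ := k6 i le_rfl
    have hsp := readSep_spec (σ := (s.setVar 3 i).tick 1) (i := i) (n := n) k5 (by simp [k2])
      (by simp) m2 m11 m3 m4 k7 (hA i hi) (hB i hi) (hAB i hi)
    obtain ⟨s2, hs2⟩ : ∃ s2, s2 = readSep.eval ((s.setVar 3 i).tick 1) := ⟨_, rfl⟩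
    have hvar : ∀ x, x ∉ 3 :: readSep.wv → s2.var x = s.var x := fun x hx => by
      simp only [List.mem_cons, not_or] at hx
      rw [hs2, Cmd.eval_var hx.2]; simp [hx.1]
    rw [← hs2] at hsp ⊢
    simp only [St.tick_arr, St.setVar_arr, St.tick_lst, St.setVar_lst, St.tick_tm,
      St.setVar_tm] at hsp
    obtain ⟨b1, b2, b3, b4, b5, b6, b7, b8, b9⟩ := hsp
    have hL : IsRep n (larger n (A i) (B i)) := by
      rw [larger]; split; exacts [hB i hi, hA i hi]
    obtain ⟨hg1, hg2, hg3⟩ := gaps_spec hL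
    have hLl : (larger n (A i) (B i)).length ≤ l := by
      have := hlen i hi
      rw [larger]; split <;> omega
    have hS : (s2.lst 4 i).length ≤ k := by
      rw [← List.length_map Prod.fst, ← List.toFinset_card_of_nodup b6]
      refine le_trans (le_of_eq ?_) (hk i hi)
      congr 1
      ext v; rw [List.mem_toFinset, b5]
    refine ⟨⟨?_, ?_, ?_, ?_, ?_, ?_, ?_⟩, ?_, ?_, ?_, b1, ?_, b8, ?_⟩
    · intro u hu
      by_cases hui : u = i
      · subst hui; rw [b3]; simp [hg3]
      · rw [b3]; simp [hui]; exact k1.size u (by omega)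
    · intro u hu
      by_cases hui : u = i
      · subst hui; rw [b2]; exact hg1.reverse
      · rw [(b7 u hui).2.2.1]; exact k1.intervals u (by omega)
    · intro u hu
      by_cases hui : u = i
      · subst hui; rw [b2, List.length_reverse]; omega
      · rw [(b7 u hui).2.2.1]; exact k1.intervals_length u (by omega)
    · intro u hu
      by_cases hui : u = i
      · subst hui; exact b5
      · rw [(b7 u hui).2.2.2]; exact k1.mem_sep u (by omega)
    · intro u hu
      by_cases hui : u = i
      · subst hui; exact b6
      · rw [(b7 u hui).2.2.2]; exact k1.sep_nodup u (by omega)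
    · intro t u
      rw [b4]
      by_cases ht : t = gapSize n (larger n (A i) (B i))
      · rw [ht]
        simp only [Function.update_self, List.map_cons, List.mem_cons, k1.mem_bySize, hg3]
        constructor
        · rintro (rfl | ⟨h1, h2⟩)
          · exact ⟨by omega, rfl⟩
          · exact ⟨by omega, h2⟩
        · rintro ⟨h1, h2⟩
          by_cases hui : u = i
          · exact .inl hui
          · exact .inr ⟨by omega, h2⟩
      · rw [Function.update_of_ne ht, k1.mem_bySize]
        constructor
        · rintro ⟨h1, h2⟩; exact ⟨by omega, h2⟩
        · rintro ⟨h1, h2⟩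
          refine ⟨?_, h2⟩
          by_contra h3
          obtain rfl : u = i := by omega
          exact ht (by rw [hg3]; exact h2.symm)
    · intro t
      rw [b4]
      by_cases ht : t = gapSize n (larger n (A i) (B i))
      · rw [ht]
        simp only [Function.update_self, List.map_cons, List.nodup_cons, k1.mem_bySize]
        exact ⟨by omega, k1.bySize_nodup _⟩
      · rw [Function.update_of_ne ht]; exact k1.bySize_nodup _
    · rw [hvar 0 (by decide), k2]
    · rw [hvar 2 (by decide), k3]
    · rw [b3, Function.update_of_ne (by omega), k4]
    · intro u hu
      obtain ⟨c1, c2, c3, c4⟩ := b7 u (by omega)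
      rw [c1, c2, c3, c4]
      exact k6 u (by omega)
    · have := hlen i hi
      rw [Nat.add_mul, Nat.one_mul]; omega

end RamLang

/-! ### Sorting -/

namespace RamLang

/-- The sizes are visited from the largest to the smallest, and `push` adds at the front, so that
the list ends up increasing. -/
theorem sortSeps_spec {σ : St} {n p : ℕ} {sz : ℕ → ℕ} (hn : σ.var 0 = n) (hl : σ.lst 6 0 = [])
    (hm : ∀ s i, i ∈ (σ.lst 5 s).map Prod.fst ↔ i < p ∧ sz i = s)
    (hnd : ∀ s, ((σ.lst 5 s).map Prod.fst).Nodup) (hle : ∀ i < p, sz i ≤ n) :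
    let σ' := sortSeps.eval σ
    ((σ'.lst 6 0).map Prod.fst).Nodup ∧ (∀ i, i ∈ (σ'.lst 6 0).map Prod.fst ↔ i < p) ∧
      ((σ'.lst 6 0).map Prod.fst).Pairwise (fun i j => sz i ≤ sz j) ∧
      σ'.tm ≤ σ.tm + 10 * n + 10 * p + 20 := by
  have key := forN_inv (x := 14) (e := .succ (.var 0))
    (P := .forL 5 (.sub (.var 0) (.var 14)) 3 17 (.push 6 .zero (.var 3) .zero)) (σ := σ)
    (fun z s => s.var 0 = n ∧ s.lst 5 = σ.lst 5 ∧ ((s.lst 6 0).map Prod.fst).Nodup ∧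
      (∀ i, i ∈ (s.lst 6 0).map Prod.fst ↔ i < p ∧ n < sz i + z) ∧
      ((s.lst 6 0).map Prod.fst).Pairwise (fun i j => sz i ≤ sz j) ∧
      s.tm ≤ σ.tm + 5 + 10 * z + 10 * (s.lst 6 0).length) ?_ ?_
  · simp only [Expr.eval, hn] at key
    obtain ⟨-, -, k1, k2, k3, k4⟩ := key
    replace k1 : (((sortSeps.eval σ).lst 6 0).map Prod.fst).Nodup := k1
    have k2' : ∀ i, i ∈ ((sortSeps.eval σ).lst 6 0).map Prod.fst ↔ i < p := by
      intro i
      rw [sortSeps, k2]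
      exact ⟨fun h => h.1, fun h => ⟨h, by omega⟩⟩
    refine ⟨k1, k2', k3, ?_⟩
    have hlen : ((sortSeps.eval σ).lst 6 0).length = p := by
      rw [← List.length_map Prod.fst, ← List.toFinset_card_of_nodup k1, ← Finset.card_range p]
      congr 1
      ext i
      rw [List.mem_toFinset, Finset.mem_range]
      exact k2' i
    simp only [sortSeps] at hlen ⊢
    rw [hlen] at k4
    omega
  · refine ⟨by simpa using hn, by simp, by simp [hl], ?_, by simp [hl], by simp; omega⟩
    intro i
    simp only [St.tick_lst, hl, List.map_nil, List.not_mem_nil, false_iff]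
    rintro ⟨h1, h2⟩
    have := hle i h1
    omega
  · rintro z s hz ⟨k1, k2, k3, k4, k5, k6⟩
    simp only [Expr.eval, hn] at hz
    have inner := forL_inv (j := 5) (e := .sub (.var 0) (.var 14)) (x := 3) (y := 17)
      (P := .push 6 .zero (.var 3) .zero) (σ := (s.setVar 14 z).tick 1)
      (fun D t => t.var 0 = n ∧ t.lst 5 = σ.lst 5 ∧
        (t.lst 6 0).map Prod.fst = (D.map Prod.fst).reverse ++ (s.lst 6 0).map Prod.fst ∧
        t.tm ≤ s.tm + 5 + 6 * D.length) ?_ ?_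
    · simp only [Expr.eval, St.tick_var, St.setVar_var, St.tick_lst, St.setVar_lst, k1, k2] at inner
      simp only [Nat.reduceEqDiff, if_true, if_false, OfNat.zero_ne_ofNat] at inner
      obtain ⟨i1, i2, i3, i4⟩ := inner
      refine ⟨i1, i2, ?_, ?_, ?_, ?_⟩
      · rw [i3]
        refine List.nodup_append.2 ⟨List.nodup_reverse.2 (hnd _), k3, ?_⟩
        rintro a ha b hb rfl
        rw [List.mem_reverse, hm] at ha
        rw [k4] at hb
        omega
      · intro i
        rw [i3, List.mem_append, List.mem_reverse, hm, k4]
        omega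
      · rw [i3]
        refine List.pairwise_append.2 ⟨?_, k5, ?_⟩
        · rw [List.pairwise_reverse]
          refine List.Pairwise.imp_of_mem ?_ (hnd (n - z))
          intro a b ha hb _
          rw [hm] at ha hb
          omega
        · intro a ha b hb
          rw [List.mem_reverse, hm] at ha
          rw [k4] at hb
          omega
      · have hlen := congrArg List.length i3
        simp only [List.length_append, List.length_reverse, List.length_map] at hlen
        omega
    · exact ⟨by simp [k1], by simp [k2], by simp, by simp⟩
    · rintro D a R t - ⟨i1, i2, i3, i4⟩
      refine ⟨by simp [Cmd.eval, i1], by simp [Cmd.eval, i2], ?_, by simp [Cmd.eval]; omega⟩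
      simp [Cmd.eval, i3]

/-- The separations are distributed by increasing size, so that each list of the family `7` is
decreasing. -/
theorem bucket_spec {σ : St} {K : ℕ} (h7 : σ.lst 7 = fun _ => []) (h8 : σ.lst 8 = fun _ => [])
    (hnd : ∀ i ∈ (σ.lst 6 0).map Prod.fst, ((σ.lst 3 i).map Prod.fst).Nodup)
    (hK : ∀ i ∈ (σ.lst 6 0).map Prod.fst, (σ.lst 3 i).length ≤ K) :
    let σ' := bucket.eval σ
    (∀ x, (σ'.lst 7 x).map Prod.fst =
      (((σ.lst 6 0).map Prod.fst).filter fun i => x ∈ (σ.lst 3 i).map Prod.fst).reverse) ∧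
    (∀ x i, i ∈ (σ'.lst 8 x).map Prod.fst ↔
      i ∈ (σ.lst 6 0).map Prod.fst ∧ x ∈ (σ.lst 3 i).map Prod.snd) ∧
    σ'.tm ≤ σ.tm + 10 + (σ.lst 6 0).length * (10 * K + 10) := by
  have key := forL_inv (j := 6) (e := .zero) (x := 3) (y := 17)
    (P := .forL 3 (.var 3) 6 7 (.push 7 (.var 6) (.var 3) .zero ;; .push 8 (.var 7) (.var 3) .zero))
    (σ := σ) (fun D s => s.lst 3 = σ.lst 3 ∧
      (∀ x, (s.lst 7 x).map Prod.fst =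
        ((D.map Prod.fst).filter fun i => x ∈ (σ.lst 3 i).map Prod.fst).reverse) ∧
      (∀ x i, i ∈ (s.lst 8 x).map Prod.fst ↔ i ∈ D.map Prod.fst ∧ x ∈ (σ.lst 3 i).map Prod.snd) ∧
      s.tm ≤ σ.tm + 2 + D.length * (10 * K + 10)) ?_ ?_
  · obtain ⟨-, k1, k2, k3⟩ := key
    exact ⟨k1, k2, by simp only [bucket, Expr.eval] at k3 ⊢; omega⟩
  · exact ⟨by simp, by simp [h7], by simp [h8], by simp⟩
  · rintro D ⟨i, w⟩ R s hL ⟨k1, k2, k3, k4⟩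
    simp only [Expr.eval] at hL
    have hi : i ∈ (σ.lst 6 0).map Prod.fst := by simp [hL]
    have inner := forL_inv (j := 3) (e := .var 3) (x := 6) (y := 7)
      (P := .push 7 (.var 6) (.var 3) .zero ;; .push 8 (.var 7) (.var 3) .zero)
      (σ := ((s.setVar 3 i).setVar 17 w).tick 1)
      (fun C t => t.lst 3 = σ.lst 3 ∧ t.var 3 = i ∧
        (∀ x, (t.lst 7 x).map Prod.fst =
          (if x ∈ C.map Prod.fst then [i] else []) ++ (s.lst 7 x).map Prod.fst) ∧
        (∀ x j, j ∈ (t.lst 8 x).map Prod.fst ↔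
          j ∈ (s.lst 8 x).map Prod.fst ∨ j = i ∧ x ∈ C.map Prod.snd) ∧
        t.tm ≤ s.tm + 3 + 10 * C.length) ?_ ?_
    · have hU : (((s.setVar 3 i).setVar 17 w).tick 1).lst 3
          ((Expr.var 3).eval (((s.setVar 3 i).setVar 17 w).tick 1)) = σ.lst 3 i := by
        simp [k1]
      rw [hU] at inner
      obtain ⟨i1, -, i2, i3, i4⟩ := inner
      refine ⟨i1, ?_, ?_, ?_⟩
      · intro x
        rw [i2, k2]
        by_cases hx : x ∈ (σ.lst 3 i).map Prod.fst <;>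
          simp only [List.map_append, List.map_cons, List.map_nil, List.filter_append,
            List.reverse_append, hx, if_true, if_false, List.filter_cons, List.filter_nil,
            decide_true, decide_false, List.reverse_cons, List.reverse_nil, List.nil_append,
            Bool.false_eq_true]
      · intro x j
        rw [i3, k3, List.map_append, List.mem_append, List.map_cons, List.map_nil,
          List.mem_singleton, or_and_right]
        refine or_congr_right ?_
        constructor <;> rintro ⟨rfl, h⟩ <;> exact ⟨rfl, h⟩
      · have := hK i hi
        simp only at i4 ⊢
        rw [List.length_append, List.length_singleton, Nat.add_mul, Nat.one_mul]
        omega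
    · refine ⟨by simp [k1], by simp, by simp, by simp, by simp⟩
    · rintro C a Q t hC ⟨i1, i2, i3, i4, i5⟩
      have hU : (((s.setVar 3 i).setVar 17 w).tick 1).lst 3
          ((Expr.var 3).eval (((s.setVar 3 i).setVar 17 w).tick 1)) = σ.lst 3 i := by
        simp [k1]
      rw [hU] at hC
      have hd := hnd i hi
      rw [hC, List.map_append, List.map_cons, List.nodup_append] at hd
      have ha : a.1 ∉ C.map Prod.fst := fun h => hd.2.2 _ h _ (by simp) rfl
      refine ⟨by simp [Cmd.eval, i1], by simp [Cmd.eval, i2], ?_, ?_, by simp [Cmd.eval]; omega⟩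
      · intro x
        by_cases hx : x = a.1
        · subst hx
          have := i3 a.1
          rw [if_neg ha] at this
          simp only [Cmd.eval, Expr.eval, St.tick_lst, St.cons_lst, St.cons_var, St.tick_var,
            St.setVar_var, St.setVar_lst, i2] at this ⊢
          simp [this]
        · have := i3 x
          simp only [List.map_append, List.mem_append, List.map_cons, List.map_nil,
            List.mem_singleton, hx, or_false, ← this]
          simp [Cmd.eval, hx]
      · intro x j
        have := i4 x j
        rw [List.map_append, List.mem_append, List.map_cons, List.map_nil, List.mem_singleton]
        by_cases hx : x = a.2
        · subst hx
          simp only [Cmd.eval, Expr.eval, St.tick_lst, St.cons_lst, St.cons_var, St.tick_var,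
            St.setVar_var, St.setVar_lst, i2] at this ⊢
          simp only [Nat.reduceEqDiff, if_true, if_false, Fin.reduceEq, Function.update_self,
            List.map_cons, List.mem_cons, this]
          tauto
        · simp only [hx, or_false, ← this]
          simp [Cmd.eval, hx]

end RamLang

/-! ### The sweep -/

namespace RamLang

/-- A laminar family of distinct subsets of `{0, …, n - 1}`, with numbers up to `p`, the last of
which is the whole set. -/
structure IsLaminar (n p : ℕ) (X : ℕ → Finset ℕ) : Prop where
  root : X p = Finset.range n
  sub : ∀ i < p, X i ⊂ Finset.range n
  cases : ∀ i ≤ p, ∀ j ≤ p, i ≠ j → X i ⊂ X j ∨ X j ⊂ X i ∨ Disjoint (X i) (X j)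

/-- `X c` is the smallest set of the family that contains `x`. -/
def IsHome (p : ℕ) (X : ℕ → Finset ℕ) (c x : ℕ) : Prop :=
  c ≤ p ∧ x ∈ X c ∧ ∀ j ≤ p, x ∈ X j → X c ⊆ X j

/-- `X c` is the smallest set of the family that strictly contains `X i`. -/
def IsPar (p : ℕ) (X : ℕ → Finset ℕ) (c i : ℕ) : Prop :=
  c ≤ p ∧ X i ⊂ X c ∧ ∀ j ≤ p, X i ⊂ X j → X c ⊆ X j

namespace IsLaminar

variable {n p : ℕ} {X : ℕ → Finset ℕ} (h : IsLaminar n p X)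
include h

theorem comparable {i j x : ℕ} (hi : i ≤ p) (hj : j ≤ p) (hij : i ≠ j) (hxi : x ∈ X i)
    (hxj : x ∈ X j) : X i ⊂ X j ∨ X j ⊂ X i := by
  rcases h.cases i hi j hj hij with h1 | h1 | h1
  · exact .inl h1
  · exact .inr h1
  · exact absurd hxj (Finset.disjoint_left.1 h1 hxi)

theorem sub_root {i : ℕ} (hi : i ≤ p) : X i ⊆ X p := by
  rcases hi.eq_or_lt with rfl | hi
  · exact subset_rfl
  · rw [h.root]; exact (h.sub i hi).subset

end IsLaminar

/-- The set number `j` is still open when the sweep arrives at `x`: it is the root, or it contains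
the predecessor of `x`. -/
def IsOpenAt (p : ℕ) (X : ℕ → Finset ℕ) (x j : ℕ) : Prop :=
  j = p ∨ ∃ y, y + 1 = x ∧ y ∈ X j

theorem IsLaminar.comparable_open {n p : ℕ} {X : ℕ → Finset ℕ} (h : IsLaminar n p X) {x i j : ℕ}
    (hi : i ≤ p) (hj : j ≤ p) (hij : i ≠ j) (hxi : IsOpenAt p X x i) (hxj : IsOpenAt p X x j) :
    X i ⊂ X j ∨ X j ⊂ X i := by
  rcases hxi with rfl | ⟨y, rfl, hy⟩
  · right; rw [h.root]; exact h.sub j (by omega)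
  rcases hxj with rfl | ⟨z, hz, hzj⟩
  · left; rw [h.root]; exact h.sub i (by omega)
  obtain rfl : z = y := by omega
  exact h.comparable hi hj hij hy hzj

/-- Closing the sets that end before `x` leaves the smallest open set that contains `x`. The sets
may be listed in any order: a set smaller than the current one has been passed already. -/
theorem sweep_close_spec {σ : St} {n p x c : ℕ} {X : ℕ → Finset ℕ} (h : IsLaminar n p X)
    (hx : x < n) (hx11 : σ.var 11 = x) (hc : σ.var 12 = c) (hcp : c ≤ p)
    (hopen : IsOpenAt p X x c) (hmin : ∀ j ≤ p, IsOpenAt p X x j → X c ⊆ X j)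
    (hsize : ∀ i ≤ p, σ.arr 0 i = (X i).card)
    (hends : ∀ i, i ∈ (σ.lst 8 x).map Prod.fst ↔ i < p ∧ x ∉ X i ∧ ∃ y, y + 1 = x ∧ y ∈ X i)
    (hpar : ∀ i ∈ (σ.lst 8 x).map Prod.fst, IsPar p X (σ.arr 1 i) i) :
    let σ' := (Cmd.forL 8 (.var 11) 3 17
      (.ite (.get 0 (.var 3)) (.get 0 (.var 12)) .skip (.set 12 (.get 1 (.var 3))))).eval σ
    σ'.var 12 ≤ p ∧ x ∈ X (σ'.var 12) ∧ IsOpenAt p X x (σ'.var 12) ∧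
      (∀ j ≤ p, IsOpenAt p X x j → x ∈ X j → X (σ'.var 12) ⊆ X j) ∧
      σ'.tm ≤ σ.tm + 2 + 10 * (σ.lst 8 x).length := by
  have key := forL_inv (j := 8) (e := .var 11) (x := 3) (y := 17)
    (P := .ite (.get 0 (.var 3)) (.get 0 (.var 12)) .skip (.set 12 (.get 1 (.var 3)))) (σ := σ)
    (fun D s => s.arr = σ.arr ∧ s.var 12 ≤ p ∧ IsOpenAt p X x (s.var 12) ∧
      (∀ j ≤ p, IsOpenAt p X x j → x ∈ X j → X (s.var 12) ⊆ X j) ∧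
      (∀ i ∈ D.map Prod.fst, (X i).card < (X (s.var 12)).card) ∧
      s.tm ≤ σ.tm + 2 + 10 * D.length) ?_ ?_
  · simp only [Expr.eval, hx11] at key
    obtain ⟨-, k2, k3, k4, k5, k6⟩ := key
    refine ⟨k2, ?_, k3, k4, k6⟩
    by_contra hxc
    rcases k3 with k3 | k3
    · rw [k3, h.root, Finset.mem_range] at hxc
      exact hxc hx
    · rcases k2.eq_or_lt with k2 | k2
      · rw [k2, h.root, Finset.mem_range] at hxc
        exact hxc hx
      · exact absurd (k5 _ ((hends _).2 ⟨k2, hxc, k3⟩)) (lt_irrefl _)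
  · exact ⟨rfl, by simpa [hc] using hcp, by simpa [hc] using hopen,
      by simpa [hc] using fun j hj hjo _ => hmin j hj hjo, by simp, by simp⟩
  · rintro D ⟨i, w⟩ R s hL ⟨k1, k2, k3, k4, k5, k6⟩
    simp only [Expr.eval, hx11] at hL
    have hi : i ∈ (σ.lst 8 x).map Prod.fst := by simp [hL]
    obtain ⟨hip, hxi, hyi⟩ := (hends i).1 hi
    obtain ⟨q1, q2, q3⟩ := hpar i hi
    simp only [Cmd.eval, Expr.eval, St.tick_var, St.tick_arr, St.setVar_var, St.setVar_arr, k1]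
    simp only [Nat.reduceEqDiff, if_true, if_false]
    rw [hsize i hip.le, hsize _ k2]
    split
    · rename_i hlt
      refine ⟨by simp [k1], by simpa using k2, by simpa using k3, by simpa using k4, ?_,
        by simp; omega⟩
      intro j hj
      simp only [List.map_append, List.map_cons, List.map_nil, List.mem_append,
        List.mem_singleton] at hj
      rcases hj with hj | rfl
      · simpa using k5 j hj
      · simpa using hlt
    · rename_i hlt
      have hq : IsOpenAt p X x (σ.arr 1 i) := by
        obtain ⟨y, h1, h2⟩ := hyi
        exact .inr ⟨y, h1, q2.subset h2⟩
      have hci : X (s.var 12) ⊆ X i := by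
        by_cases hne : s.var 12 = i
        · rw [hne]
        · rcases h.comparable_open k2 hip.le hne k3 (.inr hyi) with h1 | h1
          · exact h1.subset
          · exact absurd (Finset.card_lt_card h1) hlt
      refine ⟨by simp [k1], by simpa using q1, by simpa using hq, ?_, ?_, by simp; omega⟩
      · intro j hj hjo hxj
        have hne : i ≠ j := fun e => hxi (e ▸ hxj)
        rcases h.comparable_open hip.le hj hne (.inr hyi) hjo with h1 | h1
        · simpa using q3 j hj h1
        · exact absurd (h1.subset hxj) hxi
      · intro j hj
        simp only [List.map_append, List.map_cons, List.map_nil, List.mem_append,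
          List.mem_singleton] at hj
        have h1 := Finset.card_lt_card q2
        have h2 := Finset.card_le_card hci
        rcases hj with hj | rfl
        · have := k5 j hj
          simp; omega
        · simpa using h1

/-- Opening the sets that start at `x`, by decreasing size: each becomes a child of the current set,
and then the current set. -/
theorem sweep_open_spec {σ : St} {n p x : ℕ} {X : ℕ → Finset ℕ} (h : IsLaminar n p X)
    (hx11 : σ.var 11 = x) (hcp : σ.var 12 ≤ p) (hxc : x ∈ X (σ.var 12))
    (hopen : IsOpenAt p X x (σ.var 12))
    (hmin : ∀ j ≤ p, IsOpenAt p X x j → x ∈ X j → X (σ.var 12) ⊆ X j)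
    (hstarts : ∀ i, i ∈ (σ.lst 7 x).map Prod.fst ↔ i < p ∧ x ∈ X i ∧ ∀ y, y + 1 = x → y ∉ X i)
    (hdec : ((σ.lst 7 x).map Prod.fst).Pairwise fun i j => (X j).card < (X i).card) :
    let σ' := (Cmd.forL 7 (.var 11) 3 17 (.put 1 (.var 3) (.var 12) ;; .set 12 (.var 3))).eval σ
    IsHome p X (σ'.var 12) x ∧ (∀ i ∈ (σ.lst 7 x).map Prod.fst, IsPar p X (σ'.arr 1 i) i) ∧
      (∀ i, i ∉ (σ.lst 7 x).map Prod.fst → σ'.arr 1 i = σ.arr 1 i) ∧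
      σ'.tm ≤ σ.tm + 2 + 10 * (σ.lst 7 x).length := by
  have key := forL_inv (j := 7) (e := .var 11) (x := 3) (y := 17)
    (P := .put 1 (.var 3) (.var 12) ;; .set 12 (.var 3)) (σ := σ)
    (fun D s => s.var 12 ≤ p ∧ x ∈ X (s.var 12) ∧
      (IsOpenAt p X x (s.var 12) ∨ s.var 12 ∈ D.map Prod.fst) ∧
      (∀ j ≤ p, x ∈ X j → IsOpenAt p X x j ∨ j ∈ D.map Prod.fst → X (s.var 12) ⊆ X j) ∧
      (∀ i ∈ D.map Prod.fst, IsPar p X (s.arr 1 i) i) ∧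
      (∀ i, i ∉ D.map Prod.fst → s.arr 1 i = σ.arr 1 i) ∧
      s.tm ≤ σ.tm + 2 + 10 * D.length) ?_ ?_
  · simp only [Expr.eval, hx11] at key
    obtain ⟨k1, k2, -, k4, k5, k6, k7⟩ := key
    refine ⟨⟨k1, k2, ?_⟩, k5, k6, k7⟩
    intro j hj hxj
    refine k4 j hj hxj ?_
    by_cases hjo : IsOpenAt p X x j
    · exact .inl hjo
    · refine .inr ((hstarts j).2 ⟨?_, hxj, fun y h1 h2 => hjo (.inr ⟨y, h1, h2⟩)⟩)
      exact lt_of_le_of_ne hj fun e => hjo (.inl e)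
  · exact ⟨by simpa using hcp, by simpa using hxc, .inl (by simpa using hopen),
      by simpa using fun j hj hxj hjo => hmin j hj hjo hxj, by simp, by simp, by simp⟩
  · rintro D ⟨i, w⟩ R s hL ⟨k1, k2, k3, k4, k5, k6, k7⟩
    simp only [Expr.eval, hx11] at hL
    obtain ⟨hip, hxi, hyi⟩ := (hstarts i).1 (by simp [hL])
    rw [hL, List.map_append, List.map_cons, List.pairwise_append, List.pairwise_cons] at hdec
    obtain ⟨-, ⟨hd2, -⟩, hd1⟩ := hdec
    have hiD : i ∉ D.map Prod.fst := fun hm => lt_irrefl _ (hd1 i hm i (by simp))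
    have hno : ¬ IsOpenAt p X x i := by
      rintro (h1 | ⟨y, h1, h2⟩)
      · omega
      · exact hyi y h1 h2
    have hne : i ≠ s.var 12 := by
      rintro h1
      rcases k3 with k3 | k3
      · exact hno (h1 ▸ k3)
      · exact hiD (h1 ▸ k3)
    have hic : X i ⊂ X (s.var 12) := by
      rcases h.comparable hip.le k1 hne hxi k2 with h1 | h1
      · exact h1
      · rcases k3 with (k3 | ⟨y, h2, h3⟩) | k3
        · rw [k3] at h1
          exact absurd (h.sub_root hip.le) h1.not_subset
        · exact absurd (h1.subset h3) (hyi y h2)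
        · exact absurd (hd1 _ k3 i (by simp)) (Finset.card_lt_card h1).not_gt
    have hpar : IsPar p X (s.var 12) i := by
      refine ⟨k1, hic, fun j hj hij => k4 j hj (hij.subset hxi) ?_⟩
      by_contra hcon
      rw [not_or] at hcon
      have hjp : j < p := lt_of_le_of_ne hj fun e => hcon.1 (.inl e)
      have hm := (hstarts j).2 ⟨hjp, hij.subset hxi, fun y h1 h2 => hcon.1 (.inr ⟨y, h1, h2⟩)⟩
      rw [hL, List.map_append, List.map_cons, List.mem_append, List.mem_cons] at hm
      rcases hm with hm | rfl | hm
      · exact hcon.2 hm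
      · exact hij.ne rfl
      · exact absurd (hd2 j hm) (Finset.card_lt_card hij).not_gt
    have hmem : ∀ j, j ∈ (D ++ [(i, w)]).map Prod.fst ↔ j ∈ D.map Prod.fst ∨ j = i := by simp
    refine ⟨?_, ?_, ?_, ?_, ?_, ?_, ?_⟩
    · simpa [Cmd.eval] using hip.le
    · simpa [Cmd.eval] using hxi
    · right; simp [Cmd.eval]
    · intro j hj hxj hjo
      have : X i ⊆ X j := by
        rw [hmem] at hjo
        rcases hjo with hjo | hjo | rfl
        · exact hic.subset.trans (k4 j hj hxj (.inl hjo))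
        · exact hic.subset.trans (k4 j hj hxj (.inr hjo))
        · exact subset_rfl
      simpa [Cmd.eval] using this
    · intro j hj
      rw [hmem] at hj
      by_cases hji : j = i
      · subst hji
        simpa [Cmd.eval] using hpar
      · have := k5 j (hj.resolve_right hji)
        simpa [Cmd.eval, hji] using this
    · intro j hj
      rw [hmem, not_or] at hj
      have := k6 j hj.1
      simpa [Cmd.eval, hj.2] using this
    · simp [Cmd.eval]; omega

/-- When the sweep arrives at `x`, the current set is the smallest open one. The parent of a set is
found when its first interval is opened, and found again, with the same result, at each further
interval. -/
theorem sweep_spec {σ : St} {n p : ℕ} {X : ℕ → Finset ℕ} (h : IsLaminar n p X)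
    (hn : σ.var 0 = n) (hp : σ.var 2 = p) (h9 : σ.lst 9 = fun _ => [])
    (hne : ∀ i < p, (X i).Nonempty)
    (hsize : ∀ i ≤ p, σ.arr 0 i = (X i).card)
    (hstarts : ∀ x i, i ∈ (σ.lst 7 x).map Prod.fst ↔
      i < p ∧ x ∈ X i ∧ ∀ y, y + 1 = x → y ∉ X i)
    (hdec : ∀ x, ((σ.lst 7 x).map Prod.fst).Pairwise fun i j => (X j).card < (X i).card)
    (hends : ∀ x i, i ∈ (σ.lst 8 x).map Prod.fst ↔
      i < p ∧ x ∉ X i ∧ ∃ y, y + 1 = x ∧ y ∈ X i) :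
    let σ' := sweep.eval σ
    (∀ i < p, IsPar p X (σ'.arr 1 i) i) ∧ (∀ x < n, IsHome p X (σ'.arr 2 x) x) ∧
      (∀ t, ((σ'.lst 9 t).map Prod.fst).Nodup) ∧
      (∀ t x, x ∈ (σ'.lst 9 t).map Prod.fst ↔ x < n ∧ σ'.arr 2 x = t) ∧
      σ'.tm ≤ σ.tm + 10 + 20 * n + 10 * ∑ x ∈ Finset.range n, (σ.lst 8 x).length +
        10 * ∑ x ∈ Finset.range n, (σ.lst 7 x).length := by
  obtain ⟨s1, hs1⟩ : ∃ s1, s1 = (Cmd.set 12 (.var 2)).eval σ := ⟨_, rfl⟩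
  have a0 : s1.var 0 = n := by simp [hs1, Cmd.eval, hn]
  have a12 : s1.var 12 = p := by simp [hs1, Cmd.eval, hp]
  have al : s1.lst = σ.lst := by simp [hs1, Cmd.eval]
  have aa : s1.arr = σ.arr := by simp [hs1, Cmd.eval]
  have at1 : s1.tm = σ.tm + 2 := by simp [hs1, Cmd.eval]
  obtain ⟨c1, hc1⟩ : ∃ c, c = Cmd.forL 8 (.var 11) 3 17
      (.ite (.get 0 (.var 3)) (.get 0 (.var 12)) .skip (.set 12 (.get 1 (.var 3)))) := ⟨_, rfl⟩
  obtain ⟨c2, hc2⟩ : ∃ c, c = Cmd.forL 7 (.var 11) 3 17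
    (.put 1 (.var 3) (.var 12) ;; .set 12 (.var 3)) := ⟨_, rfl⟩
  have key := forN_inv (x := 11) (e := .var 0)
    (P := c1 ;; c2 ;; .put 2 (.var 11) (.var 12) ;; .push 9 (.var 12) (.var 11) .zero)
    (σ := s1) (fun x s => s.var 12 ≤ p ∧ IsOpenAt p X x (s.var 12) ∧
      (∀ j ≤ p, IsOpenAt p X x j → X (s.var 12) ⊆ X j) ∧
      s.lst 7 = σ.lst 7 ∧ s.lst 8 = σ.lst 8 ∧ s.arr 0 = σ.arr 0 ∧
      (∀ i < p, (∃ y < x, y ∈ X i) → IsPar p X (s.arr 1 i) i) ∧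
      (∀ y < x, IsHome p X (s.arr 2 y) y) ∧
      (∀ t, ((s.lst 9 t).map Prod.fst).Nodup) ∧
      (∀ t y, y ∈ (s.lst 9 t).map Prod.fst ↔ y < x ∧ s.arr 2 y = t) ∧
      s.tm ≤ σ.tm + 10 + 20 * x + 10 * ∑ y ∈ Finset.range x, (σ.lst 8 y).length +
        10 * ∑ y ∈ Finset.range x, (σ.lst 7 y).length) ?_ ?_
  · simp only [Expr.eval, a0] at key
    have hev : sweep.eval σ = (Cmd.forN 11 (.var 0) (c1 ;; c2 ;; .put 2 (.var 11) (.var 12) ;;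
        .push 9 (.var 12) (.var 11) .zero)).eval s1 := by
      rw [hs1, hc1, hc2]; rfl
    rw [← hev] at key
    obtain ⟨-, -, -, -, -, -, k7, k8, k9, k10, k11⟩ := key
    refine ⟨fun i hi => k7 i hi ?_, k8, k9, k10, k11⟩
    obtain ⟨y, hy⟩ := hne i hi
    exact ⟨y, Finset.mem_range.1 ((h.sub i hi).subset hy), hy⟩
  · refine ⟨by simp [a12], .inl (by simp [a12]), ?_, by simp [al], by simp [al], by simp [aa],
      by simp, by simp, by simp [al, h9], by simp [al, h9], by simp; omega⟩
    rintro j hj (rfl | ⟨y, hy, -⟩)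
    · simp [a12]
    · omega
  · rintro x s hx ⟨k1, k2, k3, k4, k5, k6, k7, k8, k9, k10, k11⟩
    simp only [Expr.eval, a0] at hx
    obtain ⟨t0, ht0⟩ : ∃ t, t = (s.setVar 11 x).tick 1 := ⟨_, rfl⟩
    obtain ⟨t1, ht1⟩ : ∃ t, t = c1.eval t0 := ⟨_, rfl⟩
    obtain ⟨t2, ht2⟩ : ∃ t, t = c2.eval t1 := ⟨_, rfl⟩
    have hfin : (c1 ;; c2 ;; .put 2 (.var 11) (.var 12) ;; .push 9 (.var 12) (.var 11) .zero).eval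
        ((s.setVar 11 x).tick 1) = (Cmd.push 9 (.var 12) (.var 11) .zero).eval
        ((Cmd.put 2 (.var 11) (.var 12)).eval t2) := by
      rw [ht2, ht1, ht0]; rfl
    have v0 : t0.var 12 = s.var 12 ∧ t0.var 11 = x ∧ t0.arr = s.arr ∧ t0.lst = s.lst ∧
      t0.tm = s.tm + 1 := by simp [ht0]
    obtain ⟨v1, v2, v3, v4, v5⟩ := v0
    have close := sweep_close_spec (σ := t0) h hx v2 v1 k1 k2 k3 (by rw [v3, k6]; exact hsize)
      (by rw [v4, k5]; exact hends x) (by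
        rw [v4, v3, k5]
        intro i hi
        obtain ⟨h1, h2, y, h3, h4⟩ := (hends x i).1 hi
        exact k7 i h1 ⟨y, by omega, h4⟩)
    rw [← hc1, ← ht1] at close
    obtain ⟨b1, b2, b3, b4, b5⟩ := close
    have e1 : t1.lst = s.lst := by
      rw [ht1, hc1, ← v4]; funext j; exact Cmd.eval_lst (by simp [Cmd.wl])
    have e2 : t1.arr = s.arr := by
      rw [ht1, hc1, ← v3]; funext j; exact Cmd.eval_arr (by simp [Cmd.wa])
    have e3 : t1.var 11 = x := by
      rw [ht1, hc1, Cmd.eval_var (by simp [Cmd.wv]), v2]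
    have opn := sweep_open_spec (σ := t1) h e3 b1 b2 b3 b4 (by rw [e1, k4]; exact hstarts x)
      (by rw [e1, k4]; exact hdec x)
    rw [← hc2, ← ht2] at opn
    obtain ⟨d1, d2, d3, d4⟩ := opn
    have f1 : t2.lst = s.lst := by
      rw [ht2, hc2, ← e1]; funext j; exact Cmd.eval_lst (by simp [Cmd.wl])
    have f2 : ∀ j, j ≠ 1 → t2.arr j = s.arr j := by
      intro j hj
      rw [ht2, hc2, ← e2]; exact Cmd.eval_arr (by simp [Cmd.wa, hj])
    have f3 : t2.var 11 = x := by
      rw [ht2, hc2, Cmd.eval_var (by simp [Cmd.wv]), e3]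
    rw [hfin]
    have hcur : ((Cmd.push 9 (.var 12) (.var 11) .zero).eval
        ((Cmd.put 2 (.var 11) (.var 12)).eval t2)).var 12 = t2.var 12 := by simp [Cmd.eval]
    have harr1 : ((Cmd.push 9 (.var 12) (.var 11) .zero).eval
        ((Cmd.put 2 (.var 11) (.var 12)).eval t2)).arr 1 = t2.arr 1 := by simp [Cmd.eval]
    have harr2 : ((Cmd.push 9 (.var 12) (.var 11) .zero).eval
        ((Cmd.put 2 (.var 11) (.var 12)).eval t2)).arr 2 =
        Function.update (s.arr 2) x (t2.var 12) := by simp [Cmd.eval, f3, f2 2 (by decide)]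
    have hlst9 : ((Cmd.push 9 (.var 12) (.var 11) .zero).eval
        ((Cmd.put 2 (.var 11) (.var 12)).eval t2)).lst 9 =
        Function.update (s.lst 9) (t2.var 12) ((x, 0) :: s.lst 9 (t2.var 12)) := by
      simp [Cmd.eval, f3, f1]
    rw [hcur, harr1, harr2, hlst9]
    have hxn : ∀ t, x ∉ (s.lst 9 t).map Prod.fst := fun t hm => by
      rw [k10] at hm; omega
    refine ⟨d1.1, .inr ⟨x, rfl, d1.2.1⟩, ?_, by simp [Cmd.eval, f1, k4], by simp [Cmd.eval, f1, k5],
      by simp [Cmd.eval, f2 0 (by decide), k6], ?_, ?_, ?_, ?_, ?_⟩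
    · rintro j hj (rfl | ⟨y, hy, hyj⟩)
      · exact h.sub_root d1.1
      · obtain rfl : y = x := by omega
        exact d1.2.2 j hj hyj
    · rintro i hi ⟨y, hy, hyi⟩
      by_cases him : i ∈ (t1.lst 7 x).map Prod.fst
      · exact d2 i him
      · rw [d3 i him, e2]
        refine k7 i hi ?_
        by_contra hcon
        rw [e1, k4, hstarts] at him
        refine him ⟨hi, ?_, fun z hz hzi => hcon ⟨z, by omega, hzi⟩⟩
        by_cases hyx : y = x
        · exact hyx ▸ hyi
        · exact absurd ⟨y, by omega, hyi⟩ hcon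
    · intro y hy
      by_cases hyx : y = x
      · subst hyx; simpa using d1
      · rw [Function.update_of_ne hyx]; exact k8 y (by omega)
    · intro t
      by_cases ht : t = t2.var 12
      · subst ht
        rw [Function.update_self, List.map_cons, List.nodup_cons]
        exact ⟨hxn _, k9 _⟩
      · rw [Function.update_of_ne ht]; exact k9 t
    · intro t y
      have hold := k10 t y
      by_cases hyx : y = x
      · subst hyx
        rw [Function.update_self]
        by_cases ht : t = t2.var 12
        · subst ht; simp
        · rw [Function.update_of_ne ht]
          exact ⟨fun hm => absurd hm (hxn t), fun hm => absurd hm.2.symm ht⟩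
      · rw [Function.update_of_ne hyx]
        have hlt : y < x + 1 ↔ y < x := by omega
        rw [hlt, ← hold]
        by_cases ht : t = t2.var 12
        · subst ht; simp [hyx]
        · rw [Function.update_of_ne ht]
    · rw [Finset.sum_range_succ, Finset.sum_range_succ]
      rw [v4, k5, v5] at b5
      rw [e1, k4] at d4
      simp [Cmd.eval]
      omega

end RamLang

/-! ### Separators and torsos -/

namespace RamLang

theorem mem_map_update_cons {L : ℕ → List (ℕ × ℕ)} {a u v : ℕ} {e : ℕ × ℕ} :
    v ∈ (Function.update L a (e :: L a) u).map Prod.fst ↔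
      v ∈ (L u).map Prod.fst ∨ u = a ∧ v = e.1 := by
  by_cases hu : u = a
  · subst hu; simp [or_comm]
  · simp [hu]

theorem nodup_map_update_cons {L : ℕ → List (ℕ × ℕ)} {a : ℕ} {e : ℕ × ℕ}
    (h : ∀ u, ((L u).map Prod.fst).Nodup) (he : e.1 ∉ (L a).map Prod.fst) (u : ℕ) :
    ((Function.update L a (e :: L a) u).map Prod.fst).Nodup := by
  by_cases hu : u = a
  · subst hu
    rw [Function.update_self, List.map_cons, List.nodup_cons]
    exact ⟨he, h u⟩
  · rw [Function.update_of_ne hu]; exact h u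

theorem mem_update_cons {L : ℕ → List (ℕ × ℕ)} {a u : ℕ} {e f : ℕ × ℕ} :
    f ∈ Function.update L a (e :: L a) u ↔ f ∈ L u ∨ u = a ∧ f = e := by
  by_cases hu : u = a
  · subst hu; simp [or_comm]
  · simp [hu]

theorem nodup_update_cons {L : ℕ → List (ℕ × ℕ)} {a : ℕ} {e : ℕ × ℕ}
    (h : ∀ u, (L u).Nodup) (he : e ∉ L a) (u : ℕ) :
    (Function.update L a (e :: L a) u).Nodup := by
  by_cases hu : u = a
  · subst hu
    rw [Function.update_self, List.nodup_cons]
    exact ⟨he, h u⟩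
  · rw [Function.update_of_ne hu]; exact h u

/-- The pairs of the separator number `i` with the smaller element `u`. -/
theorem fill_row_spec {σ : St} {i u : ℕ} (hi : σ.var 3 = i) (hu : σ.var 4 = u)
    (hnd : ((σ.lst 4 i).map Prod.fst).Nodup) (h10 : ∀ t, (σ.lst 10 t).Nodup)
    (hold : ∀ e ∈ σ.lst 10 i, e.1 ≠ u) :
    let σ' := (Cmd.forL 4 (.var 3) 5 17 (.ite (.var 4) (.var 5)
      (.push 1 (.var 4) (.var 5) .zero ;; .push 10 (.var 3) (.var 4) (.var 5)) .skip)).eval σ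
    (∀ a v, v ∈ (σ'.lst 1 a).map Prod.fst ↔
      v ∈ (σ.lst 1 a).map Prod.fst ∨ a = u ∧ v ∈ (σ.lst 4 i).map Prod.fst ∧ u < v) ∧
    (∀ t, (σ'.lst 10 t).Nodup) ∧
    (∀ t e, e ∈ σ'.lst 10 t ↔
      e ∈ σ.lst 10 t ∨ t = i ∧ e.1 = u ∧ e.2 ∈ (σ.lst 4 i).map Prod.fst ∧ u < e.2) ∧
    σ'.tm ≤ σ.tm + 2 + 12 * (σ.lst 4 i).length := by
  have key := forL_inv (j := 4) (e := .var 3) (x := 5) (y := 17)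
    (P := .ite (.var 4) (.var 5)
      (.push 1 (.var 4) (.var 5) .zero ;; .push 10 (.var 3) (.var 4) (.var 5)) .skip) (σ := σ)
    (fun D s => s.var 3 = i ∧ s.var 4 = u ∧
      (∀ a v, v ∈ (s.lst 1 a).map Prod.fst ↔
        v ∈ (σ.lst 1 a).map Prod.fst ∨ a = u ∧ v ∈ D.map Prod.fst ∧ u < v) ∧
      (∀ t, (s.lst 10 t).Nodup) ∧
      (∀ t e, e ∈ s.lst 10 t ↔
        e ∈ σ.lst 10 t ∨ t = i ∧ e.1 = u ∧ e.2 ∈ D.map Prod.fst ∧ u < e.2) ∧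
      s.tm ≤ σ.tm + 2 + 12 * D.length) ?_ ?_
  · simp only [Expr.eval, hi] at key
    obtain ⟨-, -, k⟩ := key
    exact k
  · exact ⟨by simpa using hi, by simpa using hu, by simp, by simpa using h10, by simp, by simp⟩
  · rintro D ⟨v, w⟩ R s hL ⟨k1, k2, k3, k4, k5, k6⟩
    simp only [Expr.eval, hi] at hL
    have hv : v ∉ D.map Prod.fst := by
      rw [hL, List.map_append, List.map_cons, List.nodup_append] at hnd
      exact fun hm => hnd.2.2 v hm v (by simp) rfl
    have hmem : ∀ j, j ∈ (D ++ [(v, w)]).map Prod.fst ↔ j ∈ D.map Prod.fst ∨ j = v := by simp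
    simp only [Cmd.eval, Expr.eval, St.tick_var, St.setVar_var, k1, k2, St.tick_lst, St.cons_lst,
      St.setVar_lst, St.cons_var]
    simp only [Nat.reduceEqDiff, Fin.reduceEq, if_true, if_false]
    split
    · rename_i huv
      refine ⟨by simp [k1], by simp [k2], ?_, ?_, ?_, by simp; omega⟩
      · intro a x
        simp only [St.tick_lst, St.cons_lst, St.setVar_lst, Fin.reduceEq, if_true, if_false,
          mem_map_update_cons, k3, hmem]
        grind
      · simp only [St.tick_lst, St.cons_lst, St.setVar_lst, Fin.reduceEq, if_true, if_false]
        refine nodup_update_cons k4 ?_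
        rw [k5]
        rintro (h1 | h1)
        · exact hold _ h1 rfl
        · exact hv h1.2.2.1
      · intro t e
        simp only [St.tick_lst, St.cons_lst, St.setVar_lst, Fin.reduceEq, if_true, if_false,
          mem_update_cons, k5, hmem, Prod.ext_iff]
        grind
    · rename_i huv
      refine ⟨by simp [k1], by simp [k2], ?_, by simpa using k4, ?_, by simp; omega⟩
      · intro a x
        simp only [St.tick_lst, St.setVar_lst, k3, hmem]
        grind
      · intro t e
        simp only [St.tick_lst, St.setVar_lst, k5, hmem]
        grind

/-- Each separator of size at most `k` contributes at most `k ^ 2` pairs. -/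
theorem fill_spec {σ : St} {p k : ℕ} (hp : σ.var 2 = p) (h10 : σ.lst 10 = fun _ => [])
    (hk : ∀ i < p, (σ.lst 4 i).length ≤ k) (hnd : ∀ i < p, ((σ.lst 4 i).map Prod.fst).Nodup)
    (h9 : ∀ t, ((σ.lst 9 t).map Prod.fst).Nodup)
    (hdisj : ∀ i < p, ∀ v ∈ (σ.lst 4 i).map Prod.fst, v ∉ (σ.lst 9 i).map Prod.fst) :
    let σ' := fill.eval σ
    (∀ t, ((σ'.lst 9 t).map Prod.fst).Nodup) ∧
    (∀ t v, v ∈ (σ'.lst 9 t).map Prod.fst ↔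
      v ∈ (σ.lst 9 t).map Prod.fst ∨ t < p ∧ v ∈ (σ.lst 4 t).map Prod.fst) ∧
    (∀ u v, v ∈ (σ'.lst 1 u).map Prod.fst ↔ v ∈ (σ.lst 1 u).map Prod.fst ∨
      ∃ i < p, u ∈ (σ.lst 4 i).map Prod.fst ∧ v ∈ (σ.lst 4 i).map Prod.fst ∧ u < v) ∧
    (∀ t, (σ'.lst 10 t).Nodup) ∧
    (∀ t e, e ∈ σ'.lst 10 t ↔
      t < p ∧ e.1 ∈ (σ.lst 4 t).map Prod.fst ∧ e.2 ∈ (σ.lst 4 t).map Prod.fst ∧ e.1 < e.2) ∧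
    σ'.tm ≤ σ.tm + 2 + p * (3 + k * (7 + 12 * k)) := by
  obtain ⟨row, hrow⟩ : ∃ c, c = Cmd.forL 4 (.var 3) 5 17 (.ite (.var 4) (.var 5)
      (.push 1 (.var 4) (.var 5) .zero ;; .push 10 (.var 3) (.var 4) (.var 5)) .skip) := ⟨_, rfl⟩
  have key := forN_inv (x := 3) (e := .var 2)
    (P := .forL 4 (.var 3) 4 17 (.push 9 (.var 3) (.var 4) .zero ;; row)) (σ := σ)
    (fun i s => s.lst 4 = σ.lst 4 ∧ (∀ t, ((s.lst 9 t).map Prod.fst).Nodup) ∧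
      (∀ t v, v ∈ (s.lst 9 t).map Prod.fst ↔
        v ∈ (σ.lst 9 t).map Prod.fst ∨ t < i ∧ v ∈ (σ.lst 4 t).map Prod.fst) ∧
      (∀ u v, v ∈ (s.lst 1 u).map Prod.fst ↔ v ∈ (σ.lst 1 u).map Prod.fst ∨
        ∃ t < i, u ∈ (σ.lst 4 t).map Prod.fst ∧ v ∈ (σ.lst 4 t).map Prod.fst ∧ u < v) ∧
      (∀ t, (s.lst 10 t).Nodup) ∧
      (∀ t e, e ∈ s.lst 10 t ↔
        t < i ∧ e.1 ∈ (σ.lst 4 t).map Prod.fst ∧ e.2 ∈ (σ.lst 4 t).map Prod.fst ∧ e.1 < e.2) ∧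
      s.tm ≤ σ.tm + 2 + i * (3 + k * (7 + 12 * k))) ?_ ?_
  · simp only [Expr.eval, hp] at key
    rw [hrow] at key
    exact key.2
  · exact ⟨by simp, by simpa using h9, by simp, by simp, by simp [h10], by simp [h10], by simp⟩
  · rintro i s hi ⟨k1, k2, k3, k4, k5, k6, k7⟩
    simp only [Expr.eval, hp] at hi
    have inner := forL_inv (j := 4) (e := .var 3) (x := 4) (y := 17)
      (P := .push 9 (.var 3) (.var 4) .zero ;; row) (σ := (s.setVar 3 i).tick 1)
      (fun D t => t.var 3 = i ∧ t.lst 4 = σ.lst 4 ∧ (∀ r, ((t.lst 9 r).map Prod.fst).Nodup) ∧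
        (∀ r v, v ∈ (t.lst 9 r).map Prod.fst ↔
          v ∈ (s.lst 9 r).map Prod.fst ∨ r = i ∧ v ∈ D.map Prod.fst) ∧
        (∀ u v, v ∈ (t.lst 1 u).map Prod.fst ↔ v ∈ (s.lst 1 u).map Prod.fst ∨
          u ∈ D.map Prod.fst ∧ v ∈ (σ.lst 4 i).map Prod.fst ∧ u < v) ∧
        (∀ r, (t.lst 10 r).Nodup) ∧
        (∀ r e, e ∈ t.lst 10 r ↔ e ∈ s.lst 10 r ∨ r = i ∧
          e.1 ∈ D.map Prod.fst ∧ e.2 ∈ (σ.lst 4 i).map Prod.fst ∧ e.1 < e.2) ∧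
        t.tm ≤ s.tm + 3 + D.length * (7 + 12 * k)) ?_ ?_
    · have hU : ((s.setVar 3 i).tick 1).lst 4 ((Expr.var 3).eval ((s.setVar 3 i).tick 1)) =
          σ.lst 4 i := by simp [k1]
      rw [hU] at inner
      obtain ⟨-, i2, i3, i4, i5, i6, i7, i8⟩ := inner
      refine ⟨i2, i3, ?_, ?_, i6, ?_, ?_⟩
      · intro t v
        rw [i4, k3, Nat.lt_succ_iff_lt_or_eq, or_and_right, or_assoc]
        refine or_congr_right (or_congr_right ?_)
        constructor <;> rintro ⟨rfl, h⟩ <;> exact ⟨rfl, h⟩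
      · intro u v
        rw [i5, k4, or_assoc]
        refine or_congr_right ?_
        constructor
        · rintro (⟨t, h1, h2⟩ | h1)
          · exact ⟨t, by omega, h2⟩
          · exact ⟨i, by omega, h1⟩
        · rintro ⟨t, h1, h2⟩
          rcases Nat.lt_succ_iff_lt_or_eq.1 h1 with h1 | rfl
          · exact .inl ⟨t, h1, h2⟩
          · exact .inr h2
      · intro t e
        rw [i7, k6, Nat.lt_succ_iff_lt_or_eq, or_and_right]
        refine or_congr_right ?_
        constructor <;> rintro ⟨rfl, h⟩ <;> exact ⟨rfl, h⟩
      · have := Nat.mul_le_mul_right (7 + 12 * k) (hk i hi)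
        rw [Nat.add_mul, Nat.one_mul]
        omega
    · refine ⟨by simp, by simpa using k1, by simpa using k2, by simp, by simp, by simpa using k5,
        by simp, by simp⟩
    · rintro D ⟨u, w⟩ R t hL ⟨i1, i2, i3, i4, i5, i6, i7, i8⟩
      have hU : ((s.setVar 3 i).tick 1).lst 4 ((Expr.var 3).eval ((s.setVar 3 i).tick 1)) =
          σ.lst 4 i := by simp [k1]
      rw [hU] at hL
      have hu : u ∉ D.map Prod.fst := by
        have hd := hnd i hi
        rw [hL, List.map_append, List.map_cons, List.nodup_append] at hd
        exact fun hm => hd.2.2 u hm u (by simp) rfl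
      have hui : u ∈ (σ.lst 4 i).map Prod.fst := by simp [hL]
      have hmem : ∀ j, j ∈ (D ++ [(u, w)]).map Prod.fst ↔ j ∈ D.map Prod.fst ∨ j = u := by simp
      obtain ⟨t1, ht1⟩ : ∃ t1, t1 = (Cmd.push 9 (.var 3) (.var 4) .zero).eval
        (((t.setVar 4 u).setVar 17 w).tick 1) := ⟨_, rfl⟩
      have b3 : t1.var 3 = i := by simp [ht1, Cmd.eval, i1]
      have b4 : t1.var 4 = u := by simp [ht1, Cmd.eval]
      have bl : ∀ j, j ≠ 9 → t1.lst j = t.lst j := fun j hj => by simp [ht1, Cmd.eval, hj]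
      have b9 : t1.lst 9 = Function.update (t.lst 9) i ((u, 0) :: t.lst 9 i) := by
        simp [ht1, Cmd.eval, i1]
      have bt : t1.tm = t.tm + 5 := by simp [ht1, Cmd.eval]
      have hr := fill_row_spec b3 b4 (by rw [bl 4 (by decide), i2]; exact hnd i hi)
        (by rw [bl 10 (by decide)]; exact i6) (by
          rw [bl 10 (by decide)]
          rintro e he rfl
          rw [i7, k6] at he
          rcases he with he | he
          · omega
          · exact hu he.2.1)
      have hfr : ∀ j, j ≠ 1 → j ≠ 10 → (row.eval t1).lst j = t1.lst j := fun j h1 h10 => by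
        rw [hrow, Cmd.eval_lst (by simp [Cmd.wl, h1, h10])]
      have hv3 : (row.eval t1).var 3 = i := by
        rw [hrow, Cmd.eval_var (by simp [Cmd.wv]), b3]
      rw [← hrow, bl 4 (by decide), bl 1 (by decide), bl 10 (by decide), i2] at hr
      obtain ⟨r1, r2, r3, r4⟩ := hr
      have hfin : (Cmd.push 9 (.var 3) (.var 4) .zero ;; row).eval
        (((t.setVar 4 (u, w).1).setVar 17 (u, w).2).tick 1) = row.eval t1 := by rw [ht1]; rfl
      rw [hfin]
      refine ⟨hv3, by rw [hfr 4 (by decide) (by decide), bl 4 (by decide), i2], ?_, ?_, ?_, r2, ?_,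
        ?_⟩
      · rw [hfr 9 (by decide) (by decide), b9]
        refine nodup_map_update_cons i3 ?_
        rw [i4, k3]
        rintro ((h1 | h1) | h1)
        · exact hdisj i hi u hui h1
        · omega
        · exact hu h1.2
      · intro r v
        rw [hfr 9 (by decide) (by decide), b9, mem_map_update_cons, i4, hmem]
        tauto
      · intro a v
        rw [r1, i5, hmem]
        grind
      · intro r e
        rw [r3, i7, hmem]
        grind
      · have := hk i hi
        rw [List.length_append, List.length_singleton, Nat.add_mul, Nat.one_mul]
        omega

/-- The array-level form of `Laminar.top`. -/
def topNode (size home : ℕ → ℕ) (u v : ℕ) : ℕ :=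
  if size (home u) < size (home v) then home u else home v

/-- The edges with smaller end `u`. A vertex with the mark `u + 1` has been met already, and marks
left by smaller vertices are at most `u`. By `hold`, the new edges of a torso are not among the
pairs in its own separator. -/
theorem distribute_row_spec {σ : St} {u : ℕ} (hu : σ.var 4 = u) (hmark : ∀ a, σ.arr 3 a ≤ u)
    (h10 : ∀ t, (σ.lst 10 t).Nodup)
    (hold : ∀ v t, (u, v) ∈ σ.lst 10 t → topNode (σ.arr 0) (σ.arr 2) u v ≠ t) :
    let σ' := (Cmd.forL 1 (.var 4) 5 17 (.ite (.get 3 (.var 5)) (.succ (.var 4))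
      (.put 3 (.var 5) (.succ (.var 4)) ;;
        .ite (.get 0 (.get 2 (.var 4))) (.get 0 (.get 2 (.var 5)))
          (.push 10 (.get 2 (.var 4)) (.var 4) (.var 5))
          (.push 10 (.get 2 (.var 5)) (.var 4) (.var 5)))
      .skip)).eval σ
    (∀ a, σ'.arr 3 a ≤ u + 1) ∧ (∀ t, (σ'.lst 10 t).Nodup) ∧
    (∀ t e, e ∈ σ'.lst 10 t ↔ e ∈ σ.lst 10 t ∨ e.1 = u ∧ e.2 ∈ (σ.lst 1 u).map Prod.fst ∧
      topNode (σ.arr 0) (σ.arr 2) u e.2 = t) ∧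
    σ'.tm ≤ σ.tm + 2 + 25 * (σ.lst 1 u).length := by
  have key := forL_inv (j := 1) (e := .var 4) (x := 5) (y := 17)
    (P := .ite (.get 3 (.var 5)) (.succ (.var 4))
      (.put 3 (.var 5) (.succ (.var 4)) ;;
        .ite (.get 0 (.get 2 (.var 4))) (.get 0 (.get 2 (.var 5)))
          (.push 10 (.get 2 (.var 4)) (.var 4) (.var 5))
          (.push 10 (.get 2 (.var 5)) (.var 4) (.var 5)))
      .skip) (σ := σ)
    (fun D s => s.var 4 = u ∧ s.arr 0 = σ.arr 0 ∧ s.arr 2 = σ.arr 2 ∧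
      (∀ a, s.arr 3 a ≤ u + 1) ∧ (∀ a, s.arr 3 a = u + 1 ↔ a ∈ D.map Prod.fst) ∧
      (∀ t, (s.lst 10 t).Nodup) ∧
      (∀ t e, e ∈ s.lst 10 t ↔ e ∈ σ.lst 10 t ∨ e.1 = u ∧ e.2 ∈ D.map Prod.fst ∧
        topNode (σ.arr 0) (σ.arr 2) u e.2 = t) ∧
      s.tm ≤ σ.tm + 2 + 25 * D.length) ?_ ?_
  · simp only [Expr.eval, hu] at key
    obtain ⟨-, -, -, k1, -, k⟩ := key
    exact ⟨k1, k⟩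
  · refine ⟨by simpa using hu, by simp, by simp, ?_, ?_, by simpa using h10, by simp, by simp⟩
    · intro a; have := hmark a; simp; omega
    · intro a; have := hmark a; simp; omega
  · rintro D ⟨v, w⟩ R s - ⟨k1, k2, k3, k4, k5, k6, k7, k8⟩
    have hmem : ∀ j, j ∈ (D ++ [(v, w)]).map Prod.fst ↔ j ∈ D.map Prod.fst ∨ j = v := by simp
    by_cases hv : v ∈ D.map Prod.fst
    · have hm := (k5 v).2 hv
      have hev : (Cmd.ite (.get 3 (.var 5)) (.succ (.var 4))
        (.put 3 (.var 5) (.succ (.var 4)) ;;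
          .ite (.get 0 (.get 2 (.var 4))) (.get 0 (.get 2 (.var 5)))
            (.push 10 (.get 2 (.var 4)) (.var 4) (.var 5))
            (.push 10 (.get 2 (.var 5)) (.var 4) (.var 5)))
        .skip).eval (((s.setVar 5 v).setVar 17 w).tick 1) =
        ((((s.setVar 5 v).setVar 17 w).tick 1).tick 5).tick 1 := by
        simp [Cmd.eval, k1, hm]
      have hmem' : ∀ j, j ∈ (D ++ [(v, w)]).map Prod.fst ↔ j ∈ D.map Prod.fst := by
        intro j; rw [hmem]; exact ⟨fun h => h.elim id fun h => h ▸ hv, .inl⟩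
      rw [hev]
      refine ⟨by simp [k1], by simp [k2], by simp [k3], by simpa using k4, ?_, by simpa using k6,
        ?_, by simp; omega⟩
      · intro a; rw [hmem', ← k5]; rfl
      · intro t e; rw [hmem', ← k7]; rfl
    · have hm : s.arr 3 v < u + 1 := lt_of_le_of_ne (k4 v) fun e => hv ((k5 v).1 e)
      obtain ⟨r, hr⟩ : ∃ r, r = topNode (σ.arr 0) (σ.arr 2) u v := ⟨_, rfl⟩
      obtain ⟨s', hs'⟩ : ∃ s', s' = (Cmd.ite (.get 3 (.var 5)) (.succ (.var 4))
        (.put 3 (.var 5) (.succ (.var 4)) ;;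
          .ite (.get 0 (.get 2 (.var 4))) (.get 0 (.get 2 (.var 5)))
            (.push 10 (.get 2 (.var 4)) (.var 4) (.var 5))
            (.push 10 (.get 2 (.var 5)) (.var 4) (.var 5)))
        .skip).eval (((s.setVar 5 v).setVar 17 w).tick 1) := ⟨_, rfl⟩
      have hs : s'.var 4 = u ∧ s'.arr 0 = σ.arr 0 ∧ s'.arr 2 = σ.arr 2 ∧
          s'.arr 3 = Function.update (s.arr 3) v (u + 1) ∧
          s'.lst 10 = Function.update (s.lst 10) r ((u, v) :: s.lst 10 r) ∧
          s'.tm ≤ s.tm + 25 := by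
        rw [hs', hr, topNode]
        simp only [Cmd.eval, Expr.eval, St.tick_var, St.setVar_var, St.tick_arr, St.setVar_arr,
          St.setArr_var, St.setArr_arr, k1, k2, k3]
        simp only [Nat.reduceEqDiff, Fin.reduceEq, if_true, if_false, hm]
        split <;> simp [k1, k2, k3]
      obtain ⟨c1, c2, c3, c4, c5, c6⟩ := hs
      rw [← hs']
      refine ⟨c1, c2, c3, ?_, ?_, ?_, ?_, by simp; omega⟩
      · intro a
        rw [c4, Function.update_apply]
        split
        · exact le_rfl
        · exact k4 a
      · intro a
        rw [c4, Function.update_apply, hmem]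
        split
        · rename_i h; simp [h]
        · rename_i h; simp only [k5, h, or_false]
      · rw [c5]
        refine nodup_update_cons k6 ?_
        rw [k7]
        rintro (h1 | h1)
        · exact hold v r h1 hr.symm
        · exact hv h1.2.1
      · intro t e
        rw [c5, mem_update_cons, k7, hmem, Prod.ext_iff, or_assoc]
        refine or_congr_right ?_
        constructor
        · rintro (⟨h1, h2, h3⟩ | ⟨rfl, h1, h2⟩)
          · exact ⟨h1, .inl h2, h3⟩
          · exact ⟨h1, .inr h2, by rw [h2, hr]⟩
        · rintro ⟨h1, h2 | h2, h3⟩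
          · exact .inl ⟨h1, h2, h3⟩
          · exact .inr ⟨by rw [← h3, h2, hr], h1, h2⟩

/-- Each edge is added to one torso, whatever its number of occurrences in the lists; the time is
bounded by the total length of these lists. -/
theorem distribute_spec {σ : St} {n : ℕ} (hn : σ.var 0 = n) (hmark : ∀ a, σ.arr 3 a = 0)
    (h10 : ∀ t, (σ.lst 10 t).Nodup)
    (hold : ∀ u v t, (u, v) ∈ σ.lst 10 t → topNode (σ.arr 0) (σ.arr 2) u v ≠ t) :
    let σ' := distribute.eval σ
    (∀ t, (σ'.lst 10 t).Nodup) ∧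
    (∀ t e, e ∈ σ'.lst 10 t ↔ e ∈ σ.lst 10 t ∨ e.1 < n ∧ e.2 ∈ (σ.lst 1 e.1).map Prod.fst ∧
      topNode (σ.arr 0) (σ.arr 2) e.1 e.2 = t) ∧
    σ'.tm ≤ σ.tm + 2 + 5 * n + 25 * ∑ u ∈ Finset.range n, (σ.lst 1 u).length := by
  obtain ⟨row, hrow⟩ : ∃ c, c = Cmd.forL 1 (.var 4) 5 17
    (.ite (.get 3 (.var 5)) (.succ (.var 4))
      (.put 3 (.var 5) (.succ (.var 4)) ;;
        .ite (.get 0 (.get 2 (.var 4))) (.get 0 (.get 2 (.var 5)))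
          (.push 10 (.get 2 (.var 4)) (.var 4) (.var 5))
          (.push 10 (.get 2 (.var 5)) (.var 4) (.var 5)))
      .skip) := ⟨_, rfl⟩
  have key := forN_inv (x := 4) (e := .var 0) (P := row) (σ := σ) (fun u s =>
    s.arr 0 = σ.arr 0 ∧ s.arr 2 = σ.arr 2 ∧ s.lst 1 = σ.lst 1 ∧ (∀ a, s.arr 3 a ≤ u) ∧
    (∀ t, (s.lst 10 t).Nodup) ∧
    (∀ t e, e ∈ s.lst 10 t ↔ e ∈ σ.lst 10 t ∨ e.1 < u ∧ e.2 ∈ (σ.lst 1 e.1).map Prod.fst ∧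
      topNode (σ.arr 0) (σ.arr 2) e.1 e.2 = t) ∧
    s.tm ≤ σ.tm + 2 + 5 * u + 25 * ∑ u ∈ Finset.range u, (σ.lst 1 u).length) ?_ ?_
  · simp only [Expr.eval, hn] at key
    rw [hrow] at key
    obtain ⟨-, -, -, -, k⟩ := key
    exact k
  · exact ⟨by simp, by simp, by simp, by simp [hmark], by simpa using h10, by simp, by simp⟩
  · rintro u s - ⟨k1, k2, k3, k4, k5, k6, k7⟩
    have hr := distribute_row_spec (σ := (s.setVar 4 u).tick 1) (u := u) (by simp)
      (by simpa using k4) (by simpa using k5) (by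
        intro v t hm
        simp only [St.tick_lst, St.setVar_lst, k6] at hm
        simp only [St.tick_arr, St.setVar_arr, k1, k2]
        rcases hm with hm | hm
        · exact hold u v t hm
        · exact absurd hm.1 (lt_irrefl u))
    rw [← hrow] at hr
    simp only [St.tick_lst, St.setVar_lst, St.tick_arr, St.setVar_arr, k1, k2, k3, St.tick_tm,
      St.setVar_tm] at hr
    obtain ⟨r1, r2, r3, r4⟩ := hr
    have ha : ∀ j, j ≠ 3 → (row.eval ((s.setVar 4 u).tick 1)).arr j = s.arr j := fun j hj => by
      rw [hrow, Cmd.eval_arr (by simp [Cmd.wa, hj])]; rfl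
    refine ⟨by rw [ha 0 (by decide), k1], by rw [ha 2 (by decide), k2], ?_, r1, r2, ?_, ?_⟩
    · rw [hrow, Cmd.eval_lst (by simp [Cmd.wl])]; exact k3
    · intro t e
      rw [r3, k6, Nat.lt_succ_iff_lt_or_eq, or_and_right, or_assoc]
      refine or_congr_right (or_congr_right ?_)
      constructor <;> rintro ⟨rfl, h⟩ <;> exact ⟨rfl, h⟩
    · rw [Finset.sum_range_succ]
      omega

/-! ### Writing the output -/

theorem drop_range_succ {p z : ℕ} (hz : z < p + 1) :
    (List.range (p + 1)).drop (p + 1 - (z + 1)) =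
      (p - z) :: (List.range (p + 1)).drop (p + 1 - z) := by
  rw [List.drop_eq_getElem_cons (by rw [List.length_range]; omega), List.getElem_range,
    show p + 1 - (z + 1) = p - z by omega, show p - z + 1 = p + 1 - z by omega]

theorem writeTorsos_spec {σ : St} {p : ℕ} (hp : σ.var 2 = p) :
    let σ' := writeTorsos.eval σ
    (σ'.lst 0 0).map Prod.fst = ((List.range (p + 1)).flatMap fun t =>
      SepTree.pairBlock (σ.lst 10 t).reverse) ++ (σ.lst 0 0).map Prod.fst ∧
    σ'.tm ≤ σ.tm + 3 + 15 * (p + 1) + 15 * ∑ t ∈ Finset.range (p + 1), (σ.lst 10 t).length := by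
  obtain ⟨row, hrow⟩ : ∃ c, c = Cmd.forL 10 (.var 18) 4 5 (.push 0 .zero (.var 5) .zero ;;
    .push 0 .zero (.var 4) .zero ;; .set 13 (.succ (.var 13))) := ⟨_, rfl⟩
  have key := forN_inv (x := 14) (e := .succ (.var 2))
    (P := .set 18 (.sub (.var 2) (.var 14)) ;; .set 13 .zero ;; row ;;
      .push 0 .zero (.var 13) .zero)
    (σ := σ) (fun z s => s.var 2 = p ∧ s.lst 10 = σ.lst 10 ∧ (s.lst 0 0).map Prod.fst =
      (((List.range (p + 1)).drop (p + 1 - z)).flatMap fun t =>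
        SepTree.pairBlock (σ.lst 10 t).reverse) ++ (σ.lst 0 0).map Prod.fst ∧
      s.tm ≤ σ.tm + 3 + 15 * z + 15 * ∑ y ∈ Finset.range z, (σ.lst 10 (p - y)).length) ?_ ?_
  · simp only [Expr.eval, hp] at key
    rw [hrow] at key
    obtain ⟨-, -, k1, k2⟩ := key
    have hs := Finset.sum_range_reflect (fun t => (σ.lst 10 t).length) (p + 1)
    simp only [Nat.add_sub_cancel] at hs
    rw [hs] at k2
    rw [Nat.sub_self, List.drop_zero] at k1
    exact ⟨k1, k2⟩
  · refine ⟨by simpa using hp, by simp, ?_, by simp⟩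
    rw [Nat.sub_zero, List.drop_eq_nil_of_le (by simp)]
    simp
  · rintro z s hz ⟨k1, k2, k3, k4⟩
    simp only [Expr.eval, hp] at hz
    obtain ⟨s1, hs1⟩ : ∃ s1, s1 = (Cmd.set 13 .zero).eval
      ((Cmd.set 18 (.sub (.var 2) (.var 14))).eval ((s.setVar 14 z).tick 1)) := ⟨_, rfl⟩
    have a2 : s1.var 2 = p := by simp [hs1, Cmd.eval, k1]
    have a18 : s1.var 18 = p - z := by simp [hs1, Cmd.eval, k1]
    have a13 : s1.var 13 = 0 := by simp [hs1, Cmd.eval]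
    have al : s1.lst = s.lst := by simp [hs1, Cmd.eval]
    have at1 : s1.tm = s.tm + 7 := by simp [hs1, Cmd.eval]
    have inner := forL_inv (j := 10) (e := .var 18) (x := 4) (y := 5)
      (P := .push 0 .zero (.var 5) .zero ;; .push 0 .zero (.var 4) .zero ;;
        .set 13 (.succ (.var 13))) (σ := s1)
      (fun D t => t.var 13 = D.length ∧ (t.lst 0 0).map Prod.fst =
        words D.reverse ++ (s.lst 0 0).map Prod.fst ∧ t.tm ≤ s.tm + 9 + 15 * D.length) ?_ ?_
    · simp only [Expr.eval, a18, al, k2] at inner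
      rw [← hrow] at inner
      obtain ⟨i1, i2, i3⟩ := inner
      obtain ⟨s2, hs2⟩ : ∃ s2, s2 = row.eval s1 := ⟨_, rfl⟩
      have b2 : s2.var 2 = p := by rw [hs2, hrow, Cmd.eval_var (by simp [Cmd.wv]), a2]
      have b10 : s2.lst 10 = σ.lst 10 := by
        rw [hs2, hrow, Cmd.eval_lst (by simp [Cmd.wl]), al, k2]
      have hfin : (Cmd.set 18 (.sub (.var 2) (.var 14)) ;; .set 13 .zero ;; row ;;
        .push 0 .zero (.var 13) .zero).eval ((s.setVar 14 z).tick 1) =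
        (Cmd.push 0 .zero (.var 13) .zero).eval s2 := by rw [hs2, hs1]; rfl
      rw [← hs2] at i1 i2 i3
      rw [hfin]
      refine ⟨by simp [Cmd.eval, b2], by simp [Cmd.eval, b10], ?_, ?_⟩
      · rw [drop_range_succ hz, List.flatMap_cons, List.append_assoc, ← k3]
        simp [Cmd.eval, i1, i2, SepTree.pairBlock]
      · rw [Finset.sum_range_succ]
        simp [Cmd.eval]
        omega
    · exact ⟨by simp [a13], by simp [al], by simp; omega⟩
    · rintro D ⟨u, v⟩ R t - ⟨i1, i2, i3⟩
      refine ⟨by simp [Cmd.eval, i1], ?_, by simp [Cmd.eval]; omega⟩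
      simp [Cmd.eval, i2]

theorem writeBags_spec {σ : St} {p : ℕ} (hp : σ.var 2 = p) :
    let σ' := writeBags.eval σ
    (σ'.lst 0 0).map Prod.fst = ((List.range (p + 1)).flatMap fun t =>
      SepTree.block ((σ.lst 9 t).map Prod.fst).reverse) ++ (σ.lst 0 0).map Prod.fst ∧
    σ'.tm ≤ σ.tm + 3 + 15 * (p + 1) + 15 * ∑ t ∈ Finset.range (p + 1), (σ.lst 9 t).length := by
  obtain ⟨row, hrow⟩ : ∃ c, c = Cmd.forL 9 (.var 18) 4 17 (.push 0 .zero (.var 4) .zero ;;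
    .set 13 (.succ (.var 13))) := ⟨_, rfl⟩
  have key := forN_inv (x := 14) (e := .succ (.var 2))
    (P := .set 18 (.sub (.var 2) (.var 14)) ;; .set 13 .zero ;; row ;;
      .push 0 .zero (.var 13) .zero)
    (σ := σ) (fun z s => s.var 2 = p ∧ s.lst 9 = σ.lst 9 ∧ (s.lst 0 0).map Prod.fst =
      (((List.range (p + 1)).drop (p + 1 - z)).flatMap fun t =>
        SepTree.block ((σ.lst 9 t).map Prod.fst).reverse) ++ (σ.lst 0 0).map Prod.fst ∧
      s.tm ≤ σ.tm + 3 + 15 * z + 15 * ∑ y ∈ Finset.range z, (σ.lst 9 (p - y)).length) ?_ ?_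
  · simp only [Expr.eval, hp] at key
    rw [hrow] at key
    obtain ⟨-, -, k1, k2⟩ := key
    have hs := Finset.sum_range_reflect (fun t => (σ.lst 9 t).length) (p + 1)
    simp only [Nat.add_sub_cancel] at hs
    rw [hs] at k2
    rw [Nat.sub_self, List.drop_zero] at k1
    exact ⟨k1, k2⟩
  · refine ⟨by simpa using hp, by simp, ?_, by simp⟩
    rw [Nat.sub_zero, List.drop_eq_nil_of_le (by simp)]
    simp
  · rintro z s hz ⟨k1, k2, k3, k4⟩
    simp only [Expr.eval, hp] at hz
    obtain ⟨s1, hs1⟩ : ∃ s1, s1 = (Cmd.set 13 .zero).eval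
      ((Cmd.set 18 (.sub (.var 2) (.var 14))).eval ((s.setVar 14 z).tick 1)) := ⟨_, rfl⟩
    have a2 : s1.var 2 = p := by simp [hs1, Cmd.eval, k1]
    have a18 : s1.var 18 = p - z := by simp [hs1, Cmd.eval, k1]
    have a13 : s1.var 13 = 0 := by simp [hs1, Cmd.eval]
    have al : s1.lst = s.lst := by simp [hs1, Cmd.eval]
    have at1 : s1.tm = s.tm + 7 := by simp [hs1, Cmd.eval]
    have inner := forL_inv (j := 9) (e := .var 18) (x := 4) (y := 17)
      (P := .push 0 .zero (.var 4) .zero ;; .set 13 (.succ (.var 13))) (σ := s1)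
      (fun D t => t.var 13 = D.length ∧ (t.lst 0 0).map Prod.fst =
        (D.map Prod.fst).reverse ++ (s.lst 0 0).map Prod.fst ∧
        t.tm ≤ s.tm + 9 + 15 * D.length) ?_ ?_
    · simp only [Expr.eval, a18, al, k2] at inner
      rw [← hrow] at inner
      obtain ⟨i1, i2, i3⟩ := inner
      obtain ⟨s2, hs2⟩ : ∃ s2, s2 = row.eval s1 := ⟨_, rfl⟩
      have b2 : s2.var 2 = p := by rw [hs2, hrow, Cmd.eval_var (by simp [Cmd.wv]), a2]
      have b9 : s2.lst 9 = σ.lst 9 := by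
        rw [hs2, hrow, Cmd.eval_lst (by simp [Cmd.wl]), al, k2]
      have hfin : (Cmd.set 18 (.sub (.var 2) (.var 14)) ;; .set 13 .zero ;; row ;;
        .push 0 .zero (.var 13) .zero).eval ((s.setVar 14 z).tick 1) =
        (Cmd.push 0 .zero (.var 13) .zero).eval s2 := by rw [hs2, hs1]; rfl
      rw [← hs2] at i1 i2 i3
      rw [hfin]
      refine ⟨by simp [Cmd.eval, b2], by simp [Cmd.eval, b9], ?_, ?_⟩
      · rw [drop_range_succ hz, List.flatMap_cons, List.append_assoc, ← k3]
        simp [Cmd.eval, i1, i2, SepTree.block]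
      · rw [Finset.sum_range_succ]
        simp [Cmd.eval]
        omega
    · exact ⟨by simp [a13], by simp [al], by simp; omega⟩
    · rintro D ⟨u, v⟩ R t - ⟨i1, i2, i3⟩
      refine ⟨by simp [Cmd.eval, i1], ?_, by simp [Cmd.eval]; omega⟩
      simp [Cmd.eval, i2]

theorem writeTree_spec {σ : St} {p : ℕ} (hp : σ.var 2 = p) :
    let σ' := writeTree.eval σ
    (σ'.lst 0 0).map Prod.fst = (p + 1) :: SepTree.pairBlock
      ((List.range p).map fun i => (i, σ.arr 1 i)).reverse ++ (σ.lst 0 0).map Prod.fst ∧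
    σ'.tm ≤ σ.tm + 12 + 12 * p := by
  have key := forN_inv (x := 3) (e := .var 2)
    (P := .push 0 .zero (.get 1 (.var 3)) .zero ;; .push 0 .zero (.var 3) .zero)
    (σ := σ) (fun z s => s.var 2 = p ∧ s.arr 1 = σ.arr 1 ∧ (s.lst 0 0).map Prod.fst =
      words ((List.range z).map fun i => (i, σ.arr 1 i)).reverse ++ (σ.lst 0 0).map Prod.fst ∧
      s.tm ≤ σ.tm + 2 + 12 * z) ?_ ?_
  · simp only [Expr.eval, hp] at key
    obtain ⟨s', hs'⟩ : ∃ s', s' = (Cmd.forN 3 (.var 2) (.push 0 .zero (.get 1 (.var 3)) .zero ;;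
      .push 0 .zero (.var 3) .zero)).eval σ := ⟨_, rfl⟩
    rw [← hs'] at key
    obtain ⟨k1, -, k2, k3⟩ := key
    have hfin : writeTree.eval σ = (Cmd.push 0 .zero (.succ (.var 2)) .zero).eval
      ((Cmd.push 0 .zero (.var 2) .zero).eval s') := by rw [hs']; rfl
    rw [hfin]
    refine ⟨?_, by simp [Cmd.eval]; omega⟩
    simp [Cmd.eval, k1, k2, SepTree.pairBlock]
  · exact ⟨by simpa using hp, by simp, by simp, by simp⟩
  · rintro z s hz ⟨k1, k2, k3, k4⟩
    refine ⟨by simpa [Cmd.eval] using k1, by simpa [Cmd.eval] using k2, ?_,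
      by simp [Cmd.eval]; omega⟩
    simp [Cmd.eval, k2, k3, List.range_succ]

end RamLang

/-! ### Correctness and running time of the algorithm -/

namespace RamLang

/-- What is computed from the separations read, and in which time. The lists through which the later
parts of the algorithm run have total length at most the time used before (`Bounded.length`), so
that each part multiplies the running time by a constant at most. -/
theorem build_spec {σ : St} {n p k K B : ℕ} {X S : ℕ → Finset ℕ} {H : ℕ → ℕ → Prop}
    (h : IsLaminar n p X) (hne : ∀ i < p, (X i).Nonempty) (hr : SepsRead n p K X S σ)
    (hn : σ.var 0 = n) (hp : σ.var 2 = p) (hroot : σ.arr 0 p = n)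
    (hk : ∀ i < p, (S i).card ≤ k) (hXS : ∀ i < p, Disjoint (X i) (S i))
    (hSn : ∀ i < p, S i ⊆ Finset.range n)
    (hH : ∀ u v, v ∈ (σ.lst 1 u).map Prod.fst ↔ H u v) (hHn : ∀ u v, H u v → u < n ∧ v < n)
    (hl : ∀ j ∈ [0, 6, 7, 8, 9, 10], σ.lst j = fun _ => []) (hmark : ∀ a, σ.arr 3 a = 0)
    (hB : Bounded B σ) :
    ∃ (par home : ℕ → ℕ) (bags : ℕ → List ℕ) (torsos : ℕ → List (ℕ × ℕ)),
      (∀ i < p, IsPar p X (par i) i) ∧ (∀ x < n, IsHome p X (home x) x) ∧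
      (∀ t, (bags t).Nodup ∧ ∀ v, v ∈ bags t ↔ v < n ∧ home v = t ∨ t < p ∧ v ∈ S t) ∧
      (∀ t, (torsos t).Nodup ∧ ∀ u v, (u, v) ∈ torsos t ↔ t < p ∧ u ∈ S t ∧ v ∈ S t ∧ u < v ∨
        (H u v ∨ ∃ i < p, u ∈ S i ∧ v ∈ S i ∧ u < v) ∧
          topNode (fun t => (X t).card) home u v = t) ∧
      ((build.eval σ).lst 0 0).map Prod.fst =
        (p + 1) :: SepTree.pairBlock ((List.range p).map fun i => (i, par i)).reverse ++
        ((List.range (p + 1)).flatMap fun t => SepTree.block (bags t)) ++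
        (List.range (p + 1)).flatMap (fun t => SepTree.pairBlock (torsos t)) ∧
      (build.eval σ).tm ≤ 10000000 * (σ.tm + n + p * (K + k ^ 2 + 1) + 1) := by
  have hcard : ∀ i < p, (X i).card ≤ n := fun i hi => by
    simpa using Finset.card_le_card (h.sub i hi).subset
  obtain ⟨s1, hs1⟩ : ∃ s, s = sortSeps.eval σ := ⟨_, rfl⟩
  have q1 := sortSeps_spec hn (by rw [hl 6 (by simp)]) hr.mem_bySize hr.bySize_nodup hcard
  have v1 : ∀ x, x ∉ sortSeps.wv → s1.var x = σ.var x := fun x hx => hs1 ▸ Cmd.eval_var hx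
  have a1 : ∀ j, j ∉ sortSeps.wa → s1.arr j = σ.arr j := fun x hx => hs1 ▸ Cmd.eval_arr hx
  have l1 : ∀ j, j ∉ sortSeps.wl → s1.lst j = σ.lst j := fun x hx => hs1 ▸ Cmd.eval_lst hx
  have B1 : Bounded B s1 := hs1 ▸ hB.cmd _
  rw [← hs1] at q1
  obtain ⟨o1, o2, o3, t1⟩ := q1
  have hOlen : (s1.lst 6 0).length = p := by
    rw [← List.length_map Prod.fst, ← List.toFinset_card_of_nodup o1, ← Finset.card_range p]
    congr 1
    ext i
    rw [List.mem_toFinset, Finset.mem_range, o2]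
  obtain ⟨s2, hs2⟩ : ∃ s, s = bucket.eval s1 := ⟨_, rfl⟩
  have q2 := bucket_spec (σ := s1) (K := K) (by rw [l1 7 (by decide), hl 7 (by simp)])
    (by rw [l1 8 (by decide), hl 8 (by simp)])
    (fun i hi => by rw [l1 3 (by decide)]; exact (hr.intervals i ((o2 i).1 hi)).nodup)
    (fun i hi => by rw [l1 3 (by decide)]; exact hr.intervals_length i ((o2 i).1 hi))
  have v2 : ∀ x, x ∉ bucket.wv → s2.var x = s1.var x := fun x hx => hs2 ▸ Cmd.eval_var hx
  have a2 : ∀ j, j ∉ bucket.wa → s2.arr j = s1.arr j := fun x hx => hs2 ▸ Cmd.eval_arr hx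
  have l2 : ∀ j, j ∉ bucket.wl → s2.lst j = s1.lst j := fun x hx => hs2 ▸ Cmd.eval_lst hx
  have B2 : Bounded B s2 := hs2 ▸ B1.cmd _
  rw [← hs2, hOlen, l1 3 (by decide)] at q2
  obtain ⟨b1, b2, t2⟩ := q2
  have hstarts : ∀ x i, i ∈ (s2.lst 7 x).map Prod.fst ↔
      i < p ∧ x ∈ X i ∧ ∀ y, y + 1 = x → y ∉ X i := by
    intro x i
    rw [b1, List.mem_reverse, List.mem_filter, o2, decide_eq_true_eq]
    exact and_congr_right fun hi => (hr.intervals i hi).mem_starts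
  have hends : ∀ x i, i ∈ (s2.lst 8 x).map Prod.fst ↔
      i < p ∧ x ∉ X i ∧ ∃ y, y + 1 = x ∧ y ∈ X i := by
    intro x i
    rw [b2, o2]
    exact and_congr_right fun hi => (hr.intervals i hi).mem_stops
  have hdec : ∀ x, ((s2.lst 7 x).map Prod.fst).Pairwise fun i j => (X j).card < (X i).card := by
    intro x
    have hnd : ((s2.lst 7 x).map Prod.fst).Nodup := by
      rw [b1]; exact List.nodup_reverse.2 (o1.filter _)
    have hle : ((s2.lst 7 x).map Prod.fst).Pairwise fun i j => (X j).card ≤ (X i).card := by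
      rw [b1, List.pairwise_reverse]; exact o3.filter _
    refine (List.Pairwise.and hnd hle).imp_of_mem ?_
    rintro i j hi hj ⟨hij, hc⟩
    rw [hstarts] at hi hj
    rcases h.comparable hi.1.le hj.1.le hij hi.2.1 hj.2.1 with h1 | h1
    · exact absurd (Finset.card_lt_card h1) hc.not_gt
    · exact Finset.card_lt_card h1
  have hsize : ∀ i ≤ p, s2.arr 0 i = (X i).card := by
    intro i hi
    rw [a2 0 (by decide), a1 0 (by decide)]
    rcases hi.eq_or_lt with rfl | hi
    · rw [hroot, h.root, Finset.card_range]
    · exact hr.size i hi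
  obtain ⟨s3, hs3⟩ : ∃ s, s = sweep.eval s2 := ⟨_, rfl⟩
  have q3 := sweep_spec (σ := s2) h (by rw [v2 0 (by decide), v1 0 (by decide), hn])
    (by rw [v2 2 (by decide), v1 2 (by decide), hp])
    (by rw [l2 9 (by decide), l1 9 (by decide), hl 9 (by simp)]) hne hsize hstarts hdec hends
  have v3 : ∀ x, x ∉ sweep.wv → s3.var x = s2.var x := fun x hx => hs3 ▸ Cmd.eval_var hx
  have a3 : ∀ j, j ∉ sweep.wa → s3.arr j = s2.arr j := fun x hx => hs3 ▸ Cmd.eval_arr hx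
  have l3 : ∀ j, j ∉ sweep.wl → s3.lst j = s2.lst j := fun x hx => hs3 ▸ Cmd.eval_lst hx
  have B3 : Bounded B s3 := hs3 ▸ B2.cmd _
  rw [← hs3] at q3
  obtain ⟨c1, c2, c3, c4, t3⟩ := q3
  have hl4 : s3.lst 4 = σ.lst 4 := by rw [l3 4 (by decide), l2 4 (by decide), l1 4 (by decide)]
  -- a vertex at home at `t` is in `X t`, hence not in the boundary of `X t`
  have hnotX : ∀ t < p, ∀ v ∈ S t, s3.arr 2 v ≠ t := by
    rintro t ht v hv rfl
    have hv' := Finset.mem_range.1 (hSn _ ht hv)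
    exact Finset.disjoint_left.1 (hXS _ ht) (c2 v hv').2.1 hv
  obtain ⟨s4, hs4⟩ : ∃ s, s = fill.eval s3 := ⟨_, rfl⟩
  have q4 := fill_spec (σ := s3) (p := p) (k := k)
    (by rw [v3 2 (by decide), v2 2 (by decide), v1 2 (by decide), hp])
    (by rw [l3 10 (by decide), l2 10 (by decide), l1 10 (by decide), hl 10 (by simp)])
    (fun i hi => by
      rw [hl4, ← List.length_map Prod.fst, ← List.toFinset_card_of_nodup (hr.sep_nodup i hi)]
      refine le_trans (le_of_eq ?_) (hk i hi)
      congr 1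
      ext v
      rw [List.mem_toFinset, hr.mem_sep i hi])
    (by rw [hl4]; exact hr.sep_nodup) c3
    (fun i hi v hv hv' => by
      rw [hl4, hr.mem_sep i hi] at hv
      exact hnotX i hi v hv ((c4 i v).1 hv').2)
  have v4 : ∀ x, x ∉ fill.wv → s4.var x = s3.var x := fun x hx => hs4 ▸ Cmd.eval_var hx
  have a4 : ∀ j, j ∉ fill.wa → s4.arr j = s3.arr j := fun x hx => hs4 ▸ Cmd.eval_arr hx
  have l4 : ∀ j, j ∉ fill.wl → s4.lst j = s3.lst j := fun x hx => hs4 ▸ Cmd.eval_lst hx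
  have B4 : Bounded B s4 := hs4 ▸ B3.cmd _
  rw [← hs4, hl4] at q4
  obtain ⟨d1, d2, d3, d4, d5, t4⟩ := q4
  have hH4 : ∀ u v, v ∈ (s4.lst 1 u).map Prod.fst ↔
      H u v ∨ ∃ i < p, u ∈ S i ∧ v ∈ S i ∧ u < v := by
    intro u v
    rw [d3, l3 1 (by decide), l2 1 (by decide), l1 1 (by decide), hH]
    refine or_congr_right (exists_congr fun i => and_congr_right fun hi => ?_)
    rw [hr.mem_sep i hi, hr.mem_sep i hi]
  have htop : ∀ u v, u < n → v < n → topNode (s4.arr 0) (s4.arr 2) u v =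
      topNode (fun t => (X t).card) (s3.arr 2) u v := by
    intro u v hu hv
    rw [topNode, topNode, a4 0 (by decide), a4 2 (by decide), a3 0 (by decide),
      hsize _ (c2 u hu).1, hsize _ (c2 v hv).1]
  obtain ⟨s5, hs5⟩ : ∃ s, s = distribute.eval s4 := ⟨_, rfl⟩
  have q5 := distribute_spec (σ := s4) (n := n)
    (by rw [v4 0 (by decide), v3 0 (by decide), v2 0 (by decide), v1 0 (by decide), hn])
    (fun a => by
      rw [a4 3 (by decide), a3 3 (by decide), a2 3 (by decide), a1 3 (by decide), hmark])
    d4 (by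
      rintro u v t hm ht
      rw [d5] at hm
      obtain ⟨htp, hu, hv, -⟩ := hm
      rw [hr.mem_sep t htp] at hu hv
      rw [a4 2 (by decide), topNode] at ht
      split at ht
      · exact hnotX t htp u hu ht
      · exact hnotX t htp v hv ht)
  have v5 : ∀ x, x ∉ distribute.wv → s5.var x = s4.var x := fun x hx => hs5 ▸ Cmd.eval_var hx
  have a5 : ∀ j, j ∉ distribute.wa → s5.arr j = s4.arr j := fun x hx => hs5 ▸ Cmd.eval_arr hx
  have l5 : ∀ j, j ∉ distribute.wl → s5.lst j = s4.lst j := fun x hx => hs5 ▸ Cmd.eval_lst hx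
  have B5 : Bounded B s5 := hs5 ▸ B4.cmd _
  rw [← hs5] at q5
  obtain ⟨e1, e2, t5⟩ := q5
  have hp5 : s5.var 2 = p := by
    rw [v5 2 (by decide), v4 2 (by decide), v3 2 (by decide), v2 2 (by decide),
      v1 2 (by decide), hp]
  -- the output list grows at the front, so its parts are written from the last to the first
  obtain ⟨s6, hs6⟩ : ∃ s, s = writeTorsos.eval s5 := ⟨_, rfl⟩
  have q6 := writeTorsos_spec hp5
  have v6 : ∀ x, x ∉ writeTorsos.wv → s6.var x = s5.var x := fun x hx => hs6 ▸ Cmd.eval_var hx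
  have a6 : ∀ j, j ∉ writeTorsos.wa → s6.arr j = s5.arr j := fun x hx => hs6 ▸ Cmd.eval_arr hx
  have l6 : ∀ j, j ∉ writeTorsos.wl → s6.lst j = s5.lst j := fun x hx => hs6 ▸ Cmd.eval_lst hx
  have B6 : Bounded B s6 := hs6 ▸ B5.cmd _
  rw [← hs6, l5 0 (by decide), l4 0 (by decide), l3 0 (by decide), l2 0 (by decide),
    l1 0 (by decide), hl 0 (by simp), List.map_nil, List.append_nil] at q6
  obtain ⟨f1, t6⟩ := q6
  obtain ⟨s7, hs7⟩ : ∃ s, s = writeBags.eval s6 := ⟨_, rfl⟩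
  have q7 := writeBags_spec (σ := s6) (p := p) (by rw [v6 2 (by decide), hp5])
  have v7 : ∀ x, x ∉ writeBags.wv → s7.var x = s6.var x := fun x hx => hs7 ▸ Cmd.eval_var hx
  have a7 : ∀ j, j ∉ writeBags.wa → s7.arr j = s6.arr j := fun x hx => hs7 ▸ Cmd.eval_arr hx
  rw [← hs7, f1] at q7
  obtain ⟨g1, t7⟩ := q7
  have q8 := writeTree_spec (σ := s7) (p := p) (by rw [v7 2 (by decide), v6 2 (by decide), hp5])
  have hfin : build.eval σ = writeTree.eval s7 := by
    rw [hs7, hs6, hs5, hs4, hs3, hs2, hs1]; rfl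
  rw [← hfin, g1] at q8
  obtain ⟨i1, t8⟩ := q8
  have hpar : s7.arr 1 = s3.arr 1 := by
    rw [a7 1 (by decide), a6 1 (by decide), a5 1 (by decide), a4 1 (by decide)]
  have hbags : s6.lst 9 = s4.lst 9 := by rw [l6 9 (by decide), l5 9 (by decide)]
  refine ⟨s3.arr 1, s3.arr 2, fun t => ((s4.lst 9 t).map Prod.fst).reverse,
    fun t => (s5.lst 10 t).reverse, c1, c2, ?_, ?_, ?_, ?_⟩
  · intro t
    refine ⟨List.nodup_reverse.2 (d1 t), fun v => ?_⟩
    rw [List.mem_reverse, d2, c4]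
    exact or_congr_right (and_congr_right fun ht => hr.mem_sep t ht v)
  · intro t
    refine ⟨List.nodup_reverse.2 (e1 t), fun u v => ?_⟩
    rw [List.mem_reverse, e2, d5]
    refine or_congr (and_congr_right fun ht => by rw [hr.mem_sep t ht, hr.mem_sep t ht]) ?_
    simp only
    rw [hH4]
    constructor
    · rintro ⟨hu, hv, ht⟩
      have hvn : v < n := by
        rcases hv with hv | ⟨i, hi, -, hv, -⟩
        · exact (hHn u v hv).2
        · exact Finset.mem_range.1 (hSn i hi hv)
      exact ⟨hv, by rw [← htop u v hu hvn]; exact ht⟩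
    · rintro ⟨hv, ht⟩
      have huv : u < n ∧ v < n := by
        rcases hv with hv | ⟨i, hi, hu, hv, -⟩
        · exact hHn u v hv
        · exact ⟨Finset.mem_range.1 (hSn i hi hu), Finset.mem_range.1 (hSn i hi hv)⟩
      exact ⟨huv.1, hv, by rw [htop u v huv.1 huv.2]; exact ht⟩
  · rw [i1, hpar, hbags, List.append_assoc]
  · -- the lengths of the lists used by each part are bounded by the time before this part
    have z1 := B2.length 8 n
    have z2 := B2.length 7 n
    have z3 := B4.length 1 n
    have z4 := B5.length 10 (p + 1)
    have z5 := B6.length 9 (p + 1)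
    have y1 : p * (10 * K + 10) = 10 * (p * K) + 10 * p := by ring
    have y2 : p * (3 + k * (7 + 12 * k)) = 3 * p + 7 * (p * k) + 12 * (p * k ^ 2) := by ring
    have y3 : p * k ≤ p * k ^ 2 := Nat.mul_le_mul_left _ (Nat.le_self_pow (by decide) k)
    have y4 : p * (K + k ^ 2 + 1) = p * K + p * k ^ 2 + p := by ring
    rw [y1] at t2
    rw [y2] at t4
    rw [y4]
    have w2 : s2.tm ≤ 40 * (σ.tm + n + (p * K + p * k ^ 2 + p) + 1) := by omega
    have w3 : s3.tm ≤ 900 * (σ.tm + n + (p * K + p * k ^ 2 + p) + 1) := by omega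
    have w4 : s4.tm ≤ 950 * (σ.tm + n + (p * K + p * k ^ 2 + p) + 1) := by omega
    have w5 : s5.tm ≤ 25000 * (σ.tm + n + (p * K + p * k ^ 2 + p) + 1) := by omega
    have w6 : s6.tm ≤ 16 * 25100 * (σ.tm + n + (p * K + p * k ^ 2 + p) + 1) := by omega
    omega

end RamLang

namespace RamLang

theorem SepsRead.congr {n q K : ℕ} {X S X' S' : ℕ → Finset ℕ} {σ : St}
    (h : SepsRead n q K X S σ) (hX : ∀ i < q, X' i = X i) (hS : ∀ i < q, S' i = S i) :
    SepsRead n q K X' S' σ where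
  size i hi := by rw [hX i hi]; exact h.size i hi
  intervals i hi := by rw [hX i hi]; exact h.intervals i hi
  intervals_length := h.intervals_length
  mem_sep i hi := by rw [hS i hi]; exact h.mem_sep i hi
  sep_nodup := h.sep_nodup
  mem_bySize s i := by
    rw [h.mem_bySize]
    exact and_congr_right fun hi => by rw [hX i hi]
  bySize_nodup := h.bySize_nodup

theorem disjoint_separator {n : ℕ} {A B : List (ℕ × ℕ)} :
    Disjoint (compl n (larger n A B)) (separator n A B) := by
  rw [Finset.disjoint_left]
  intro v hv hs
  rw [separator, Finset.mem_filter] at hs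
  rw [larger] at hv
  split at hv
  · exact hs.2.2 hv
  · exact hs.2.1 hv

/-- What the algorithm computes, in terms of numbers. The hypothesis `hl` says that `l` is positive
if there are separations; without it, reading them would not be paid for. -/
theorem algorithm_spec {n p k l : ℕ} {E : List (ℕ × ℕ)} {A B : ℕ → List (ℕ × ℕ)}
    {X S : ℕ → Finset ℕ} {input : List ℕ}
    (hin : input = n :: SepTree.pairBlock E ++ p :: (List.range p).flatMap fun i =>
      SepTree.pairBlock (A i) ++ SepTree.pairBlock (B i))
    (hX : ∀ i < p, X i = compl n (larger n (A i) (B i)))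
    (hS : ∀ i < p, S i = separator n (A i) (B i)) (h : IsLaminar n p X)
    (hne : ∀ i < p, (X i).Nonempty) (hA : ∀ i < p, IsRep n (A i)) (hB : ∀ i < p, IsRep n (B i))
    (hAB : ∀ i < p, Disjoint (compl n (A i)) (compl n (B i)))
    (hlen : ∀ i < p, (A i).length + (B i).length ≤ l) (hk : ∀ i < p, (S i).card ≤ k)
    (hE : ∀ e ∈ E, e.1 < n ∧ e.2 < n) (hn : 1 ≤ n) (hl : p ≤ p * l) :
    ∃ (par home : ℕ → ℕ) (bags : ℕ → List ℕ) (torsos : ℕ → List (ℕ × ℕ)),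
      (∀ i < p, IsPar p X (par i) i) ∧ (∀ x < n, IsHome p X (home x) x) ∧
      (∀ t, (bags t).Nodup ∧ ∀ v, v ∈ bags t ↔ v < n ∧ home v = t ∨ t < p ∧ v ∈ S t) ∧
      (∀ t, (torsos t).Nodup ∧ ∀ u v, (u, v) ∈ torsos t ↔ t < p ∧ u ∈ S t ∧ v ∈ S t ∧ u < v ∨
        ((∃ e ∈ E, u = min e.1 e.2 ∧ v = max e.1 e.2) ∨ ∃ i < p, u ∈ S i ∧ v ∈ S i ∧ u < v) ∧
          topNode (fun t => (X t).card) home u v = t) ∧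
      ((algorithm.eval (initSt input)).lst 0 0).map Prod.fst =
        (p + 1) :: SepTree.pairBlock ((List.range p).map fun i => (i, par i)).reverse ++
        ((List.range (p + 1)).flatMap fun t => SepTree.block (bags t)) ++
        (List.range (p + 1)).flatMap (fun t => SepTree.pairBlock (torsos t)) ∧
      (algorithm.eval (initSt input)).tm ≤
        10000000000 * (n + E.length + p * l + p * k ^ 2) := by
  obtain ⟨C, hC⟩ : ∃ C, ∀ a ∈ input, a ≤ C :=
    ⟨input.sum, fun a ha => List.single_le_sum (by simp) a ha⟩
  have hB0 : Bounded C (initSt input) :=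
    ⟨fun _ => by simp [initSt], fun _ _ => by simp [initSt], fun _ _ a ha => by simp [initSt] at ha,
      hC, fun _ _ => by simp [initSt]⟩
  obtain ⟨s1, hs1⟩ : ∃ s, s = readGraph.eval (initSt input) := ⟨_, rfl⟩
  have q1 := readGraph_spec (σ := initSt input) (by exact hin) rfl
  have a1 : ∀ j, j ∉ readGraph.wa → s1.arr j = fun _ => 0 := fun j hj => by
    rw [hs1, Cmd.eval_arr hj]; rfl
  have l1 : ∀ j, j ∉ readGraph.wl → s1.lst j = fun _ => [] := fun j hj => by
    rw [hs1, Cmd.eval_lst hj]; rfl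
  rw [← hs1] at q1
  obtain ⟨b1, b2, b3, b4⟩ := q1
  obtain ⟨s2, hs2⟩ : ∃ s, s = readSeps.eval s1 := ⟨_, rfl⟩
  have q2 := readSeps_spec (σ := s1) b1 b2 (fun j hj => l1 j (by simp [readGraph, Cmd.wl, hj]))
    (fun a => by rw [a1 4 (by decide)]) hA hB hAB hlen (fun i hi => hS i hi ▸ hk i hi)
  have a2 : ∀ j, j ∉ readSeps.wa → s2.arr j = s1.arr j := fun x hx => hs2 ▸ Cmd.eval_arr hx
  have l2 : ∀ j, j ∉ readSeps.wl → s2.lst j = s1.lst j := fun x hx => hs2 ▸ Cmd.eval_lst hx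
  rw [← hs2] at q2
  obtain ⟨c1, c2, c3, c4, c5⟩ := q2
  have q3 := build_spec (σ := s2) (k := k)
    (H := fun u v => ∃ e ∈ E, u = min e.1 e.2 ∧ v = max e.1 e.2) h hne (c1.congr hX hS) c2 c3 c4 hk
    (fun i hi => by rw [hX i hi, hS i hi]; exact disjoint_separator)
    (fun i hi => by rw [hS i hi]; exact Finset.filter_subset _ _)
    (by rw [l2 1 (by decide)]; exact b4)
    (by
      rintro _ _ ⟨e, he, rfl, rfl⟩
      have := hE e he
      omega)
    (fun j hj => by
      have : j ∉ readSeps.wl ∧ j ∉ readGraph.wl := by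
        revert j; decide
      rw [l2 j this.1, l1 j this.2])
    (fun a => by rw [a2 3 (by decide), a1 3 (by decide)])
    (hs2 ▸ (hs1 ▸ hB0.cmd readGraph : Bounded C s1).cmd readSeps)
  have hfin : algorithm.eval (initSt input) = build.eval s2 := by rw [hs2, hs1]; rfl
  rw [hfin]
  obtain ⟨par, home, bags, torsos, d1, d2, d3, d4, d5, d6⟩ := q3
  refine ⟨par, home, bags, torsos, d1, d2, d3, d4, d5, ?_⟩
  have t0 : (initSt input).tm = 0 := rfl
  have y1 : p * (60 * l + 20 * k + 201) = 60 * (p * l) + 20 * (p * k) + 201 * p := by ring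
  have y2 : p * (l + 1 + k ^ 2 + 1) = p * l + p * k ^ 2 + 2 * p := by ring
  have y3 : p * k ≤ p * k ^ 2 := Nat.mul_le_mul_left _ (Nat.le_self_pow (by decide) k)
  rw [y1] at c5
  rw [y2] at d6
  omega

end RamLang

/-! ### Oriented separations -/

namespace SepTree

theorem IsMinimalSeparation.symm {V : Type*} {G : SimpleGraph V} {A B : Set V}
    (h : IsMinimalSeparation G A B) : IsMinimalSeparation G B A where
  cover := by rw [Set.union_comm]; exact h.cover
  left_nonempty := h.right_nonempty
  right_nonempty := h.left_nonempty
  no_edge u hu v hv huv := h.no_edge v hv u hu huv.symm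
  left_neighbor x hx := h.right_neighbor x hx.symm
  right_neighbor x hx := h.left_neighbor x hx.symm

theorem IsMinimalSeparation.congr {V : Type*} {G : SimpleGraph V} {A B C D : Set V}
    (h : IsMinimalSeparation G A B) (e : s(C, D) = s(A, B)) : IsMinimalSeparation G C D := by
  rcases Sym2.eq_iff.1 e with ⟨rfl, rfl⟩ | ⟨rfl, rfl⟩
  · exact h
  · exact h.symm

theorem Nested.congr {V : Type*} {A B A' B' C D C' D' : Set V} (h : Nested A B A' B')
    (e : s(C, D) = s(A, B)) (e' : s(C', D') = s(A', B')) : Nested C D C' D' := by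
  unfold Nested at h ⊢
  rcases Sym2.eq_iff.1 e with ⟨rfl, rfl⟩ | ⟨rfl, rfl⟩ <;>
  rcases Sym2.eq_iff.1 e' with ⟨rfl, rfl⟩ | ⟨rfl, rfl⟩ <;> tauto

/-- The separator of a minimal separation is the boundary of the strict side. -/
theorem IsMinimalSeparation.mem_inter_iff {V : Type*} {G : SimpleGraph V} {C D : Set V}
    (h : IsMinimalSeparation G C D) {x : V} : x ∈ C ∩ D ↔ x ∉ Dᶜ ∧ ∃ y ∈ Dᶜ, G.Adj x y := by
  constructor
  · intro hx
    obtain ⟨y, hy, hxy⟩ := h.left_neighbor x hx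
    exact ⟨fun hn => hn hx.2, y, hy.2, hxy⟩
  · rintro ⟨hx, y, hy, hxy⟩
    rw [Set.notMem_compl_iff] at hx
    refine ⟨?_, hx⟩
    by_contra hC
    have hyC : y ∈ C := ((h.cover ▸ Set.mem_univ y : y ∈ C ∪ D)).resolve_right hy
    exact h.no_edge y ⟨hyC, hy⟩ x ⟨hx, hC⟩ hxy.symm

theorem IsMinimalSeparation.compl_eq {V : Type*} {G : SimpleGraph V} {C D : Set V}
    (h : IsMinimalSeparation G C D) : Dᶜ = C \ D := by
  ext x
  refine ⟨fun hx => ⟨?_, hx⟩, fun hx => hx.2⟩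
  exact (h.cover ▸ Set.mem_univ x : x ∈ C ∪ D).resolve_right hx

/-- A minimal separation is determined by either of its strict sides. -/
theorem IsMinimalSeparation.eq_of_compl_eq {V : Type*} {G : SimpleGraph V} {C D C' D' : Set V}
    (h : IsMinimalSeparation G C D) (h' : IsMinimalSeparation G C' D') (e : Dᶜ = D'ᶜ) :
    C = C' ∧ D = D' := by
  refine ⟨?_, compl_injective e⟩
  have h1 : C ∩ D = C' ∩ D' := by
    ext x; rw [h.mem_inter_iff, h'.mem_inter_iff, e]
  rw [← Set.inter_union_sdiff C D, ← Set.inter_union_sdiff C' D', h1, ← h.compl_eq,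
    ← h'.compl_eq, e]

/-- For nested minimal separations, each oriented so that its strict side `Dᶜ` is the one with at
most as many vertices, the strict sides are nested, or disjoint without an edge between them: two
small strict sides cannot cover the rest of each other's separation, by their sizes. -/
theorem IsMinimalSeparation.cases {V : Type*} [Finite V] {G : SimpleGraph V} {C D C' D' : Set V}
    (h : IsMinimalSeparation G C D) (h' : IsMinimalSeparation G C' D') (hn : Nested C D C' D')
    (hne : s(C, D) ≠ s(C', D')) (hs : Dᶜ.ncard ≤ Cᶜ.ncard) (hs' : D'ᶜ.ncard ≤ C'ᶜ.ncard) :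
    Dᶜ ⊂ D'ᶜ ∨ D'ᶜ ⊂ Dᶜ ∨
      Disjoint Dᶜ D'ᶜ ∧ Disjoint Dᶜ (C' ∩ D') ∧ Disjoint D'ᶜ (C ∩ D) := by
  have hneq : Dᶜ ≠ D'ᶜ := fun e => by
    obtain ⟨rfl, rfl⟩ := h.eq_of_compl_eq h' e
    exact hne rfl
  have hsub : Dᶜ ⊆ C := by rw [h.compl_eq]; exact Set.sdiff_subset
  have hsub' : D'ᶜ ⊆ C' := by rw [h'.compl_eq]; exact Set.sdiff_subset
  rcases hn with ⟨h1, h2⟩ | ⟨h1, h2⟩ | ⟨h1, h2⟩ | ⟨h1, h2⟩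
  · exact .inl ((Set.compl_subset_compl.2 h2).ssubset_of_ne hneq)
  · exfalso
    have h3 : C'ᶜ ⊆ Dᶜ := Set.compl_subset_compl.2 h1
    have h4 : Cᶜ ⊆ D'ᶜ := Set.compl_subset_compl.2 h2
    have n3 := Set.ncard_le_ncard h3
    have n4 := Set.ncard_le_ncard h4
    have e3 : C'ᶜ = Dᶜ := Set.eq_of_subset_of_ncard_le h3 (by omega)
    have e4 : Cᶜ = D'ᶜ := Set.eq_of_subset_of_ncard_le h4 (by omega)
    exact hne (by rw [compl_injective e3, compl_injective e4, Sym2.eq_swap])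
  · refine .inr (.inr ⟨?_, ?_, ?_⟩)
    · exact Set.disjoint_compl_right_iff_subset.2 (hsub.trans h1)
    · exact Set.disjoint_compl_left_iff_subset.2 (Set.inter_subset_left.trans h2)
    · exact Set.disjoint_compl_left_iff_subset.2 (Set.inter_subset_left.trans h1)
  · exact .inr (.inl ((Set.compl_subset_compl.2 h1).ssubset_of_ne hneq.symm))

/-! ### Representations -/

theorem IsIntervalRep.isRep {n : ℕ} {A : Set (Fin n)} {L : List (ℕ × ℕ)} (h : IsIntervalRep A L) :
    RamLang.IsRep n L where
  le := h.le
  lt I hI := ((h.mem_iff I.2).1 ⟨I, hI, h.le I hI, le_rfl⟩).1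
  gap := h.gap

theorem IsIntervalRep.mem_compl {n : ℕ} {A : Set (Fin n)} {L : List (ℕ × ℕ)}
    (h : IsIntervalRep A L) {v : Fin n} : v.val ∈ RamLang.compl n L ↔ v ∉ A := by
  rw [RamLang.compl, Finset.mem_filter, h.mem_iff, Finset.mem_range]
  exact ⟨fun hv hA => hv.2 ⟨v.2, hA⟩, fun hv => ⟨v.2, fun ⟨_, hA⟩ => hv hA⟩⟩

theorem eq_map_val {n : ℕ} {X : Finset ℕ} {Y : Finset (Fin n)} (hX : X ⊆ Finset.range n)
    (h : ∀ v : Fin n, v.val ∈ X ↔ v ∈ Y) : X = Y.map Fin.valEmbedding := by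
  ext x
  rw [Finset.mem_map]
  constructor
  · intro hx
    exact ⟨⟨x, Finset.mem_range.1 (hX hx)⟩, (h _).1 hx, rfl⟩
  · rintro ⟨v, hv, rfl⟩
    exact (h v).2 hv

theorem IsIntervalRep.card_compl {n : ℕ} {A : Set (Fin n)} {L : List (ℕ × ℕ)}
    (h : IsIntervalRep A L) : RamLang.gapSize n L = Aᶜ.ncard := by
  classical
  rw [(RamLang.gaps_spec h.isRep).2.2, eq_map_val (X := RamLang.compl n L)
    (Y := (Aᶜ).toFinset) (Finset.filter_subset _ _)
    (fun v => by rw [Set.mem_toFinset]; exact h.mem_compl),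
    Finset.card_map, Set.ncard_eq_toFinset_card']

/-- The orientation chosen by `larger`: the set `X` found by the algorithm is the strict side `Dᶜ`,
which has at most as many vertices as `Cᶜ`. -/
theorem exists_oriented {n : ℕ} {A B : Set (Fin n)} {L M : List (ℕ × ℕ)} (hA : IsIntervalRep A L)
    (hB : IsIntervalRep B M) : ∃ C D : Set (Fin n), s(C, D) = s(A, B) ∧ Dᶜ.ncard ≤ Cᶜ.ncard ∧
      (∀ v : Fin n, v.val ∈ RamLang.compl n (RamLang.larger n L M) ↔ v ∉ D) ∧
      ∀ v : Fin n, v.val ∈ RamLang.separator n L M ↔ v ∈ C ∩ D := by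
  have hS : ∀ v : Fin n, v.val ∈ RamLang.separator n L M ↔ v ∈ A ∩ B := fun v => by
    rw [RamLang.separator, Finset.mem_filter, hA.mem_compl, hB.mem_compl, not_not, not_not,
      Finset.mem_range]
    exact ⟨fun h => h.2, fun h => ⟨v.2, h⟩⟩
  by_cases h : RamLang.gapSize n M < RamLang.gapSize n L + 1
  · refine ⟨A, B, rfl, ?_, fun v => ?_, hS⟩
    · rw [← hA.card_compl, ← hB.card_compl]; omega
    · rw [RamLang.larger, if_pos h, hB.mem_compl]
  · refine ⟨B, A, Sym2.eq_swap, ?_, fun v => ?_, fun v => by rw [hS, Set.inter_comm]⟩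
    · rw [← hA.card_compl, ← hB.card_compl]; omega
    · rw [RamLang.larger, if_neg h, hA.mem_compl]

/-! ### Lists -/

theorem exists_map_val {n : ℕ} {L : List ℕ} (h : ∀ v ∈ L, v < n) :
    ∃ L' : List (Fin n), L'.map Fin.val = L :=
  ⟨L.pmap Fin.mk h, by simp [List.map_pmap]⟩

theorem exists_toWords {n : ℕ} {L : List (ℕ × ℕ)} (h : ∀ e ∈ L, e.1 < n ∧ e.2 < n) :
    ∃ L' : List (Fin n × Fin n), toWords L' = L :=
  ⟨L.pmap (fun e he => (⟨e.1, he.1⟩, ⟨e.2, he.2⟩)) h, by simp [toWords, List.map_pmap]⟩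

theorem mem_toWords {n : ℕ} {L : List (Fin n × Fin n)} {u v : Fin n} :
    (u.val, v.val) ∈ toWords L ↔ (u, v) ∈ L := by
  simp only [toWords, List.mem_map, Prod.mk.injEq, Fin.val_inj]
  constructor
  · rintro ⟨⟨a, b⟩, h, rfl, rfl⟩; exact h
  · intro h; exact ⟨_, h, rfl, rfl⟩

theorem listsEdges_of_lt {n : ℕ} {L : List (Fin n × Fin n)} {s : Set (Sym2 (Fin n))}
    (hnd : L.Nodup) (hL : ∀ u v, (u, v) ∈ L ↔ u < v ∧ s(u, v) ∈ s) (hs : ∀ u, s(u, u) ∉ s) :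
    ListsEdges L s := by
  refine ⟨List.Nodup.map_on ?_ hnd, ?_⟩
  · rintro ⟨a, b⟩ h1 ⟨c, d⟩ h2 e
    rw [hL] at h1 h2
    rcases Sym2.eq_iff.1 e with ⟨rfl, rfl⟩ | ⟨h3, h4⟩
    · rfl
    · simp only at h3 h4
      subst h3 h4
      exact absurd h1.1 h2.1.not_gt
  · intro e
    induction e with
    | _ a b =>
      rw [List.mem_map]
      constructor
      · rintro ⟨⟨u, v⟩, h1, h2⟩
        exact h2 ▸ ((hL u v).1 h1).2
      · intro h
        rcases lt_trichotomy a b with h1 | rfl | h1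
        · exact ⟨(a, b), (hL a b).2 ⟨h1, h⟩, rfl⟩
        · exact absurd h (hs a)
        · exact ⟨(b, a), (hL b a).2 ⟨h1, by rwa [Sym2.eq_swap]⟩, Sym2.eq_swap⟩

theorem ListsEdges.mem_iff {n : ℕ} {G : SimpleGraph (Fin n)} {E : List (Fin n × Fin n)}
    (h : ListsEdges E G.edgeSet) {u v : Fin n} :
    (∃ e ∈ toWords E, u.val = min e.1 e.2 ∧ v.val = max e.1 e.2) ↔ u < v ∧ G.Adj u v := by
  have hE : ∀ a b, G.Adj a b ↔ ∃ e ∈ E, s(e.1, e.2) = s(a, b) := fun a b => by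
    rw [← SimpleGraph.mem_edgeSet, ← h.2, List.mem_map]
  rw [hE]
  constructor
  · rintro ⟨_, he, h1, h2⟩
    obtain ⟨⟨a, b⟩, he', rfl⟩ := List.mem_map.1 he
    simp only at h1 h2
    have hab : a ≠ b := ((hE a b).2 ⟨_, he', rfl⟩).ne
    rcases lt_or_gt_of_ne hab with hlt | hlt
    · have hlt' : a.val < b.val := hlt
      obtain rfl : u = a := Fin.ext (by omega)
      obtain rfl : v = b := Fin.ext (by omega)
      exact ⟨hlt, _, he', rfl⟩
    · have hlt' : b.val < a.val := hlt
      obtain rfl : u = b := Fin.ext (by omega)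
      obtain rfl : v = a := Fin.ext (by omega)
      exact ⟨hlt, _, he', Sym2.eq_swap⟩
  · rintro ⟨hlt, ⟨a, b⟩, he, e⟩
    have hlt' : u.val < v.val := hlt
    refine ⟨(a.val, b.val), mem_toWords.2 he, ?_⟩
    rcases Sym2.eq_iff.1 e with ⟨h1, h2⟩ | ⟨h1, h2⟩ <;> simp only at h1 h2 <;> subst h1 h2 <;>
      simp only <;> omega

theorem ListsEdges.length_eq {n : ℕ} {G : SimpleGraph (Fin n)} {E : List (Fin n × Fin n)}
    (h : ListsEdges E G.edgeSet) : E.length = G.edgeSet.ncard := by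
  classical
  have h1 : G.edgeSet = ((E.map fun e => s(e.1, e.2)).toFinset : Set (Sym2 (Fin n))) := by
    ext e
    rw [← h.2, List.coe_toFinset, Set.mem_ofPred_eq]
  rw [h1, Set.ncard_coe_finset, List.toFinset_card_of_nodup h.1, List.length_map]

theorem flatMap_range {α : Type*} (n : ℕ) (f : ℕ → List α) :
    (List.range n).flatMap f = (List.finRange n).flatMap fun i : Fin n => f i := by
  rw [← List.map_coe_finRange_eq_range, List.flatMap_map]

end SepTree

/-! ### From numbers to the tree-decomposition -/

namespace SepTree

open RamLang Laminar

section

variable {n p : ℕ} {G : SimpleGraph (Fin n)} {XF SF : Fin (p + 1) → Finset (Fin n)}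
  {X : ℕ → Finset ℕ}

/-- The algorithm works with sets of numbers, `Laminar.Family` with finite sets over `Fin n` indexed
by `Fin (p + 1)`; here and below, `X` is the image of `XF`. -/
theorem isLaminar_of_fin (hroot : XF (Fin.last p) = Finset.univ)
    (hX : ∀ t : Fin (p + 1), X t = (XF t).map Fin.valEmbedding)
    (hcases : ∀ a b, a ≠ b → XF a ⊂ XF b ∨ XF b ⊂ XF a ∨ Disjoint (XF a) (XF b))
    (hsub : ∀ i : Fin p, XF i.castSucc ⊂ Finset.univ) : IsLaminar n p X := by
  have hu : Finset.range n = (Finset.univ : Finset (Fin n)).map Fin.valEmbedding := by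
    ext x; simp
  refine ⟨?_, fun i hi => ?_, fun i hi j hj hij => ?_⟩
  · rw [hu, ← hroot]; exact hX (Fin.last p)
  · have := hX (Fin.castSucc ⟨i, hi⟩)
    simp only [Fin.val_castSucc] at this
    rw [this, hu, Finset.map_ssubset_map]
    exact hsub ⟨i, hi⟩
  · have h1 := hX ⟨i, by omega⟩
    have h2 := hX ⟨j, by omega⟩
    simp only at h1 h2
    rw [h1, h2, Finset.map_ssubset_map, Finset.map_ssubset_map, Finset.disjoint_map]
    exact hcases _ _ fun e => hij (congrArg Fin.val e)

/-- Parents and homes computed as numbers form, over `Fin`, a family in the sense of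
`Laminar.Family`. The parent of the root is irrelevant. -/
theorem exists_family (hroot : XF (Fin.last p) = Finset.univ)
    (hX : ∀ t : Fin (p + 1), X t = (XF t).map Fin.valEmbedding)
    (hS : ∀ t x, x ∈ SF t ↔ x ∉ XF t ∧ ∃ y ∈ XF t, G.Adj x y) (hne : ∀ t, (XF t).Nonempty)
    (hcases : ∀ a b, a ≠ b → XF a ⊂ XF b ∨ XF b ⊂ XF a ∨
      Disjoint (XF a) (XF b) ∧ Disjoint (XF a) (SF b) ∧ Disjoint (XF b) (SF a))
    {par home : ℕ → ℕ} (hpar : ∀ i < p, IsPar p X (par i) i)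
    (hhome : ∀ x < n, IsHome p X (home x) x) :
    ∃ (parF : Fin (p + 1) → Fin (p + 1)) (homeF : Fin n → Fin (p + 1)),
      (∀ i : Fin p, (parF i.castSucc).val = par i) ∧ (∀ v, (homeF v).val = home v) ∧
      Family G XF SF (Fin.last p) parF homeF := by
  have hP : ∀ t : Fin (p + 1), ∃ c : Fin (p + 1), t ≠ Fin.last p → c.val = par t := by
    intro t
    by_cases ht : t = Fin.last p
    · exact ⟨t, fun h => absurd ht h⟩
    · have := (hpar t (Fin.val_lt_last ht)).1
      exact ⟨⟨par t, by omega⟩, fun _ => rfl⟩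
  have hH : ∀ v : Fin n, ∃ c : Fin (p + 1), c.val = home v := fun v => by
    have := (hhome v v.2).1
    exact ⟨⟨home v, by omega⟩, rfl⟩
  choose parF hparF using hP
  choose homeF hhomeF using hH
  refine ⟨parF, homeF, fun i => by simpa using hparF i.castSucc (Fin.castSucc_ne_last i), hhomeF,
    ⟨hroot, hS, hne, hcases, ?_, ?_, ?_, ?_⟩⟩
  · intro t ht
    have := (hpar t (Fin.val_lt_last ht)).2.1
    rwa [← hparF t ht, hX, hX, Finset.map_ssubset_map] at this
  · intro t ht j hj
    have := (hpar t (Fin.val_lt_last ht)).2.2 j (by omega)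
    rw [← hparF t ht, hX, hX, hX, Finset.map_ssubset_map, Finset.map_subset_map] at this
    exact this hj
  · intro x
    have := (hhome x x.2).2.1
    rw [← hhomeF, hX] at this
    exact (Finset.mem_map' Fin.valEmbedding).1 this
  · intro x j hj
    have := (hhome x x.2).2.2 j (by omega)
    rw [← hhomeF, hX, hX, Finset.map_subset_map] at this
    exact this ((Finset.mem_map' Fin.valEmbedding).2 hj)

/-- The numbers computed by the algorithm encode the tree-decomposition defined by the laminar
family, and its torsos. -/
theorem isDecompositionOutput_of_family {parF : Fin (p + 1) → Fin (p + 1)}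
    {homeF : Fin n → Fin (p + 1)} {S : ℕ → Finset ℕ} {E : List (Fin n × Fin n)}
    {par home : ℕ → ℕ} {bags : ℕ → List ℕ} {torsos : ℕ → List (ℕ × ℕ)}
    {𝒮 : Set (Sym2 (Set (Fin n)))} (hF : Family G XF SF (Fin.last p) parF homeF)
    (hX : ∀ t : Fin (p + 1), X t = (XF t).map Fin.valEmbedding)
    (hS : ∀ t : Fin (p + 1), S t = (SF t).map Fin.valEmbedding)
    (hE : ListsEdges E G.edgeSet)
    (hinj : Set.InjOn (fun t => s(((XF t ∪ SF t : Finset _) : Set (Fin n)),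
      ((XF t : Finset _) : Set (Fin n))ᶜ)) {t | t ≠ Fin.last p})
    (h𝒮 : (fun t => s(((XF t ∪ SF t : Finset _) : Set (Fin n)),
      ((XF t : Finset _) : Set (Fin n))ᶜ)) '' {t | t ≠ Fin.last p} = 𝒮)
    (hparF : ∀ i : Fin p, (parF i.castSucc).val = par i) (hhomeF : ∀ v, (homeF v).val = home v)
    (hbags : ∀ t, (bags t).Nodup ∧ ∀ v, v ∈ bags t ↔ v < n ∧ home v = t ∨ t < p ∧ v ∈ S t)
    (htorsos : ∀ t, (torsos t).Nodup ∧ ∀ u v, (u, v) ∈ torsos t ↔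
      t < p ∧ u ∈ S t ∧ v ∈ S t ∧ u < v ∨
        ((∃ e ∈ toWords E, u = min e.1 e.2 ∧ v = max e.1 e.2) ∨
          ∃ i < p, u ∈ S i ∧ v ∈ S i ∧ u < v) ∧
          topNode (fun t => (X t).card) home u v = t) :
    IsDecompositionOutput G 𝒮 ((p + 1) ::
      pairBlock ((List.range p).map fun i => (i, par i)).reverse ++
      ((List.range (p + 1)).flatMap fun t => block (bags t)) ++
      (List.range (p + 1)).flatMap (fun t => pairBlock (torsos t))) := by
  have hSmem : ∀ (t : Fin (p + 1)) (v : Fin n), v.val ∈ S t ↔ v ∈ SF t := fun t v => by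
    rw [hS]; exact Finset.mem_map' Fin.valEmbedding
  have hSn : ∀ t < p, ∀ v ∈ S t, v < n := fun t ht v hv => by
    have := hS ⟨t, by omega⟩
    simp only at this
    rw [this, Finset.mem_map] at hv
    obtain ⟨w, -, rfl⟩ := hv
    exact w.2
  have hSlast : ∀ t : Fin (p + 1), (∃ v, v ∈ SF t) → t.val < p := by
    rintro t ⟨v, hv⟩
    refine Fin.val_lt_last fun e => ?_
    have := ((hF.mem_S t v).1 hv).1
    rw [e, hF.root_X] at this
    exact this (Finset.mem_univ v)
  have htop : ∀ (u v : Fin n) (t : Fin (p + 1)),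
      topNode (fun t => (X t).card) home u v = t ↔ top XF homeF u v = t := by
    intro u v t
    have : topNode (fun t => (X t).card) home u v = (top XF homeF u v).val := by
      simp only [topNode, top, ← hhomeF, hX, Finset.card_map]
      split <;> rfl
    rw [this, Fin.val_inj]
  -- the lists of vertices and edges
  have hB : ∀ t : Fin (p + 1), ∃ L : List (Fin n), L.map Fin.val = bags t := fun t =>
    exists_map_val fun v hv => by
      rcases ((hbags t).2 v).1 hv with h | h
      · exact h.1
      · exact hSn t h.1 v h.2
  have hT : ∀ t : Fin (p + 1), ∃ L : List (Fin n × Fin n), toWords L = torsos t := fun t =>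
    exists_toWords fun e he => by
      rcases ((htorsos t).2 e.1 e.2).1 he with h | ⟨⟨e', he', h1, h2⟩ | ⟨i, hi, h1, h2, -⟩, -⟩
      · exact ⟨hSn t h.1 _ h.2.1, hSn t h.1 _ h.2.2.1⟩
      · obtain ⟨⟨a, b⟩, -, rfl⟩ := List.mem_map.1 he'
        simp only at h1 h2
        omega
      · exact ⟨hSn i hi _ h1, hSn i hi _ h2⟩
  choose bagList hbagList using hB
  choose torsoList htorsoList using hT
  refine ⟨p + 1, tree (Fin.last p) parF, bag SF homeF,
    ((List.finRange p).map fun i => (i.castSucc, parF i.castSucc)).reverse, bagList, torsoList,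
    hF.isTreeDecomposition, h𝒮 ▸ hF.induces hinj, ⟨?_, ?_⟩, fun t => ⟨?_, ?_⟩, fun t => ?_, ?_⟩
  · rw [List.map_reverse, List.nodup_reverse, List.map_map]
    refine List.Nodup.map_on ?_ (List.nodup_finRange p)
    intro a _ b _ e
    exact Fin.castSucc_injective p (hF.edge_injOn (Fin.castSucc_ne_last a)
      (Fin.castSucc_ne_last b) e)
  · intro e
    rw [hF.edgeSet_tree, List.map_reverse, List.mem_reverse, List.map_map, List.mem_map]
    constructor
    · rintro ⟨i, -, rfl⟩
      exact ⟨i.castSucc, Fin.castSucc_ne_last i, rfl⟩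
    · rintro ⟨t, ht, rfl⟩
      obtain ⟨i, rfl⟩ := Fin.exists_castSucc_eq.2 ht
      exact ⟨i, List.mem_finRange i, rfl⟩
  · exact List.Nodup.of_map Fin.val (by rw [hbagList]; exact (hbags t).1)
  · intro v
    have h1 : v ∈ bagList t ↔ v.val ∈ bags t := by
      rw [← hbagList, List.mem_map_of_injective Fin.val_injective]
    rw [h1, (hbags t).2, hSmem, bag, Set.mem_ofPred_eq, ← hhomeF, Fin.val_inj]
    exact or_congr (and_iff_right v.2) (and_iff_right_of_imp fun h => hSlast t ⟨v, h⟩)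
  · refine listsEdges_of_lt ?_ ?_ ?_
    · exact List.Nodup.of_map (fun e : Fin n × Fin n => (e.1.val, e.2.val))
        (by rw [← toWords, htorsoList]; exact (htorsos t).1)
    · intro u v
      rw [← mem_toWords, htorsoList, (htorsos t).2, hE.mem_iff, htop, hSmem, hSmem,
        SimpleGraph.Subgraph.mem_edgeSet, hF.torso_adj_iff, Fin.val_fin_lt]
      have h1 : (∃ i < p, u.val ∈ S i ∧ v.val ∈ S i ∧ u < v) ↔
          u < v ∧ ∃ i, u ∈ SF i ∧ v ∈ SF i := by
        constructor
        · rintro ⟨i, hi, h1, h2, h3⟩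
          exact ⟨h3, ⟨i, by omega⟩, (hSmem ⟨i, by omega⟩ u).1 h1, (hSmem ⟨i, by omega⟩ v).1 h2⟩
        · rintro ⟨h3, i, h1, h2⟩
          exact ⟨i, hSlast i ⟨u, h1⟩, (hSmem i u).2 h1, (hSmem i v).2 h2, h3⟩
      have h2 : u ∈ SF t → t.val < p := fun h => hSlast t ⟨u, h⟩
      rw [h1]
      constructor
      · rintro (⟨-, hu, hv, huv⟩ | ⟨⟨huv, hadj⟩ | ⟨huv, hi⟩, ht⟩)
        · exact ⟨huv, huv.ne, .inl ⟨hu, hv⟩⟩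
        · exact ⟨huv, huv.ne, .inr ⟨.inl hadj, ht⟩⟩
        · exact ⟨huv, huv.ne, .inr ⟨.inr hi, ht⟩⟩
      · rintro ⟨huv, -, ⟨hu, hv⟩ | ⟨hadj | hi, ht⟩⟩
        · exact .inl ⟨h2 hu, hu, hv, huv⟩
        · exact .inr ⟨.inl ⟨huv, hadj⟩, ht⟩
        · exact .inr ⟨.inr ⟨huv, hi⟩, ht⟩
    · intro u h
      exact (SimpleGraph.Subgraph.mem_edgeSet.1 h).1 rfl
  · rw [encodeOutput, flatMap_range, flatMap_range]
    congr 1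
    · congr 1
      · congr 2
        simp only [toWords, List.map_reverse, List.map_map]
        rw [← List.map_coe_finRange_eq_range, List.map_map]
        congr 2
        funext i
        simp [hparF]
      · simp only [hbagList]
    · simp only [htorsoList]

end

end SepTree

namespace SepTree

open RamLang Laminar

/-- The length of the input, and the size of its words, in terms of the parameters. -/
theorem encodeInput_bounds {n p l N : ℕ} {E : List (Fin n × Fin n)}
    {repA repB : Fin p → List (ℕ × ℕ)} {A B : Fin p → Set (Fin n)}
    (hA : ∀ i, IsIntervalRep (A i) (repA i)) (hB : ∀ i, IsIntervalRep (B i) (repB i))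
    (hlen : ∀ i, (repA i).length + (repB i).length ≤ l) (hN : n + E.length + p * l ≤ N)
    (hpl : p ≤ p * l) :
    (encodeInput n E p repA repB).length ≤ 3 + 6 * N ∧
      ∀ a ∈ encodeInput n E p repA repB, a ≤ N := by
  have hl : ∀ _ : Fin p, l ≤ p * l := fun i => Nat.le_mul_of_pos_left l i.pos
  have hrep : ∀ (L : List (ℕ × ℕ)) (C : Set (Fin n)), IsIntervalRep C L → L.length ≤ N →
      ∀ a ∈ pairBlock L, a ≤ N := by
    intro L C hC hL a ha
    rw [pairBlock, List.mem_cons, List.mem_flatMap] at ha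
    rcases ha with rfl | ⟨I, hI, ha⟩
    · exact hL
    · have h1 := hC.isRep.le I hI
      have h2 := hC.isRep.lt I hI
      simp only [List.mem_cons, List.not_mem_nil, or_false] at ha
      omega
  constructor
  · have h1 : ((List.finRange p).flatMap fun i => pairBlock (repA i) ++ pairBlock (repB i)).length ≤
        p * (2 + 2 * l) := by
      rw [List.length_flatMap]
      refine (List.sum_le_card_nsmul _ (2 + 2 * l) ?_).trans (by simp)
      intro m hm
      obtain ⟨i, -, rfl⟩ := List.mem_map.1 hm
      have := hlen i
      rw [List.length_append, length_pairBlock, length_pairBlock]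
      omega
    rw [encodeInput, List.length_append, List.length_cons, List.length_cons, length_pairBlock,
      toWords, List.length_map]
    have h2 : p * (2 + 2 * l) = 2 * p + 2 * (p * l) := by ring
    omega
  · intro a ha
    rw [encodeInput, List.mem_append, List.mem_cons, List.mem_cons, List.mem_flatMap] at ha
    rcases ha with (rfl | ha) | rfl | ⟨i, -, ha⟩
    · omega
    · rw [pairBlock, List.mem_cons, List.mem_flatMap] at ha
      rcases ha with rfl | ⟨I, hI, ha⟩
      · rw [toWords, List.length_map]; omega
      · obtain ⟨⟨u, v⟩, -, rfl⟩ := List.mem_map.1 hI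
        simp only [List.mem_cons, List.not_mem_nil, or_false] at ha
        omega
    · omega
    · have h1 := hl i
      have h2 := hlen i
      rcases List.mem_append.1 ha with ha | ha
      · exact hrep _ _ (hA i) (by omega) a ha
      · exact hrep _ _ (hB i) (by omega) a ha

/-- One run of the compiled algorithm. The constant is the one of `algorithm_spec` times the
slowdown of the compilation, generously rounded. -/
theorem exists_run {n : ℕ} {G : SimpleGraph (Fin n)} {E : List (Fin n × Fin n)}
    {p k l : ℕ} {A B : Fin p → Set (Fin n)} {repA repB : Fin p → List (ℕ × ℕ)}
    (hG : G.Connected) (hE : ListsEdges E G.edgeSet)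
    (hsep : ∀ i, IsMinimalSeparation G (A i) (B i))
    (hinj : Function.Injective (fun i => s(A i, B i)))
    (hnest : ∀ i j, Nested (A i) (B i) (A j) (B j)) (hk : ∀ i, (A i ∩ B i).ncard ≤ k)
    (hrA : ∀ i, IsIntervalRep (A i) (repA i)) (hrB : ∀ i, IsIntervalRep (B i) (repB i))
    (hlen : ∀ i, (repA i).length + (repB i).length ≤ l) :
    ∃ (t : ℕ) (s : WordRAM.State) (out : List ℕ),
      t ≤ 2000000000000 * (n + G.edgeSet.ncard + p * l + p * k ^ 2) ∧
      WordRAM.Exec (2000000000000 * (n + G.edgeSet.ncard + p * l + p * k ^ 2))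
        (program algorithm) (WordRAM.initState (encodeInput n E p repA repB)) t s ∧
      s.Outputs out ∧ IsDecompositionOutput G (Set.range fun i => s(A i, B i)) out := by
  classical
  have hn : 1 ≤ n := by
    obtain ⟨v⟩ := hG.nonempty
    exact v.pos
  -- a side of a separation is nonempty, so its representation has positive length
  have hpl : p ≤ p * l := by
    rcases Nat.eq_zero_or_pos p with h0 | h0
    · simp [h0]
    · obtain ⟨x, hx⟩ := (hsep ⟨0, h0⟩).left_nonempty
      obtain ⟨I, hI, -⟩ := ((hrA ⟨0, h0⟩).mem_iff x).2 ⟨x.2, hx.1⟩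
      have h1 := List.length_pos_of_mem hI
      have h2 := hlen ⟨0, h0⟩
      exact Nat.le_mul_of_pos_right p (by omega)
  obtain ⟨N, hN⟩ : ∃ N, N = n + G.edgeSet.ncard + p * l + p * k ^ 2 := ⟨_, rfl⟩
  rw [← hN]
  rw [← hE.length_eq] at hN
  -- the oriented separations
  have hor := fun i => exists_oriented (hrA i) (hrB i)
  choose C D hCD hcard hX hS using hor
  have hm : ∀ i, IsMinimalSeparation G (C i) (D i) := fun i => (hsep i).congr (hCD i)
  have hinj' : Function.Injective fun i => s(C i, D i) := fun i j e => hinj (by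
    simp only [hCD] at e
    exact e)
  have hcases : ∀ i j, i ≠ j → _ := fun i j hij => (hm i).cases (hm j)
    ((hnest i j).congr (hCD i) (hCD j)) (fun e => hij (hinj' e)) (hcard i) (hcard j)
  -- the sets and their boundaries, on `Fin n` and as sets of numbers
  obtain ⟨XF, hXF⟩ : ∃ XF : Fin (p + 1) → Finset (Fin n),
    XF = Fin.lastCases Finset.univ fun i => (D i)ᶜ.toFinset := ⟨_, rfl⟩
  obtain ⟨SF, hSF⟩ : ∃ SF : Fin (p + 1) → Finset (Fin n),
    SF = Fin.lastCases ∅ fun i => (C i ∩ D i).toFinset := ⟨_, rfl⟩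
  have hXl : XF (Fin.last p) = Finset.univ := by simp [hXF]
  have hSl : SF (Fin.last p) = ∅ := by simp [hSF]
  have hXc : ∀ i : Fin p, XF i.castSucc = (D i)ᶜ.toFinset := fun i => by
    simp [hXF]
  have hSc : ∀ i : Fin p, SF i.castSucc = (C i ∩ D i).toFinset := fun i => by
    simp [hSF]
  have hsub : ∀ i : Fin p, XF i.castSucc ⊂ Finset.univ := fun i => by
    obtain ⟨x, hx⟩ := (hm i).right_nonempty
    refine Finset.ssubset_univ_iff.2 fun e => ?_
    have : x ∈ XF i.castSucc := e ▸ Finset.mem_univ x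
    rw [hXc, Set.mem_toFinset] at this
    exact this hx.1
  have hne : ∀ t, (XF t).Nonempty := fun t => by
    induction t using Fin.lastCases with
    | last =>
      rw [hXl]
      exact ⟨⟨0, hn⟩, Finset.mem_univ _⟩
    | cast i =>
      obtain ⟨x, hx⟩ := (hm i).left_nonempty
      exact ⟨x, by rw [hXc, Set.mem_toFinset]; exact hx.2⟩
  have hbd : ∀ t x, x ∈ SF t ↔ x ∉ XF t ∧ ∃ y ∈ XF t, G.Adj x y := fun t x => by
    induction t using Fin.lastCases with
    | last => simp [hXl, hSl]
    | cast i =>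
      simp only [hXc, hSc, Set.mem_toFinset]
      exact (hm i).mem_inter_iff
  have hlam : ∀ a b, a ≠ b → XF a ⊂ XF b ∨ XF b ⊂ XF a ∨
      Disjoint (XF a) (XF b) ∧ Disjoint (XF a) (SF b) ∧ Disjoint (XF b) (SF a) := by
    intro a b hab
    induction a using Fin.lastCases with
    | last =>
      induction b using Fin.lastCases with
      | last => exact absurd rfl hab
      | cast j => exact .inr (.inl (hXl ▸ hsub j))
    | cast i =>
      induction b using Fin.lastCases with
      | last => exact .inl (hXl ▸ hsub i)
      | cast j =>
        simp only [hXc, hSc, Set.toFinset_ssubset_toFinset, Set.disjoint_toFinset]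
        exact hcases i j fun e => hab (e ▸ rfl)
  obtain ⟨X, hXdef⟩ : ∃ X : ℕ → Finset ℕ, X = fun t =>
    if h : t < p + 1 then (XF ⟨t, h⟩).map Fin.valEmbedding else ∅ := ⟨_, rfl⟩
  obtain ⟨S, hSdef⟩ : ∃ S : ℕ → Finset ℕ, S = fun t =>
    if h : t < p + 1 then (SF ⟨t, h⟩).map Fin.valEmbedding else ∅ := ⟨_, rfl⟩
  have hXm : ∀ t : Fin (p + 1), X t = (XF t).map Fin.valEmbedding := fun t => by
    rw [hXdef]; exact dif_pos t.isLt
  have hSm : ∀ t : Fin (p + 1), S t = (SF t).map Fin.valEmbedding := fun t => by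
    rw [hSdef]; exact dif_pos t.isLt
  obtain ⟨rA, hrA'⟩ : ∃ r : ℕ → List (ℕ × ℕ), r = fun i => if h : i < p then repA ⟨i, h⟩ else [] :=
    ⟨_, rfl⟩
  obtain ⟨rB, hrB'⟩ : ∃ r : ℕ → List (ℕ × ℕ), r = fun i => if h : i < p then repB ⟨i, h⟩ else [] :=
    ⟨_, rfl⟩
  have eA : ∀ i : Fin p, rA i = repA i := fun i => by simp [hrA']
  have eB : ∀ i : Fin p, rB i = repB i := fun i => by simp [hrB']
  have hXi : ∀ i : Fin p, X i = compl n (larger n (rA i) (rB i)) := fun i => by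
    have := hXm i.castSucc
    rw [Fin.val_castSucc] at this
    rw [this, eA, eB]
    symm
    refine eq_map_val (Finset.filter_subset _ _) fun v => ?_
    rw [hX, hXc, Set.mem_toFinset, Set.mem_compl_iff]
  have hSi : ∀ i : Fin p, S i = separator n (rA i) (rB i) := fun i => by
    have := hSm i.castSucc
    rw [Fin.val_castSucc] at this
    rw [this, eA, eB]
    symm
    refine eq_map_val (Finset.filter_subset _ _) fun v => ?_
    rw [hS, hSc, Set.mem_toFinset]
  have hin : encodeInput n E p repA repB = n :: pairBlock (toWords E) ++
      p :: (List.range p).flatMap fun i => pairBlock (rA i) ++ pairBlock (rB i) := by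
    rw [flatMap_range, encodeInput]
    simp only [eA, eB]
  -- running the algorithm
  obtain ⟨par, home, bags, torsos, hpar, hhome, hbags, htorsos, hout, htm⟩ :=
    algorithm_spec (k := k) hin (fun i hi => hXi ⟨i, hi⟩) (fun i hi => hSi ⟨i, hi⟩)
      (isLaminar_of_fin hXl hXm (fun a b hab => by
        rcases hlam a b hab with h | h | h
        exacts [.inl h, .inr (.inl h), .inr (.inr h.1)]) hsub)
      (fun i hi => by
        have := hXm ⟨i, by omega⟩
        simp only at this
        rw [this, Finset.map_nonempty]
        exact hne _)
      (fun i hi => eA ⟨i, hi⟩ ▸ (hrA ⟨i, hi⟩).isRep) (fun i hi => eB ⟨i, hi⟩ ▸ (hrB ⟨i, hi⟩).isRep)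
      (fun i hi => by
        rw [eA ⟨i, hi⟩, eB ⟨i, hi⟩, Finset.disjoint_left]
        intro x hxA hxB
        have hxn : x < n := Finset.mem_range.1 (Finset.filter_subset _ _ hxA)
        rw [(hrA _).mem_compl (v := ⟨x, hxn⟩)] at hxA
        rw [(hrB _).mem_compl (v := ⟨x, hxn⟩)] at hxB
        have := (hsep ⟨i, hi⟩).cover ▸ Set.mem_univ (⟨x, hxn⟩ : Fin n)
        exact this.elim hxA hxB)
      (fun i hi => by rw [eA ⟨i, hi⟩, eB ⟨i, hi⟩]; exact hlen _)
      (fun i hi => by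
        have h1 := hSm ⟨i, by omega⟩
        have h2 := hSc ⟨i, hi⟩
        simp only [Fin.castSucc_mk] at h1 h2
        rw [h1, h2, Finset.card_map, ← Set.ncard_eq_toFinset_card']
        refine le_trans (le_of_eq ?_) (hk ⟨i, hi⟩)
        congr 1
        rcases Sym2.eq_iff.1 (hCD ⟨i, hi⟩) with ⟨h3, h4⟩ | ⟨h3, h4⟩
        · rw [h3, h4]
        · rw [h3, h4, Set.inter_comm])
      (fun e he => by
        obtain ⟨e', -, rfl⟩ := List.mem_map.1 he
        exact ⟨e'.1.2, e'.2.2⟩) hn hpl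
  rw [toWords, List.length_map, ← hN] at htm
  obtain ⟨hil, hiw⟩ := encodeInput_bounds (N := N) (E := E) hrA hrB hlen (by omega) hpl
  obtain ⟨t, s, hex, ht, hos⟩ := exec_program algorithm (n := n) (p := p) (E := toWords E)
    (bs := (List.finRange p).flatMap fun i => [repA i, repB i])
    (W := 2000000000000 * N)
    (by rw [List.length_flatMap]; simp; omega)
    (by rw [inputWords, encodeInput, List.flatMap_assoc]; simp) hiw (by omega)
  refine ⟨t, s, _, by omega, hex, hos, ?_⟩
  -- the output is correct
  obtain ⟨parF, homeF, hparF, hhomeF, hF⟩ := exists_family hXl hXm hbd hne hlam hpar hhome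
  have hsepF : ∀ i : Fin p, s(((XF i.castSucc ∪ SF i.castSucc : Finset _) : Set (Fin n)),
      ((XF i.castSucc : Finset _) : Set (Fin n))ᶜ) = s(A i, B i) := by
    intro i
    rw [← hCD, hXc, hSc, Finset.coe_union, Set.coe_toFinset, Set.coe_toFinset, compl_compl,
      (hm i).compl_eq, Set.sdiff_union_inter]
  rw [hout]
  refine isDecompositionOutput_of_family hF hXm hSm hE ?_ ?_ hparF hhomeF hbags htorsos
  · intro a ha b hb e
    obtain ⟨i, rfl⟩ := Fin.exists_castSucc_eq.2 ha
    obtain ⟨j, rfl⟩ := Fin.exists_castSucc_eq.2 hb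
    simp only [hsepF] at e
    rw [hinj e]
  · ext e
    constructor
    · rintro ⟨a, ha, rfl⟩
      obtain ⟨i, rfl⟩ := Fin.exists_castSucc_eq.2 ha
      exact ⟨i, (hsepF i).symm⟩
    · rintro ⟨i, rfl⟩
      exact ⟨i.castSucc, Fin.castSucc_ne_last i, hsepF i⟩

end SepTree

theorem mainTheorem5 :
    ∃ (P : WordRAM.Prog) (c : ℕ),
      ∀ (n : ℕ) (G : SimpleGraph (Fin n)) (E : List (Fin n × Fin n))
        (p k l : ℕ) (A B : Fin p → Set (Fin n)) (repA repB : Fin p → List (ℕ × ℕ)),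
        G.Connected →
        SepTree.ListsEdges E G.edgeSet →
        (∀ i, SepTree.IsMinimalSeparation G (A i) (B i)) →
        Function.Injective (fun i => s(A i, B i)) →
        (∀ i j, SepTree.Nested (A i) (B i) (A j) (B j)) →
        (∀ i, (A i ∩ B i).ncard ≤ k) →
        (∀ i, SepTree.IsIntervalRep (A i) (repA i)) →
        (∀ i, SepTree.IsIntervalRep (B i) (repB i)) →
        (∀ i, (repA i).length + (repB i).length ≤ l) →
        ∃ (t : ℕ) (s : WordRAM.State) (out : List ℕ),
          t ≤ c * (n + G.edgeSet.ncard + p * l + p * k ^ 2) ∧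
          WordRAM.Exec (c * (n + G.edgeSet.ncard + p * l + p * k ^ 2)) P
            (WordRAM.initState (SepTree.encodeInput n E p repA repB)) t s ∧
          s.Outputs out ∧
          SepTree.IsDecompositionOutput G (Set.range fun i => s(A i, B i)) out := by
  exact ⟨RamLang.program RamLang.algorithm, 2000000000000,
    fun _ _ _ _ _ _ _ _ _ _ hG hE hsep hinj hnest hk hrA hrB hlen =>
      SepTree.exists_run hG hE hsep hinj hnest hk hrA hrB hlen⟩
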